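/- **Setting.** Let $d\in\{1,2,3\}$ (any $d\ge 1$ is allowed), $\Omega=(0,1)^d$, $\alpha\in(0,1)$, $T>0$ arbitrary. Consider $$D_t^\alpha u+\mathcal Lu+f(x,t,u)=0\ \text{ in }\Omega\times(0,T],\qquad u=0\ \text{ on }\partial\Omega\times(0,T],\qquad u(\cdot,0)=u_0\ \text{ in }\Omega,$$ where $D_t^\alpha u=\frac1{\Gamma(1-\alpha)}\int_0^t(t-s)^{-\alpha}\partial_su(\cdot,s)\,ds$, $u_0\in L_\infty(\Omega)$ (with values prescribed on $\bar\Omega$) and $$\mathcal Lv=\sum_{k=1}^d\{-\partial_{x_k}(a_k\partial_{x_k}v)+b_k\partial_{x_k}v\}+cv .$$ The coefficients satisfy $a_k(\cdot,t)\in C^3(\bar\Omega)$, $b_k(\cdot,t)\in C^1(\bar\Omega)$, $c(\cdot,t)\in C(\bar\Omega)$ with bounds uniform in $t\in(0,T]$, and $a_k>0$, $c\ge0$, $c-\frac12\sum_k\partial_{x_k}b_k\ge0$. *A1 (with constant $\lambda\ge0$):* $f$ is continuous in $s$, $f(\cdot,t,s)\in L_\infty(\Omega)$, and $f(x,t,s_1)-f(x,t,s_2)\ge-\lambda(s_1-s_2)$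 for all $s_1\ge s_2$, $x\in\Omega$, $t\in(0,T]$. *A2:* $\sigma_1\le0\le\sigma_2$ are constants with $f(\cdot,\cdot,\sigma_1)\le0\le f(\cdot,\cdot,\sigma_2)$ in $\Omega\times(0,T]$, and $c=0$. **Discretization.** For a temporal mesh $0=t_0<\dots<t_M=T$, $M\ge 1$, $\tau_j=t_j-t_{j-1}$, let $$\delta_t^\alpha U^m=\frac1{\Gamma(1-\alpha)}\sum_{j=1}^m\frac{U^j-U^{j-1}}{\tau_j}\int_{t_{j-1}}^{t_j}(t_m-s)^{-\alpha}ds .$$ Let $h=1/N$, $N\ge1$, let $\bar\Omega_h$ be the tensor product of the meshes $\{ih\}_{i=0}^N$, $\Omega_h=\bar\Omega_h\setminus\partial\Omega$, let $\mathbf i_k$ be the standard basis vectors, and at time $t=t_m$ let $$\mathcal L_hV(z)=\sum_k h^{-2}\{a_k(z+\tfrac h2\mathbf i_k,t_m)[V(z)-V(z+h\mathbf i_k)]+a_k(z-\tfrac h2\mathbf i_k,t_m)[V(z)-V(z-h\mathbf i_k)]\}+\sum_k\tfrac1{2h}b_k(z,t_m)[V(z+h\mathbf i_k)-V(z-h\mathbf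 i_k)]+c(z,t_m)V(z).$$ The discrete problem is: $\delta_t^\alpha U^m+\mathcal L_hU^m+f(\cdot,t_m,U^m)=0$ in $\Omega_h$ and $U^m=0$ on $\bar\Omega_h\cap\partial\Omega$ for $1\le m\le M$, and $U^0=u_0$ on $\bar\Omega_h$. Assume throughout the discrete maximum principle condition $$h^{-1}\ge\max_k\tfrac12\|b_k(\cdot,t)\|_{L_\infty(\Omega)}\|a_k(\cdot,t)^{-1}\|_{L_\infty(\Omega)}\qquad\forall t\in(0,T].$$ **Theorem.** Let $f$ satisfy A1. (i-a) If $\lambda\tau_j^\alpha<\{\Gamma(2-\alpha)\}^{-1}$ for all $j\ge1$, the discrete problem has a unique solution $\{U^m\}_{m=0}^M$. (i-b) Let $u$ be a classical solution of the continuous problem, twice differentiable in $t$ and with pure derivatives $\partial_{x_k}^lu$, $l\le4$, existing in $\Omega$, such that $\|\partial_t^lu(\cdot,t)\|_{L_\infty(\Omega)}\lesssim1+t^{\alpha-l}$ for $l=1,2$ and $\|\partial_{x_k}^lu(\cdot,t)\|_{L_\infty(\Omega)}\lesssim1$ for $l=3,4$, $k=1,\dots,d$. Let $r\ge1$, $c_1,c_2,c_3>0$,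 $\epsilon>0$ and $q<1$. Then there is a constant $C$, depending only on the continuous problem ($d,\alpha,T,a_k,b_k,c,f,\lambda,u_0,u$) and on $r,c_1,c_2,c_3,\epsilon,q$, but not on $M$, $N$, or otherwise on the meshes, such that, whenever the temporal mesh is quasi-graded, i.e. $$c_1M^{-r}\le t_1\le c_2M^{-r},\qquad\tau_j\le c_3\,t_1^{1/r}t_j^{1-1/r}\quad(1\le j\le M),$$ and $\lambda\tau_j^\alpha\le q\,\{\Gamma(2-\alpha)\}^{-1}$ for all $j\ge 1$, the discrete solution satisfies $$\max_{z\in\Omega_h}|u(z,t_m)-U^m(z)|\le C\,(\mathcal E^m+t_m^\alpha h^2),\qquad m=1,\dots,M,$$ $$\mathcal E^m=\begin{cases}M^{-r}t_m^{\alpha-1}&1\le r<2-\alpha,\\ M^{-r(1-\epsilon)}t_m^{\alpha-(1-\epsilon)}&r=2-\alpha,\\ M^{\alpha-2}t_m^{\alpha-(2-\alpha)/r}&r>2-\alpha.\end{cases}$$ (ii) If, in the situation of (i-a), A2 also holds and $\sigma_1\le u_0\le\sigma_2$, then $\sigma_1\le U^m\le\sigma_2$ on $\bar\Omega_h$ for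 all $0\le m\le M$. This holds for arbitrarily large $T$; no regularity of $u$ and no grading of the mesh is needed for (i-a) and (ii). -/

import Mathlib

open Set MeasureTheory

noncomputable section

namespace FracFD

/-! ### The continuous problem -/

/-- The open cube `(0,1)^d`. -/
def cube (d : ℕ) : Set (Fin d → ℝ) := Set.univ.pi fun _ => Ioo (0 : ℝ) 1

/-- The closed cube `[0,1]^d`. -/
def closedCube (d : ℕ) : Set (Fin d → ℝ) := Set.univ.pi fun _ => Icc (0 : ℝ) 1

/-- The classical partial derivative in the `k`-th coordinate direction. -/
def pd {d : ℕ} (k : Fin d) (g : (Fin d → ℝ) → ℝ) : (Fin d → ℝ) → ℝ :=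
  fun x => lineDeriv ℝ g x (Pi.single k 1)

/-- Existence of the classical partial derivative in the `k`-th coordinate direction. -/
def PDiffAt {d : ℕ} (k : Fin d) (g : (Fin d → ℝ) → ℝ) (x : Fin d → ℝ) : Prop :=
  LineDifferentiableAt ℝ g x (Pi.single k 1)

/-- The Caputo derivative of order `α ∈ (0,1)`. -/
def caputo (α : ℝ) (v : ℝ → ℝ) (t : ℝ) : ℝ :=
  (Real.Gamma (1 - α))⁻¹ * ∫ s in (0 : ℝ)..t, (t - s) ^ (-α) * deriv v s

/-- `L v = ∑ₖ { -∂ₖ(aₖ ∂ₖ v) + bₖ ∂ₖ v } + c v` at the point `x` and the time `t`. -/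
def ellipticOp {d : ℕ} (a b : Fin d → (Fin d → ℝ) → ℝ → ℝ) (c : (Fin d → ℝ) → ℝ → ℝ)
    (t : ℝ) (v : (Fin d → ℝ) → ℝ) (x : Fin d → ℝ) : ℝ :=
  ∑ k, (-pd k (fun y => a k y t * pd k v y) x + b k x t * pd k v x) + c x t * v x

/-- `g(·,t)` is of class `C^n` up to the boundary of the cube for every `t ∈ (0,T]`, with
derivatives up to the order `n` bounded uniformly in `t`. -/
def SmoothInSpace {d : ℕ} (T : ℝ) (n : ℕ) (g : (Fin d → ℝ) → ℝ → ℝ) : Prop :=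
  ∃ K : ℝ, ∀ t ∈ Ioc 0 T, ContDiffOn ℝ n (fun x => g x t) (closedCube d) ∧
    ∀ j ≤ n, ∀ x ∈ closedCube d,
      ‖iteratedFDerivWithin ℝ j (fun y => g y t) (closedCube d) x‖ ≤ K

/-- The standing assumptions on the coefficients of the elliptic operator. -/
structure EllipticCoeffs {d : ℕ} (T : ℝ) (a b : Fin d → (Fin d → ℝ) → ℝ → ℝ)
    (c : (Fin d → ℝ) → ℝ → ℝ) : Prop where
  smooth_a : ∀ k, SmoothInSpace T 3 (a k)
  smooth_b : ∀ k, SmoothInSpace T 1 (b k)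
  smooth_c : SmoothInSpace T 0 c
  a_pos : ∀ k, ∀ x ∈ closedCube d, ∀ t ∈ Ioc 0 T, 0 < a k x t
  c_nonneg : ∀ x ∈ closedCube d, ∀ t ∈ Ioc 0 T, 0 ≤ c x t
  c_sub_div_nonneg : ∀ x ∈ cube d, ∀ t ∈ Ioc 0 T,
    0 ≤ c x t - (1 / 2) * ∑ k, pd k (fun y => b k y t) x

/-- Assumption A1 on the nonlinearity: continuity in `s`, membership in `L_∞(Ω)`, and the
one-sided Lipschitz condition with constant `lam`. -/
structure A1 {d : ℕ} (T : ℝ) (f : (Fin d → ℝ) → ℝ → ℝ → ℝ) (lam : ℝ) : Prop where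
  lam_nonneg : 0 ≤ lam
  cont : ∀ x ∈ cube d, ∀ t ∈ Ioc 0 T, Continuous (f x t)
  memLp : ∀ t ∈ Ioc 0 T, ∀ s : ℝ, MemLp (fun x => f x t s) ⊤ (volume.restrict (cube d))
  lipschitz : ∀ x ∈ cube d, ∀ t ∈ Ioc 0 T, ∀ s₁ s₂ : ℝ, s₂ ≤ s₁ →
    -lam * (s₁ - s₂) ≤ f x t s₁ - f x t s₂

/-- Assumption A2 with the constants `σ₁ ≤ 0 ≤ σ₂`. -/
structure A2 {d : ℕ} (T : ℝ) (f : (Fin d → ℝ) → ℝ → ℝ → ℝ) (c : (Fin d → ℝ) → ℝ → ℝ)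
    (σ₁ σ₂ : ℝ) : Prop where
  nonpos : σ₁ ≤ 0
  nonneg : 0 ≤ σ₂
  f_lower : ∀ x ∈ cube d, ∀ t ∈ Ioc 0 T, f x t σ₁ ≤ 0
  f_upper : ∀ x ∈ cube d, ∀ t ∈ Ioc 0 T, 0 ≤ f x t σ₂
  c_zero : ∀ x ∈ closedCube d, ∀ t ∈ Ioc 0 T, c x t = 0

/-- `u` is a classical solution of `D_t^α u + L u + f(x,t,u) = 0` in `(0,1)^d × (0,T]` with
`u = 0` on the boundary of the cube and `u(·,0) = u₀`. -/
structure IsSolution {d : ℕ} (α T : ℝ) (a b : Fin d → (Fin d → ℝ) → ℝ → ℝ)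
    (c : (Fin d → ℝ) → ℝ → ℝ) (f : (Fin d → ℝ) → ℝ → ℝ → ℝ) (u₀ : (Fin d → ℝ) → ℝ)
    (u : (Fin d → ℝ) → ℝ → ℝ) : Prop where
  cont_time : ∀ x ∈ cube d, ContinuousOn (u x) (Icc 0 T)
  cont_space : ∀ t ∈ Ioc 0 T, ContinuousOn (fun x => u x t) (closedCube d)
  diff_time : ∀ x ∈ cube d, ∀ t ∈ Ioo 0 T, DifferentiableAt ℝ (u x) t
  caputo_integrable : ∀ x ∈ cube d, ∀ t ∈ Ioc 0 T,
    IntervalIntegrable (fun s => (t - s) ^ (-α) * deriv (u x) s) volume 0 t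
  diff_space : ∀ x ∈ cube d, ∀ t ∈ Ioc 0 T, ∀ k, PDiffAt k (fun y => u y t) x
  diff_flux : ∀ x ∈ cube d, ∀ t ∈ Ioc 0 T, ∀ k,
    PDiffAt k (fun y => a k y t * pd k (fun z => u z t) y) x
  equation : ∀ x ∈ cube d, ∀ t ∈ Ioc 0 T,
    caputo α (u x) t + ellipticOp a b c t (fun y => u y t) x + f x t (u x t) = 0
  boundary : ∀ x ∈ closedCube d \ cube d, ∀ t ∈ Ioc 0 T, u x t = 0
  initial : ∀ x ∈ cube d, u x 0 = u₀ x

/-- `|∂_t^l u(x,t)| ≤ K (1 + t^{α-l})` for `l = 1, 2`, with one constant `K`. The time `t = T`,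
where only one-sided derivatives make sense, is not needed. -/
def TimeRegular {d : ℕ} (α T : ℝ) (u : (Fin d → ℝ) → ℝ → ℝ) : Prop :=
  ∃ K : ℝ, ∀ x ∈ cube d, ∀ t ∈ Ioo 0 T,
    (∀ l < 2, DifferentiableAt ℝ (iteratedDeriv l (u x)) t) ∧
    ∀ l : ℕ, l = 1 ∨ l = 2 → |iteratedDeriv l (u x) t| ≤ K * (1 + t ^ (α - l))

/-- `u(·,t)` has the partial derivatives `∂ₖ^l u`, `l ≤ 4`, in the cube, and those with
`l = 3, 4` are bounded uniformly in `x` and `t`. -/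
def SpaceRegular {d : ℕ} (T : ℝ) (u : (Fin d → ℝ) → ℝ → ℝ) : Prop :=
  ∃ K : ℝ, ∀ k, ∀ x ∈ cube d, ∀ t ∈ Ioc 0 T,
    (∀ l < 4, PDiffAt k ((pd k)^[l] fun y => u y t) x) ∧
    ∀ l : ℕ, l = 3 ∨ l = 4 → |((pd k)^[l] fun y => u y t) x| ≤ K

/-! ### The discretization -/

/-- `0 = t₀ < t₁ < … < t_M = T`, with `M ≥ 1`. -/
structure IsTemporalMesh (T : ℝ) (M : ℕ) (t : ℕ → ℝ) : Prop where
  one_le : 1 ≤ M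
  zero : t 0 = 0
  last : t M = T
  lt_succ : ∀ j < M, t j < t (j + 1)

/-- The mesh is quasi-graded with exponent `r`: `t₁ ≃ M^{-r}` and
`t_j - t_{j-1} ≲ t₁^{1/r} t_j^{1-1/r}`, with explicit constants. -/
structure QuasiGraded (r c₁ c₂ c₃ : ℝ) (M : ℕ) (t : ℕ → ℝ) : Prop where
  lower : c₁ * (M : ℝ) ^ (-r) ≤ t 1
  upper : t 1 ≤ c₂ * (M : ℝ) ^ (-r)
  step : ∀ j ∈ Finset.Icc 1 M, t j - t (j - 1) ≤ c₃ * t 1 ^ (1 / r) * t j ^ (1 - 1 / r)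

/-- The L1 discretization of the Caputo derivative at the time `t m`. -/
def l1 (α : ℝ) (t : ℕ → ℝ) (V : ℕ → ℝ) (m : ℕ) : ℝ :=
  (Real.Gamma (1 - α))⁻¹ * ∑ j ∈ Finset.Icc 1 m,
    (V j - V (j - 1)) / (t j - t (j - 1)) * ∫ s in t (j - 1)..t j, (t m - s) ^ (-α)

/-- Indices of the nodes of the uniform tensor-product mesh with step `1 / N` on `[0,1]^d`. -/
abbrev Idx (d N : ℕ) : Type := Fin d → Fin (N + 1)

/-- The node with multi-index `i`. -/
def node {d N : ℕ} (i : Idx d N) : Fin d → ℝ := fun k => ((i k : ℕ) : ℝ) * (1 / (N : ℝ))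

/-- The multi-indices of the interior nodes. -/
def interior {d N : ℕ} : Set (Idx d N) := {i | ∀ k, 0 < (i k : ℕ) ∧ (i k : ℕ) < N}

/-- The neighbour `z + h iₖ` of a node (used at interior nodes only, so nothing wraps). -/
def next {d N : ℕ} (k : Fin d) (i : Idx d N) : Idx d N := Function.update i k (i k + 1)

/-- The neighbour `z - h iₖ` of a node (used at interior nodes only, so nothing wraps). -/
def prev {d N : ℕ} (k : Fin d) (i : Idx d N) : Idx d N := Function.update i k (i k - 1)

/-- The standard central finite difference operator at the time `t` (step `h = 1 / N`). -/
def fdOp {d N : ℕ} (a b : Fin d → (Fin d → ℝ) → ℝ → ℝ) (c : (Fin d → ℝ) → ℝ → ℝ)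
    (t : ℝ) (V : Idx d N → ℝ) (i : Idx d N) : ℝ :=
  let h : ℝ := 1 / (N : ℝ)
  ∑ k, (h ^ 2)⁻¹ *
      (a k (node i + Pi.single k (h / 2)) t * (V i - V (next k i))
        + a k (node i - Pi.single k (h / 2)) t * (V i - V (prev k i)))
    + ∑ k, (1 / 2) * h⁻¹ * b k (node i) t * (V (next k i) - V (prev k i))
    + c (node i) t * V i

/-- `U` solves the fully discrete problem; only the values `U m` with `m ≤ M` matter. -/
structure IsDiscreteSolution {d : ℕ} (α : ℝ) (a b : Fin d → (Fin d → ℝ) → ℝ → ℝ)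
    (c : (Fin d → ℝ) → ℝ → ℝ) (f : (Fin d → ℝ) → ℝ → ℝ → ℝ) (u₀ : (Fin d → ℝ) → ℝ)
    (M : ℕ) (t : ℕ → ℝ) (N : ℕ) (U : ℕ → Idx d N → ℝ) : Prop where
  equation : ∀ m ∈ Finset.Icc 1 M, ∀ i ∈ interior (d := d) (N := N),
    l1 α t (fun j => U j i) m + fdOp a b c (t m) (U m) i + f (node i) (t m) (U m i) = 0
  boundary : ∀ m ∈ Finset.Icc 1 M, ∀ i ∉ interior (d := d) (N := N), U m i = 0
  initial : ∀ i, U 0 i = u₀ (node i)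

/-- `sup_S |g|`; used only for functions that are bounded on `S`. -/
def supNorm {X : Type*} (S : Set X) (g : X → ℝ) : ℝ := sSup ((fun x => |g x|) '' S)

/-- The condition `h⁻¹ ≥ maxₖ ½ ‖bₖ(·,t)‖ ‖aₖ(·,t)⁻¹‖` for `t ∈ (0,T]` (norms in `L_∞` of the
cube) on the mesh with step `h = 1 / N`. -/
def DiscreteMaxCond {d : ℕ} (T : ℝ) (a b : Fin d → (Fin d → ℝ) → ℝ → ℝ) (N : ℕ) : Prop :=
  ∀ t ∈ Ioc 0 T, ∀ k : Fin d,
    (1 / 2) * supNorm (cube d) (fun x => b k x t) * supNorm (cube d) (fun x => (a k x t)⁻¹)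
      ≤ (1 / (N : ℝ))⁻¹

/-- The temporal error term at the time `s = t_m`. The parameter `ε` matters only if
`r = 2 - α`. -/
def temporalError (α r ε : ℝ) (M : ℕ) (s : ℝ) : ℝ :=
  if r < 2 - α then (M : ℝ) ^ (-r) * s ^ (α - 1)
  else if r = 2 - α then (M : ℝ) ^ (-r * (1 - ε)) * s ^ (α - (1 - ε))
  else (M : ℝ) ^ (α - 2) * s ^ (α - (2 - α) / r)

end FracFD

end

noncomputable section

namespace FracFD

/-! ### The L1 operator: weights, maximum principle and comparison -/

/-! The proof combines a maximum principle in time, a maximum principle in space, and explicit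
supersolutions in time. Written in increments, the L1 operator is a sum of terms `κ_j (V_{j+1} -
V_j)`, where the positive weights `κ_j` are means of the increasing kernel `(t_m - s)^(-α)` and
hence increase with `j`. Summation by parts leaves the coefficient `τ_m^(-α) / Γ(2-α)` at `V_m` and
nonpositive coefficients at all earlier values. The restriction `λ τ_m^α < 1 / Γ(2-α)` therefore
makes `δ_t^α - λ` inverse monotone (`l1Coeff_mul_le_l1`, `l1_comparison`). In space, the condition
on `h` makes the neighbour weights of the difference operator nonnegative (`weights_nonneg`,
`fdOp_ge_of_max`).

Well-posedness: one time step is solved by a nonlinear Jacobi iteration, which contracts because the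
diagonal, reduced by `λ`, strictly dominates the neighbour weights (`exists_step`). Uniqueness and
the range follow by looking at a node where the modulus of the difference, or the solution itself,
is largest.

Error: at a node where `|e^m|` is maximal the spatial operator and the nonlinearity have favourable
signs, so the maximum norms satisfy `δ_t^α ‖e‖ - λ ‖e‖ ≤` truncation error (`l1_supNorm_sub_le`).
The temporal truncation error is of order `(t₁/t_m)^p` whenever `p < 1 + α` and `p ≤ (2-α)/r`
(`exists_l1_sub_caputo_le`), the spatial one of order `h²`. What remains is a supersolution for the
source `(t₁/t_m)^p` of size `t_m^α (t₁/t_m)^(min p 1)` (`exists_l1_barrier`,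
`exists_l1_barrier_lam`). For `p < 1` this is the natural scaling. For `p > 1` the source is
concentrated near `t = 0` and acts like an impulse, whose response decays like `t^(α-1)`. The
exponent `p = 1` would bring in a logarithm and is avoided, whence the `ε` for `r = 2 - α`. Choosing
`p` according to `r` (`exists_exponent`) yields the three cases; the `h²` term is the source with `p
= 0`. -/

theorem IsTemporalMesh.lt {T : ℝ} {M : ℕ} {t : ℕ → ℝ} (ht : IsTemporalMesh T M t) {i j : ℕ}
    (hij : i < j) (hj : j ≤ M) : t i < t j := by
  induction j, hij using Nat.le_induction with
  | base => exact ht.lt_succ i (by omega)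
  | succ k hk ih => exact (ih (by omega)).trans (ht.lt_succ k (by omega))

theorem IsTemporalMesh.le {T : ℝ} {M : ℕ} {t : ℕ → ℝ} (ht : IsTemporalMesh T M t) {i j : ℕ}
    (hij : i ≤ j) (hj : j ≤ M) : t i ≤ t j := by
  rcases hij.eq_or_lt with rfl | h
  · exact le_rfl
  · exact (ht.lt h hj).le

theorem IsTemporalMesh.pos {T : ℝ} {M : ℕ} {t : ℕ → ℝ} (ht : IsTemporalMesh T M t) {j : ℕ}
    (h0 : 1 ≤ j) (hj : j ≤ M) : 0 < t j := by
  have := ht.lt (i := 0) h0 hj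
  rwa [ht.zero] at this

theorem IsTemporalMesh.nonneg {T : ℝ} {M : ℕ} {t : ℕ → ℝ} (ht : IsTemporalMesh T M t) {j : ℕ}
    (hj : j ≤ M) : 0 ≤ t j := by
  have := ht.le (Nat.zero_le j) hj
  rwa [ht.zero] at this

theorem IsTemporalMesh.le_last {T : ℝ} {M : ℕ} {t : ℕ → ℝ} (ht : IsTemporalMesh T M t) {j : ℕ}
    (hj : j ≤ M) : t j ≤ T := by
  rw [← ht.last]
  exact ht.le hj le_rfl

theorem IsTemporalMesh.mem_Ioc {T : ℝ} {M : ℕ} {t : ℕ → ℝ} (ht : IsTemporalMesh T M t) {j : ℕ}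
    (hj : j ∈ Finset.Icc 1 M) : t j ∈ Ioc 0 T := by
  rw [Finset.mem_Icc] at hj
  exact ⟨ht.pos hj.1 hj.2, ht.le_last hj.2⟩

/-- The mean value of the kernel `(t_m - s)^{-α}` over the mesh interval `(t_j, t_{j+1})`. -/
def kerAvg (α : ℝ) (t : ℕ → ℝ) (m j : ℕ) : ℝ :=
  (∫ s in t j..t (j + 1), (t m - s) ^ (-α)) / (t (j + 1) - t j)

theorem l1_eq (α : ℝ) (t V : ℕ → ℝ) (m : ℕ) :
    l1 α t V m = (Real.Gamma (1 - α))⁻¹ *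
      ∑ j ∈ Finset.range m, kerAvg α t m j * (V (j + 1) - V j) := by
  unfold l1
  congr 1
  have h : Finset.Icc 1 m = Finset.Ico (0 + 1) (m + 1) := by
    ext j
    simp only [Finset.mem_Icc, Finset.mem_Ico]
    omega
  rw [h, ← Finset.sum_Ico_add', Finset.range_eq_Ico]
  refine Finset.sum_congr rfl fun j _ => ?_
  simp only [Nat.add_sub_cancel, kerAvg]
  ring

theorem intervalIntegrable_kernel {α : ℝ} (hα' : α < 1) (c x y : ℝ) :
    IntervalIntegrable (fun s : ℝ => (c - s) ^ (-α)) volume x y := by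
  have h := (intervalIntegral.intervalIntegrable_rpow' (a := c - x) (b := c - y)
    (r := -α) (by linarith)).comp_sub_left c
  simpa using h

theorem integral_kernel {α : ℝ} (hα' : α < 1) (c x y : ℝ) :
    ∫ s in x..y, (c - s) ^ (-α) = ((c - x) ^ (1 - α) - (c - y) ^ (1 - α)) / (1 - α) := by
  rw [intervalIntegral.integral_comp_sub_left (fun s : ℝ => s ^ (-α)) c,
    integral_rpow (Or.inl (by linarith))]
  rw [show -α + 1 = 1 - α by ring]

section
variable {α T : ℝ} {M : ℕ} {t : ℕ → ℝ}

theorem le_kerAvg (hα : 0 < α) (hα' : α < 1) (ht : IsTemporalMesh T M t) {m j : ℕ}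
    (hj : j < m) (hm : m ≤ M) : (t m - t j) ^ (-α) ≤ kerAvg α t m j := by
  have h1 : t j < t (j + 1) := ht.lt (by omega) (by omega)
  have h2 : t (j + 1) ≤ t m := ht.le (by omega) hm
  rw [kerAvg, le_div_iff₀ (by linarith)]
  have := intervalIntegral.integral_mono_on_of_le_Ioo (a := t j) (b := t (j + 1))
    (f := fun _ => (t m - t j) ^ (-α)) (g := fun s => (t m - s) ^ (-α)) (μ := volume) h1.le
    intervalIntegrable_const (intervalIntegrable_kernel hα' _ _ _) (fun s hs =>
      Real.rpow_le_rpow_of_nonpos (by linarith [hs.2]) (by linarith [hs.1]) (by linarith))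
  simpa [mul_comm] using this

theorem kerAvg_le (hα : 0 < α) (hα' : α < 1) (ht : IsTemporalMesh T M t) {m j : ℕ}
    (hj : j + 1 < m) (hm : m ≤ M) : kerAvg α t m j ≤ (t m - t (j + 1)) ^ (-α) := by
  have h1 : t j < t (j + 1) := ht.lt (by omega) (by omega)
  have h2 : t (j + 1) < t m := ht.lt (by omega) hm
  rw [kerAvg, div_le_iff₀ (by linarith)]
  have := intervalIntegral.integral_mono_on_of_le_Ioo (a := t j) (b := t (j + 1))
    (g := fun _ => (t m - t (j + 1)) ^ (-α)) (f := fun s => (t m - s) ^ (-α)) (μ := volume) h1.le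
    (intervalIntegrable_kernel hα' _ _ _) intervalIntegrable_const (fun s hs =>
      Real.rpow_le_rpow_of_nonpos (by linarith [hs.2]) (by linarith [hs.2]) (by linarith))
  simpa [mul_comm] using this

theorem kerAvg_pos (hα : 0 < α) (hα' : α < 1) (ht : IsTemporalMesh T M t) {m j : ℕ}
    (hj : j < m) (hm : m ≤ M) : 0 < kerAvg α t m j :=
  (Real.rpow_pos_of_pos (sub_pos.2 (ht.lt hj hm)) _).trans_le (le_kerAvg hα hα' ht hj hm)

/-- The kernel value at the common node `t (j + 1)` separates the two means. This monotonicity gives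
the L1 matrix its sign pattern. -/
theorem kerAvg_mono (hα : 0 < α) (hα' : α < 1) (ht : IsTemporalMesh T M t) {m j : ℕ}
    (hj : j + 1 < m) (hm : m ≤ M) : kerAvg α t m j ≤ kerAvg α t m (j + 1) :=
  (kerAvg_le hα hα' ht hj hm).trans (le_kerAvg hα hα' ht hj hm)

theorem kerAvg_last (hα' : α < 1) (ht : IsTemporalMesh T M t) {m : ℕ} (hm : m + 1 ≤ M) :
    kerAvg α t (m + 1) m = (t (m + 1) - t m) ^ (-α) / (1 - α) := by
  have h1 : 0 < t (m + 1) - t m := sub_pos.2 (ht.lt (by omega) hm)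
  rw [kerAvg, integral_kernel hα', sub_self, Real.zero_rpow (by linarith), sub_zero,
    show (1 - α) = -α + 1 by ring, Real.rpow_add_one h1.ne']
  field_simp

theorem Gamma_two_sub (hα' : α < 1) :
    Real.Gamma (2 - α) = (1 - α) * Real.Gamma (1 - α) := by
  rw [← Real.Gamma_add_one (by linarith)]
  ring_nf

theorem Gamma_one_sub_pos (hα' : α < 1) : 0 < Real.Gamma (1 - α) :=
  Real.Gamma_pos_of_pos (by linarith)

theorem Gamma_two_sub_pos (hα' : α < 1) : 0 < Real.Gamma (2 - α) :=
  Real.Gamma_pos_of_pos (by linarith)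

theorem l1_sub (α : ℝ) (t V W : ℕ → ℝ) (m : ℕ) :
    l1 α t (fun j => V j - W j) m = l1 α t V m - l1 α t W m := by
  simp only [l1_eq, ← mul_sub, ← Finset.sum_sub_distrib]
  congr 1
  exact Finset.sum_congr rfl fun j _ => by ring

theorem l1_add (α : ℝ) (t V W : ℕ → ℝ) (m : ℕ) :
    l1 α t (fun j => V j + W j) m = l1 α t V m + l1 α t W m := by
  simp only [l1_eq, ← mul_add, ← Finset.sum_add_distrib]
  congr 1
  exact Finset.sum_congr rfl fun j _ => by ring

theorem l1_smul (α : ℝ) (t V : ℕ → ℝ) (k : ℝ) (m : ℕ) :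
    l1 α t (fun j => k * V j) m = k * l1 α t V m := by
  simp only [l1_eq, Finset.mul_sum]
  exact Finset.sum_congr rfl fun j _ => by ring

theorem l1_congr (α : ℝ) (t : ℕ → ℝ) {V W : ℕ → ℝ} {m : ℕ} (h : ∀ j ≤ m, V j = W j) :
    l1 α t V m = l1 α t W m := by
  simp only [l1_eq]
  congr 1
  refine Finset.sum_congr rfl fun j hj => ?_
  rw [Finset.mem_range] at hj
  rw [h j (by omega), h (j + 1) (by omega)]

/-- The coefficient of `U^m` in the L1 operator at the time `t_m`. -/
def l1Coeff (α : ℝ) (t : ℕ → ℝ) (m : ℕ) : ℝ :=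
  (Real.Gamma (2 - α))⁻¹ * (t m - t (m - 1)) ^ (-α)

theorem l1Coeff_eq (hα' : α < 1) (ht : IsTemporalMesh T M t) {m : ℕ} (hm : m + 1 ≤ M) :
    l1Coeff α t (m + 1) = (Real.Gamma (1 - α))⁻¹ * kerAvg α t (m + 1) m := by
  rw [kerAvg_last hα' ht hm, l1Coeff, Gamma_two_sub hα', Nat.add_sub_cancel]
  field_simp

theorem lam_lt_l1Coeff {lam : ℝ} (ht : IsTemporalMesh T M t) {m : ℕ}
    (hm : m ∈ Finset.Icc 1 M)
    (hlam : lam * (t m - t (m - 1)) ^ α < (Real.Gamma (2 - α))⁻¹) : lam < l1Coeff α t m := by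
  rw [Finset.mem_Icc] at hm
  have h1 : 0 < t m - t (m - 1) := sub_pos.2 (ht.lt (by omega) hm.2)
  rw [l1Coeff, Real.rpow_neg h1.le, ← div_eq_mul_inv, lt_div_iff₀ (Real.rpow_pos_of_pos h1 _)]
  exact hlam

/-- If `V_j ≤ Q` for all `j < m`, then the L1 operator controls `V_m - Q` from above. -/
theorem l1Coeff_mul_le_l1 (hα : 0 < α) (hα' : α < 1) (ht : IsTemporalMesh T M t) {m : ℕ}
    (hm : m ∈ Finset.Icc 1 M) {V : ℕ → ℝ} {Q : ℝ} (hV : ∀ j < m, V j ≤ Q) :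
    l1Coeff α t m * (V m - Q) ≤ l1 α t V m := by
  obtain ⟨n, rfl⟩ : ∃ n, m = n + 1 := ⟨m - 1, by rw [Finset.mem_Icc] at hm; omega⟩
  have hnM : n + 1 ≤ M := (Finset.mem_Icc.1 hm).2
  rw [l1Coeff_eq hα' ht hnM, l1_eq, mul_assoc]
  refine mul_le_mul_of_nonneg_left ?_ (inv_nonneg.2 (Gamma_one_sub_pos hα').le)
  -- Summation by parts as an induction: since `V (k + 1) - Q ≤ 0`, replacing the weight `k` by the
  -- larger weight `k + 1` only lowers the bound.
  have key : ∀ k ≤ n, kerAvg α t (n + 1) k * (V (k + 1) - Q) ≤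
      ∑ j ∈ Finset.range (k + 1), kerAvg α t (n + 1) j * (V (j + 1) - V j) := by
    intro k
    induction k with
    | zero =>
      intro _
      have h1 := kerAvg_pos hα hα' ht (Nat.succ_pos n) hnM
      have h2 := hV 0 (Nat.succ_pos n)
      simp only [zero_add, Finset.range_one, Finset.sum_singleton]
      exact mul_le_mul_of_nonneg_left (by linarith) h1.le
    | succ k ih =>
      intro hk
      rw [Finset.sum_range_succ]
      have h1 := kerAvg_mono hα hα' ht (m := n + 1) (j := k) (by omega) hnM
      have h2 := hV (k + 1) (by omega)
      nlinarith [ih (by omega), mul_nonneg (sub_nonneg.2 h1) (sub_nonneg.2 h2)]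
  exact key n le_rfl

/-- Comparison principle for `δ_t^α - λ`. -/
theorem l1_comparison (hα : 0 < α) (hα' : α < 1) (ht : IsTemporalMesh T M t) {lam : ℝ}
    (hlam : ∀ j ∈ Finset.Icc 1 M, lam * (t j - t (j - 1)) ^ α < (Real.Gamma (2 - α))⁻¹)
    {E B : ℕ → ℝ} {m : ℕ} (hm : m ≤ M) (h0 : E 0 ≤ B 0)
    (h : ∀ j ∈ Finset.Icc 1 m, l1 α t E j - lam * E j ≤ l1 α t B j - lam * B j) :
    ∀ j ≤ m, E j ≤ B j := by
  intro j
  induction j using Nat.strong_induction_on with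
  | _ j ih =>
    intro hj
    rcases Nat.eq_zero_or_pos j with rfl | hj0
    · exact h0
    have hjM : j ∈ Finset.Icc 1 M := Finset.mem_Icc.2 ⟨hj0, hj.trans hm⟩
    -- All earlier differences are nonpositive, so `l1Coeff * (E j - B j) ≤ lam * (E j - B j)`. A
    -- positive difference would contradict `lam < l1Coeff`.
    have h1 := l1Coeff_mul_le_l1 hα hα' ht hjM (V := fun j => E j - B j) (Q := 0)
      (fun i hi => by have := ih i hi (by omega); linarith)
    rw [l1_sub] at h1
    have h2 := h j (Finset.mem_Icc.2 ⟨hj0, hj⟩)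
    have h3 := lam_lt_l1Coeff ht hjM (hlam j hjM)
    by_contra hcon
    push Not at hcon
    nlinarith

/-- Lower bound of the L1 operator for nondecreasing sequences. -/
theorem l1_ge_of_mono (hα : 0 < α) (hα' : α < 1) (ht : IsTemporalMesh T M t) {m l : ℕ}
    (hl : l < m) (hm : m ≤ M) {V : ℕ → ℝ} (hV : ∀ j < m, V j ≤ V (j + 1)) :
    (Real.Gamma (1 - α))⁻¹ * ((t m - t l) ^ (-α) * (V m - V l)) ≤ l1 α t V m := by
  rw [l1_eq]
  refine mul_le_mul_of_nonneg_left ?_ (inv_nonneg.2 (Gamma_one_sub_pos hα').le)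
  rw [← Finset.sum_range_add_sum_Ico _ hl.le, ← Finset.sum_Ico_sub V hl.le, Finset.mul_sum]
  have h1 : 0 ≤ ∑ j ∈ Finset.range l, kerAvg α t m j * (V (j + 1) - V j) :=
    Finset.sum_nonneg fun j hj => by
      have hj' := Finset.mem_range.1 hj
      exact mul_nonneg (kerAvg_pos hα hα' ht (by omega) hm).le
        (sub_nonneg.2 (hV j (by omega)))
  have h2 : ∑ j ∈ Finset.Ico l m, (t m - t l) ^ (-α) * (V (j + 1) - V j) ≤
      ∑ j ∈ Finset.Ico l m, kerAvg α t m j * (V (j + 1) - V j) :=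
    Finset.sum_le_sum fun j hj => by
      have hj' := Finset.mem_Ico.1 hj
      refine mul_le_mul_of_nonneg_right ?_ (sub_nonneg.2 (hV j hj'.2))
      refine le_trans ?_ (le_kerAvg hα hα' ht hj'.2 hm)
      exact Real.rpow_le_rpow_of_nonpos (sub_pos.2 (ht.lt hj'.2 hm))
        (by linarith [ht.le hj'.1 (by omega : j ≤ M)]) (by linarith)
  linarith

end

/-! ### Barrier functions for the L1 operator -/

section
variable {α T : ℝ} {M : ℕ} {t : ℕ → ℝ}

theorem l1_ge_of_mono_zero (hα : 0 < α) (hα' : α < 1) (ht : IsTemporalMesh T M t) {m : ℕ}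
    (hm : m ∈ Finset.Icc 1 M) {V : ℕ → ℝ} (h0 : V 0 = 0) (hV : ∀ j < m, V j ≤ V (j + 1)) :
    (Real.Gamma (1 - α))⁻¹ * (t m ^ (-α) * V m) ≤ l1 α t V m := by
  rw [Finset.mem_Icc] at hm
  have := l1_ge_of_mono hα hα' ht (l := 0) hm.1 hm.2 hV
  simpa [ht.zero, h0] using this

theorem intervalIntegrable_kernel_sub_mul (hα' : α < 1) {x y c : ℝ} (hxy : x ≤ y) (k : ℝ)
    {φ : ℝ → ℝ} (hφ : ContinuousOn φ (Icc x y)) :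
    IntervalIntegrable (fun s => ((c - s) ^ (-α) - k) * φ s) volume x y := by
  refine IntervalIntegrable.mul_continuousOn ?_ (by rwa [uIcc_of_le hxy])
  exact (intervalIntegrable_kernel hα' c x y).sub intervalIntegrable_const

theorem kernel_ge (hα : 0 < α) {c s : ℝ} (hs : 0 ≤ s) (hsc : s < c) :
    c ^ (-α) ≤ (c - s) ^ (-α) :=
  Real.rpow_le_rpow_of_nonpos (by linarith) (by linarith) (by linarith)

/-- `(c - s)^(-α) s^(α-2)` has the primitive `-((c - s)/s)^(1-α) / (c (1-α))`. The terms singular in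
`k` cancel against those of the subtracted `c^(-α)`, so the bound does not depend on `k`. Its value
is exactly what the barriers need: `(1-α) c` times the integral is at most `1`. -/
theorem integral_kernel_mul_rpow_le (hα' : α < 1) {k c : ℝ} (hk : 0 < k)
    (hkc : k ≤ c) :
    ∫ s in k..c, ((c - s) ^ (-α) - c ^ (-α)) * s ^ (α - 2) ≤ c⁻¹ / (1 - α) := by
  have hc : 0 < c := hk.trans_le hkc
  have h1α : 0 < 1 - α := by linarith
  have hcont : ContinuousOn (fun s : ℝ => s ^ (α - 2)) (Icc k c) := fun s hs =>
    (Real.continuousAt_rpow_const _ _ (Or.inl (hk.trans_le hs.1).ne')).continuousWithinAt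
  have hint1 : IntervalIntegrable (fun s : ℝ => (c - s) ^ (-α) * s ^ (α - 2)) volume k c := by
    simpa using intervalIntegrable_kernel_sub_mul hα' (c := c) hkc 0 hcont
  have hint2 : IntervalIntegrable (fun s : ℝ => c ^ (-α) * s ^ (α - 2)) volume k c :=
    ((hcont.const_smul (c ^ (-α))).intervalIntegrable_of_Icc hkc)
  have e1 : ∫ s in k..c, (c - s) ^ (-α) * s ^ (α - 2)
      = ((c - k) / k) ^ (1 - α) * (c⁻¹ / (1 - α)) := by
    have hF := intervalIntegral.integral_eq_sub_of_hasDerivAt_of_le hkc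
      (f := fun s => -(((c - s) / s) ^ (1 - α) * (c⁻¹ / (1 - α))))
      (f' := fun s => (c - s) ^ (-α) * s ^ (α - 2)) ?_ ?_ hint1
    · rw [hF, sub_self, zero_div, Real.zero_rpow h1α.ne']
      ring
    · refine ContinuousOn.neg (ContinuousOn.mul (ContinuousOn.rpow_const ?_ ?_)
        continuousOn_const)
      · exact (continuousOn_const.sub continuousOn_id).div continuousOn_id
          fun s hs => (hk.trans_le hs.1).ne'
      · exact fun s _ => Or.inr h1α.le
    · intro s hs
      have hs0 : 0 < s := hk.trans hs.1
      have hcs : 0 < c - s := by linarith [hs.2]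
      have hd : HasDerivAt (fun s : ℝ => (c - s) / s) ((-1 * s - (c - s) * 1) / s ^ 2) s :=
        ((hasDerivAt_id s).const_sub c).div (hasDerivAt_id s) hs0.ne'
      have := ((hd.rpow_const (p := 1 - α) (Or.inl (div_pos hcs hs0).ne')).mul_const
        (c⁻¹ / (1 - α))).neg
      refine this.congr_deriv ?_
      rw [show 1 - α - 1 = -α by ring, Real.div_rpow hcs.le hs0.le,
        show α - 2 = α + (-2 : ℝ) by ring, Real.rpow_add hs0, Real.rpow_neg hs0.le α,
        show ((-2 : ℝ)) = ((-2 : ℤ) : ℝ) by norm_num, Real.rpow_intCast]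
      have : s ^ α ≠ 0 := (Real.rpow_pos_of_pos hs0 _).ne'
      field_simp
      ring
  have e2 : ∫ s in k..c, c ^ (-α) * s ^ (α - 2)
      = c ^ (-α) * ((k ^ (α - 1) - c ^ (α - 1)) / (1 - α)) := by
    rw [intervalIntegral.integral_const_mul, integral_rpow (Or.inr ⟨by linarith, ?_⟩)]
    · rw [show α - 2 + 1 = α - 1 by ring, ← neg_div_neg_eq]
      ring_nf
    · rw [uIcc_of_le hkc]
      exact fun h => absurd h.1 (not_le.2 hk)
  have e3 : ∫ s in k..c, ((c - s) ^ (-α) - c ^ (-α)) * s ^ (α - 2)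
      = ((c - k) / k) ^ (1 - α) * (c⁻¹ / (1 - α)) -
        c ^ (-α) * ((k ^ (α - 1) - c ^ (α - 1)) / (1 - α)) := by
    rw [← e1, ← e2, ← intervalIntegral.integral_sub hint1 hint2]
    exact intervalIntegral.integral_congr fun s _ => by ring
  rw [e3]
  have h1 : ((c - k) / k) ^ (1 - α) ≤ (c / k) ^ (1 - α) :=
    Real.rpow_le_rpow (div_nonneg (by linarith) hk.le) (by gcongr; linarith) h1α.le
  have h2 : (c / k) ^ (1 - α) * c⁻¹ = c ^ (-α) * k ^ (α - 1) := by
    rw [Real.div_rpow hc.le hk.le, show 1 - α = -α + 1 by ring, Real.rpow_add_one hc.ne',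
      show α - 1 = -(-α + 1) by ring, Real.rpow_neg hk.le]
    field_simp
  have h3 : c ^ (-α) * c ^ (α - 1) = c⁻¹ := by
    rw [← Real.rpow_add hc, show -α + (α - 1) = -1 by ring, Real.rpow_neg_one]
  rw [← mul_div_assoc, ← mul_div_assoc, ← sub_div]
  gcongr
  have : 0 < c⁻¹ := inv_pos.2 hc
  nlinarith [mul_le_mul_of_nonneg_right h1 this.le]

/-- Lower bound of the L1 operator for a sequence that increases up to the index `n` and then
decreases with slopes bounded by `φ`. -/
theorem l1_ge_of_slope_le (hα : 0 < α) (hα' : α < 1) (ht : IsTemporalMesh T M t) {m n : ℕ}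
    (hnm : n < m) (hm : m ≤ M) {B : ℕ → ℝ} (h0 : B 0 = 0) (hB : ∀ j < n, B j ≤ B (j + 1))
    {φ : ℝ → ℝ} (hφ : ContinuousOn φ (Icc (t n) (t m)))
    (hs : ∀ j, n ≤ j → j < m → ∀ s ∈ Icc (t j) (t (j + 1)),
      B j - B (j + 1) ≤ φ s * (t (j + 1) - t j)) :
    (Real.Gamma (1 - α))⁻¹ * (t m ^ (-α) * B m -
      ∫ s in t n..t m, ((t m - s) ^ (-α) - t m ^ (-α)) * φ s) ≤ l1 α t B m := by
  rw [l1_eq]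
  refine mul_le_mul_of_nonneg_left ?_ (inv_nonneg.2 (Gamma_one_sub_pos hα').le)
  have hsub : ∀ j, n ≤ j → j < m → Icc (t j) (t (j + 1)) ⊆ Icc (t n) (t m) := fun j h1 h2 =>
    Icc_subset_Icc (ht.le h1 (by omega)) (ht.le (by omega) hm)
  have hint : ∀ j, n ≤ j → j < m → IntervalIntegrable
      (fun s => ((t m - s) ^ (-α) - t m ^ (-α)) * φ s) volume (t j) (t (j + 1)) :=
    fun j h1 h2 => intervalIntegrable_kernel_sub_mul hα' (ht.le (by omega) (by omega)) _
      (hφ.mono (hsub j h1 h2))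
  rw [← intervalIntegral.sum_integral_adjacent_intervals_Ico hnm.le
    (fun j hj => hint j hj.1 hj.2)]
  -- The constant kernel `t m ^ (-α)` telescopes to `t m ^ (-α) * B m` because `B 0 = 0`. The
  -- remaining kernel difference is nonnegative, so the increasing part may be dropped and the slope
  -- bound inserted on the decreasing part.
  have e1 : t m ^ (-α) * B m = ∑ j ∈ Finset.range m, t m ^ (-α) * (B (j + 1) - B j) := by
    rw [← Finset.mul_sum, Finset.sum_range_sub, h0, sub_zero]
  rw [e1, sub_le_iff_le_add, ← sub_le_iff_le_add', ← Finset.sum_sub_distrib,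
    ← Finset.sum_range_add_sum_Ico _ hnm.le]
  have h1 : ∑ j ∈ Finset.range n, (t m ^ (-α) * (B (j + 1) - B j) -
      kerAvg α t m j * (B (j + 1) - B j)) ≤ 0 := by
    refine Finset.sum_nonpos fun j hj => ?_
    have hj' := Finset.mem_range.1 hj
    have h2 := le_kerAvg hα hα' ht (j := j) (by omega) hm
    have h3 := kernel_ge hα (ht.nonneg (j := j) (by omega)) (ht.lt (j := m) (i := j) (by omega) hm)
    nlinarith [hB j hj']
  have h2 : ∑ j ∈ Finset.Ico n m, (t m ^ (-α) * (B (j + 1) - B j) -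
      kerAvg α t m j * (B (j + 1) - B j)) ≤
      ∑ j ∈ Finset.Ico n m, ∫ s in t j..t (j + 1), ((t m - s) ^ (-α) - t m ^ (-α)) * φ s := by
    refine Finset.sum_le_sum fun j hj => ?_
    have hj' := Finset.mem_Ico.1 hj
    have hlt : t j < t (j + 1) := ht.lt (by omega) (by omega)
    have hτ : 0 < t (j + 1) - t j := sub_pos.2 hlt
    have e2 : t m ^ (-α) * (B (j + 1) - B j) - kerAvg α t m j * (B (j + 1) - B j) =
        ∫ s in t j..t (j + 1), ((t m - s) ^ (-α) - t m ^ (-α)) *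
          ((B j - B (j + 1)) / (t (j + 1) - t j)) := by
      rw [intervalIntegral.integral_mul_const, intervalIntegral.integral_sub
        (intervalIntegrable_kernel hα' _ _ _) intervalIntegrable_const, kerAvg,
        intervalIntegral.integral_const, smul_eq_mul]
      field_simp
      ring
    rw [e2]
    refine intervalIntegral.integral_mono_on_of_le_Ioo hlt.le
      (intervalIntegrable_kernel_sub_mul hα' hlt.le _ continuousOn_const)
      (hint j hj'.1 hj'.2) fun s hs' => ?_
    have hs0 : 0 ≤ s := (ht.nonneg (j := j) (by omega)).trans hs'.1.le
    have hsm : s < t m := hs'.2.trans_le (ht.le (by omega) hm)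
    refine mul_le_mul_of_nonneg_left ?_ (sub_nonneg.2 (kernel_ge hα hs0 hsm))
    rw [div_le_iff₀ hτ]
    exact hs j hj'.1 hj'.2 s (Ioo_subset_Icc_self hs')
  linarith

end

/-! Difference quotients of negative powers. -/

theorem rpow_sub_rpow_eq {β x y : ℝ} (hx : 0 < x) (hxy : x < y) :
    ∃ ξ ∈ Ioo x y, x ^ β - y ^ β = -β * ξ ^ (β - 1) * (y - x) := by
  obtain ⟨ξ, hξ, h⟩ := exists_hasDerivAt_eq_slope (fun s : ℝ => s ^ β)
    (fun s => β * s ^ (β - 1)) hxy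
    (fun s hs => (Real.continuousAt_rpow_const _ _
      (Or.inl (hx.trans_le hs.1).ne')).continuousWithinAt)
    (fun s hs => Real.hasDerivAt_rpow_const (Or.inl (hx.trans hs.1).ne'))
  refine ⟨ξ, hξ, ?_⟩
  rw [eq_div_iff (by linarith)] at h
  linarith

/-- With relative step at most `e`, the intermediate point of the mean value theorem and an
arbitrary `s` of the interval differ by a factor at most `1 + e`. Slopes of a power sequence thus
become pointwise multiples of a power of `s`, which can be integrated against the kernel. -/
theorem rpow_sub_rpow_le {β x y s e : ℝ} (hβ : β ≤ 0) (hx : 0 < x) (hxy : x < y)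
    (he : 0 ≤ e) (hy : y ≤ (1 + e) * x) (hs : s ∈ Icc x y) :
    x ^ β - y ^ β ≤ -β * ((1 + e) ^ (1 - β) * s ^ (β - 1)) * (y - x) := by
  obtain ⟨ξ, hξ, h⟩ := rpow_sub_rpow_eq (β := β) hx hxy
  rw [h]
  have hs0 : 0 < s := hx.trans_le hs.1
  have h1 : ξ ^ (β - 1) ≤ (s / (1 + e)) ^ (β - 1) := by
    refine Real.rpow_le_rpow_of_nonpos (by positivity) ?_ (by linarith)
    rw [div_le_iff₀ (by positivity)]
    nlinarith [hs.2, hξ.1]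
  have h2 : (s / (1 + e)) ^ (β - 1) = (1 + e) ^ (1 - β) * s ^ (β - 1) := by
    rw [Real.div_rpow hs0.le (by positivity), show 1 - β = -(β - 1) by ring,
      Real.rpow_neg (by positivity)]
    ring
  rw [h2] at h1
  have : 0 ≤ y - x := by linarith
  have : 0 ≤ -β := by linarith
  gcongr

theorem le_rpow_sub_rpow {β x y s e : ℝ} (hβ : β ≤ 0) (hx : 0 < x) (hxy : x < y)
    (he : 0 ≤ e) (hy : y ≤ (1 + e) * x) (hs : s ∈ Icc x y) :
    -β * ((1 + e) ^ (β - 1) * s ^ (β - 1)) * (y - x) ≤ x ^ β - y ^ β := by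
  obtain ⟨ξ, hξ, h⟩ := rpow_sub_rpow_eq (β := β) hx hxy
  rw [h]
  have hs0 : 0 < s := hx.trans_le hs.1
  rw [← Real.mul_rpow (by positivity) hs0.le]
  have h1 : ((1 + e) * s) ^ (β - 1) ≤ ξ ^ (β - 1) := by
    refine Real.rpow_le_rpow_of_nonpos (hx.trans hξ.1) ?_ (by linarith)
    nlinarith [hs.1, hξ.2]
  have : 0 ≤ y - x := by linarith
  have : 0 ≤ -β := by linarith
  gcongr

section
variable {α T : ℝ} {M : ℕ} {t : ℕ → ℝ}

/-- A power barrier for sources `(t₁/t_m)^p` with `p ≤ α`. -/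
theorem exists_barrier_of_le (hα : 0 < α) (hα' : α < 1) {p : ℝ} (hp : p ≤ α)
    (ht : IsTemporalMesh T M t) :
    ∃ B : ℕ → ℝ, B 0 = 0 ∧ ∀ m ∈ Finset.Icc 1 M,
      (Real.Gamma (1 - α))⁻¹ * (t 1 / t m) ^ p ≤ l1 α t B m ∧
      B m ≤ t m ^ α * (t 1 / t m) ^ p := by
  have h1 : 0 < t 1 := ht.pos le_rfl ht.one_le
  -- The powers are nondecreasing as `p ≤ α`. The value at `j = 0` is set separately because `0 ^ (0
  -- : ℝ) = 1` when `p = α`.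
  refine ⟨fun j => if j = 0 then 0 else t 1 ^ p * t j ^ (α - p), by simp, fun m hm => ?_⟩
  have hm' := Finset.mem_Icc.1 hm
  have hmp : 0 < t m := ht.pos hm'.1 hm'.2
  have e1 : t 1 ^ p * t m ^ (α - p) = t m ^ α * (t 1 / t m) ^ p := by
    rw [Real.rpow_sub hmp, Real.div_rpow h1.le hmp.le]
    ring
  have e2 : (if m = 0 then 0 else t 1 ^ p * t m ^ (α - p)) = t m ^ α * (t 1 / t m) ^ p := by
    rw [if_neg (by omega), e1]
  refine ⟨?_, by simp only [e2]; exact le_rfl⟩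
  refine le_trans (le_of_eq ?_) (l1_ge_of_mono_zero hα hα' ht hm (by simp) fun j hj => ?_)
  · rw [e2, Real.rpow_neg hmp.le, ← mul_assoc (t m ^ α)⁻¹,
      inv_mul_cancel₀ (Real.rpow_pos_of_pos hmp _).ne', one_mul]
  · rw [if_neg (Nat.succ_ne_zero j)]
    have hj1 : 0 < t (j + 1) := ht.pos (by omega) (by omega)
    rcases Nat.eq_zero_or_pos j with rfl | hj0
    · simp only [if_true]
      positivity
    · rw [if_neg (by omega)]
      have : 0 < t j := ht.pos hj0 (by omega)
      gcongr
      exact ht.le (by omega) (by omega)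

theorem rpow_ite_monotone {k : ℝ} (hk : 0 ≤ k) (hα : 0 < α) (ht : IsTemporalMesh T M t)
    {n : ℕ} (hn : n ≤ M) (v : ℕ → ℝ) {j : ℕ} (hj : j < n) :
    (if j ≤ n then k * t j ^ α else v j) ≤ if j + 1 ≤ n then k * t (j + 1) ^ α else v (j + 1) := by
  rw [if_pos hj.le, if_pos (by omega)]
  have := ht.nonneg (j := j) (by omega)
  gcongr
  exact ht.le (by omega) (by omega)

/-- The barrier is `t^α` up to `t n` and `t_n^p t^(α-p)` afterwards. Past `t n` its decay rate is
`(p-α) t_n^p s^(α-p-1) ≤ (p-α) t_n^p t_m^(1-p) s^(α-2)`, so `integral_kernel_mul_rpow_le` shows that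
memory of the decay takes away only the fraction `(p-α)/(1-α) < 1` of `(t_n/t_m)^p`, up to the
step-size correction. -/
theorem barrier_of_lt_one (hα : 0 < α) (hα' : α < 1) {p C₀ : ℝ} (hp : α < p) (hp' : p < 1)
    (ht : IsTemporalMesh T M t) {n : ℕ} (hn : n ∈ Finset.Icc 1 M) (hC₀ : t n ≤ C₀ * t 1)
    (hstep : ∀ j, n ≤ j → j < M → t (j + 1) - t j ≤ (1 - p) / 6 * t j) :
    ∃ B : ℕ → ℝ, B 0 = 0 ∧ ∀ m ∈ Finset.Icc 1 M,
      (Real.Gamma (1 - α))⁻¹ * ((1 - p) / (2 * (1 - α))) * (t 1 / t m) ^ p ≤ l1 α t B m ∧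
      B m ≤ C₀ ^ p * (t m ^ α * (t 1 / t m) ^ p) := by
  have hn' := Finset.mem_Icc.1 hn
  have h1 : 0 < t 1 := ht.pos le_rfl ht.one_le
  have hκ : 0 < t n := ht.pos hn'.1 hn'.2
  have hp0 : 0 < p := hα.trans hp
  have h1α : 0 < 1 - α := by linarith
  have hC0 : 0 < C₀ := by
    by_contra hcon
    nlinarith
  have hG := inv_pos.2 (Gamma_one_sub_pos hα')
  -- As `(1 + η)² ≤ 1 + 3η = 1 + (1-p)/2`, the discretization uses at most half of the gap `1 - p`.
  set η : ℝ := (1 - p) / 6 with hη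
  have hη0 : 0 < η := by rw [hη]; linarith
  refine ⟨fun j => if j ≤ n then 1 * t j ^ α else t n ^ p * t j ^ (α - p), ?_, fun m hm => ?_⟩
  · simp [ht.zero, Real.zero_rpow hα.ne']
  have hm' := Finset.mem_Icc.1 hm
  have hmp : 0 < t m := ht.pos hm'.1 hm'.2
  have e1 : t n ^ p * t m ^ (α - p) = t m ^ α * (t n / t m) ^ p := by
    rw [Real.rpow_sub hmp, Real.div_rpow hκ.le hmp.le]
    ring
  have hBn : ∀ j, n ≤ j → j ≤ M →
      (if j ≤ n then 1 * t j ^ α else t n ^ p * t j ^ (α - p)) = t n ^ p * t j ^ (α - p) := by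
    intro j hj hjM
    split_ifs with h
    · obtain rfl : j = n := le_antisymm h hj
      rw [← Real.rpow_add hκ, one_mul]
      ring_nf
    · rfl
  have hc1 : (1 - p) / (2 * (1 - α)) ≤ 1 := by
    rw [div_le_one (by linarith)]
    linarith
  have hc0 : 0 < (1 - p) / (2 * (1 - α)) := div_pos (by linarith) (by linarith)
  refine ⟨?_, ?_⟩
  · rcases le_or_gt m n with hmn | hmn
    · have hle : (t 1 / t m) ^ p ≤ 1 :=
        Real.rpow_le_one (by positivity) ((div_le_one hmp).2 (ht.le hm'.1 hm'.2)) hp0.le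
      refine le_trans ?_ (l1_ge_of_mono_zero hα hα' ht hm
        (V := fun j => if j ≤ n then 1 * t j ^ α else t n ^ p * t j ^ (α - p)) ?_
        fun j hj => rpow_ite_monotone zero_le_one hα ht hn'.2
          (fun j => t n ^ p * t j ^ (α - p)) (by omega))
      · rw [if_pos hmn, one_mul, ← Real.rpow_add hmp, neg_add_cancel, Real.rpow_zero, mul_assoc]
        refine mul_le_mul_of_nonneg_left ?_ hG.le
        exact mul_le_one₀ hc1 (by positivity) hle
      · simp [ht.zero, Real.zero_rpow hα.ne']
    · set K : ℝ := (p - α) * (1 + η) ^ 2 * (t n ^ p * t m ^ (1 - p)) with hK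
      have hcont : ContinuousOn (fun s : ℝ => s ^ (α - 2)) (Icc (t n) (t m)) := fun s hs =>
        (Real.continuousAt_rpow_const _ _ (Or.inl (hκ.trans_le hs.1).ne')).continuousWithinAt
      refine le_trans ?_ (l1_ge_of_slope_le hα hα' ht hmn hm'.2
        (B := fun j => if j ≤ n then 1 * t j ^ α else t n ^ p * t j ^ (α - p))
        (φ := fun s => K * s ^ (α - 2)) ?_ (fun j hj =>
          rpow_ite_monotone zero_le_one hα ht hn'.2 (fun j => t n ^ p * t j ^ (α - p)) hj)
        (continuousOn_const.mul hcont) ?_)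
      · rw [mul_assoc]
        refine mul_le_mul_of_nonneg_left ?_ hG.le
        rw [hBn m hmn.le hm'.2]
        have hI := integral_kernel_mul_rpow_le hα' hκ (ht.le hmn.le hm'.2)
        have e3 : ∫ s in t n..t m, ((t m - s) ^ (-α) - t m ^ (-α)) * (K * s ^ (α - 2)) =
            K * ∫ s in t n..t m, ((t m - s) ^ (-α) - t m ^ (-α)) * s ^ (α - 2) := by
          rw [← intervalIntegral.integral_const_mul]
          exact intervalIntegral.integral_congr fun s _ => by ring
        have hK0 : 0 ≤ K := by
          have : 0 ≤ p - α := by linarith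
          positivity
        have e4 : t m ^ (-α) * (t n ^ p * t m ^ (α - p)) = (t n / t m) ^ p := by
          rw [e1, Real.rpow_neg hmp.le, ← mul_assoc,
            inv_mul_cancel₀ (Real.rpow_pos_of_pos hmp _).ne', one_mul]
        have e5 : K * ((t m)⁻¹ / (1 - α)) =
            (p - α) * (1 + η) ^ 2 / (1 - α) * (t n / t m) ^ p := by
          rw [hK, Real.rpow_sub hmp, Real.rpow_one, Real.div_rpow hκ.le hmp.le]
          field_simp
        rw [e3, e4]
        have h5 := mul_le_mul_of_nonneg_left hI hK0
        rw [e5] at h5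
        have h6 : (1 - p) / (2 * (1 - α)) ≤ 1 - (p - α) * (1 + η) ^ 2 / (1 - α) := by
          rw [div_le_iff₀ (by linarith), sub_mul,
            show (p - α) * (1 + η) ^ 2 / (1 - α) * (2 * (1 - α)) = 2 * ((p - α) * (1 + η) ^ 2) by
              field_simp]
          have : (1 + η) ^ 2 ≤ 1 + 3 * η := by nlinarith
          nlinarith
        have h7 : (t 1 / t m) ^ p ≤ (t n / t m) ^ p :=
          Real.rpow_le_rpow (by positivity)
            (by gcongr; exact ht.le hn'.1 hn'.2) hp0.le
        have h8 : 0 ≤ (t n / t m) ^ p := by positivity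
        nlinarith [mul_le_mul_of_nonneg_left h7 hc0.le, mul_le_mul_of_nonneg_right h6 h8]
      · simp [ht.zero, Real.zero_rpow hα.ne']
      · intro j hj hjm s hs
        rw [hBn j hj (by omega), hBn (j + 1) (by omega) (by omega), ← mul_sub]
        have htj : 0 < t j := hκ.trans_le (ht.le hj (by omega))
        have hlt : t j < t (j + 1) := ht.lt (by omega) (by omega)
        have hs0 : 0 < s := htj.trans_le hs.1
        have h2 := rpow_sub_rpow_le (β := α - p) (by linarith) htj hlt hη0.le
          (by linarith [hstep j hj (by omega)]) hs
        have h3 : (1 + η) ^ (1 - (α - p)) ≤ (1 + η) ^ 2 := by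
          rw [← Real.rpow_natCast]
          exact Real.rpow_le_rpow_of_exponent_le (by linarith) (by push_cast; linarith)
        have h4 : s ^ (α - p - 1) ≤ t m ^ (1 - p) * s ^ (α - 2) := by
          rw [show α - p - 1 = (1 - p) + (α - 2) by ring, Real.rpow_add hs0]
          gcongr
          exact hs.2.trans (ht.le (by omega) hm'.2)
        calc t n ^ p * (t j ^ (α - p) - t (j + 1) ^ (α - p))
            ≤ t n ^ p * (-(α - p) * ((1 + η) ^ (1 - (α - p)) * s ^ (α - p - 1)) *
                (t (j + 1) - t j)) := by gcongr
          _ ≤ t n ^ p * ((p - α) * ((1 + η) ^ 2 * (t m ^ (1 - p) * s ^ (α - 2))) *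
                (t (j + 1) - t j)) := by
              rw [neg_sub]
              have : 0 ≤ p - α := by linarith
              have : 0 ≤ t (j + 1) - t j := by linarith
              gcongr
          _ = K * s ^ (α - 2) * (t (j + 1) - t j) := by rw [hK]; ring
  · have e6 : C₀ ^ p * (t m ^ α * (t 1 / t m) ^ p) = t m ^ α * (C₀ * t 1 / t m) ^ p := by
      rw [mul_div_assoc, Real.mul_rpow hC0.le (by positivity)]
      ring
    rw [e6]
    simp only
    split_ifs with h
    · rw [one_mul]
      refine le_mul_of_one_le_right (by positivity) (Real.one_le_rpow ?_ hp0.le)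
      rw [one_le_div hmp]
      exact (ht.le h hn'.2).trans hC₀
    · rw [e1]
      gcongr

-- The leading power `t^(α-1)` alone gives no positive lower bound: its own term `t_n/t_m` is
-- cancelled by the memory integral. Subtracting `c t_n^p t^(α-p)` produces the source. The choice
-- `c (p-α) = 1-α` makes the continuous decay rate `(1-α)(t_n s^(α-2) - t_n^p s^(α-p-1))`, and `c <
-- 1` leaves a surplus. The step condition carries the factor `(t_n/t_{j+1})^(p-1)` because the
-- error made on the leading power must be absorbed by the smaller second one.
set_option maxHeartbeats 1000000 in
theorem barrier_of_one_lt (hα : 0 < α) (hα' : α < 1) {p C₀ c : ℝ} (hp : 1 < p) (hp' : p ≤ 2)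
    (hc : c = (1 - α) / (p - α)) (ht : IsTemporalMesh T M t) {n : ℕ}
    (hn : n ∈ Finset.Icc 1 M) (hC₀ : t n ≤ C₀ * t 1)
    (hstep : ∀ j, n ≤ j → j < M →
      t (j + 1) - t j ≤ (1 - c) / 12 * (t n / t (j + 1)) ^ (p - 1) * t j) :
    ∃ B : ℕ → ℝ, B 0 = 0 ∧ ∀ m ∈ Finset.Icc 1 M,
      (Real.Gamma (1 - α))⁻¹ * ((1 - c) / 2) * (t 1 / t m) ^ p ≤ l1 α t B m ∧
      B m ≤ C₀ * (t m ^ α * (t 1 / t m)) := by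
  have hn' := Finset.mem_Icc.1 hn
  have h1 : 0 < t 1 := ht.pos le_rfl ht.one_le
  have hκ : 0 < t n := ht.pos hn'.1 hn'.2
  have hp0 : 0 < p := by linarith
  have h1α : 0 < 1 - α := by linarith
  have hpα : 0 < p - α := by linarith
  have hc0 : 0 < c := by rw [hc]; positivity
  have hc1 : c < 1 := by rw [hc, div_lt_one hpα]; linarith
  have hcp : c * (p - α) = 1 - α := by rw [hc]; field_simp
  have hC0 : 0 < C₀ := by
    by_contra hcon
    nlinarith
  have hG := inv_pos.2 (Gamma_one_sub_pos hα')
  -- The discretization loses a fraction `3η` in each of the two powers, hence the factor `1 - 6η`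
  -- below, and `1 - 6η - c = (1 - c)/2`.
  set η : ℝ := (1 - c) / 12 with hη
  have hη0 : 0 < η := by rw [hη]; linarith
  have hη1 : η < 1 / 12 := by rw [hη]; linarith
  set v : ℕ → ℝ := fun j => t n * t j ^ (α - 1) - c * (t n ^ p * t j ^ (α - p)) with hv
  have h0 : (if 0 ≤ n then (1 - c) * t 0 ^ α else v 0) = 0 := by
    simp [ht.zero, Real.zero_rpow hα.ne']
  refine ⟨fun j => if j ≤ n then (1 - c) * t j ^ α else v j, h0, fun m hm => ?_⟩
  have hm' := Finset.mem_Icc.1 hm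
  have hmp : 0 < t m := ht.pos hm'.1 hm'.2
  have hBn : ∀ j, n ≤ j → j ≤ M → (if j ≤ n then (1 - c) * t j ^ α else v j) = v j := by
    intro j hj hjM
    split_ifs with h
    · obtain rfl : j = n := le_antisymm h hj
      simp only [hv]
      rw [← Real.rpow_add hκ, Real.rpow_sub_one hκ.ne']
      field_simp
      ring_nf
    · rfl
  have hmono : ∀ j < n, (if j ≤ n then (1 - c) * t j ^ α else v j) ≤
      if j + 1 ≤ n then (1 - c) * t (j + 1) ^ α else v (j + 1) := fun j hj =>
    rpow_ite_monotone (by linarith) hα ht hn'.2 v hj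
  refine ⟨?_, ?_⟩
  · rcases le_or_gt m n with hmn | hmn
    · have hle : (t 1 / t m) ^ p ≤ 1 :=
        Real.rpow_le_one (by positivity) ((div_le_one hmp).2 (ht.le hm'.1 hm'.2)) hp0.le
      refine le_trans ?_ (l1_ge_of_mono_zero hα hα' ht hm
        (V := fun j => if j ≤ n then (1 - c) * t j ^ α else v j) h0
        fun j hj => hmono j (by omega))
      rw [if_pos hmn, mul_left_comm (t m ^ (-α)), ← Real.rpow_add hmp, neg_add_cancel,
        Real.rpow_zero, mul_assoc]
      refine mul_le_mul_of_nonneg_left ?_ hG.le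
      nlinarith [mul_le_mul_of_nonneg_left hle (by linarith : 0 ≤ (1 - c) / 2)]
    · set J₁ : ℝ := ∫ s in t n..t m, ((t m - s) ^ (-α) - t m ^ (-α)) * s ^ (α - 2) with hJ₁
      set J₂ : ℝ := ∫ s in t n..t m, ((t m - s) ^ (-α) - t m ^ (-α)) * s ^ (α - p - 1) with hJ₂
      have hnm := ht.le hmn.le hm'.2
      have hcont : ∀ e : ℝ, ContinuousOn (fun s : ℝ => s ^ e) (Icc (t n) (t m)) := fun e s hs =>
        (Real.continuousAt_rpow_const _ _ (Or.inl (hκ.trans_le hs.1).ne')).continuousWithinAt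
      refine le_trans ?_ (l1_ge_of_slope_le hα hα' ht hmn hm'.2
        (B := fun j => if j ≤ n then (1 - c) * t j ^ α else v j)
        (φ := fun s => (1 - α) * t n * s ^ (α - 2) -
          (1 - α) * (1 - 6 * η) * t n ^ p * s ^ (α - p - 1)) h0 hmono
        ((continuousOn_const.mul (hcont _)).sub (continuousOn_const.mul (hcont _))) ?_)
      · rw [mul_assoc]
        refine mul_le_mul_of_nonneg_left ?_ hG.le
        rw [hBn m hmn.le hm'.2]
        have hI : J₁ ≤ (t m)⁻¹ / (1 - α) := integral_kernel_mul_rpow_le hα' hκ hnm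
        have hJ₁₂ : t m ^ (1 - p) * J₁ ≤ J₂ := by
          rw [hJ₁, hJ₂, ← intervalIntegral.integral_const_mul]
          refine intervalIntegral.integral_mono_on_of_le_Ioo hnm
            ((intervalIntegrable_kernel_sub_mul hα' hnm _ (hcont _)).const_mul _)
            (intervalIntegrable_kernel_sub_mul hα' hnm _ (hcont _)) fun s hs => ?_
          have hs0 : 0 < s := hκ.trans hs.1
          have h3 : t m ^ (1 - p) * s ^ (α - 2) ≤ s ^ (α - p - 1) := by
            rw [show α - p - 1 = (1 - p) + (α - 2) by ring, Real.rpow_add hs0]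
            exact mul_le_mul_of_nonneg_right
              (Real.rpow_le_rpow_of_nonpos hs0 hs.2.le (by linarith)) (by positivity)
          have h4 := sub_nonneg.2 (kernel_ge hα hs0.le hs.2)
          nlinarith [mul_le_mul_of_nonneg_left h3 h4]
        have e3 : ∫ s in t n..t m, ((t m - s) ^ (-α) - t m ^ (-α)) *
            ((1 - α) * t n * s ^ (α - 2) -
              (1 - α) * (1 - 6 * η) * t n ^ p * s ^ (α - p - 1)) =
            (1 - α) * t n * J₁ - (1 - α) * (1 - 6 * η) * t n ^ p * J₂ := by
          rw [hJ₁, hJ₂, ← intervalIntegral.integral_const_mul,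
            ← intervalIntegral.integral_const_mul, ← intervalIntegral.integral_sub
            ((intervalIntegrable_kernel_sub_mul hα' hnm _ (hcont _)).const_mul _)
            ((intervalIntegrable_kernel_sub_mul hα' hnm _ (hcont _)).const_mul _)]
          exact intervalIntegral.integral_congr fun s _ => by ring
        set x : ℝ := t n / t m with hx
        have hx0 : 0 < x := by positivity
        have hx1 : x ≤ 1 := (div_le_one hmp).2 hnm
        have hxp : x ^ p ≤ x := by
          simpa using Real.rpow_le_rpow_of_exponent_ge hx0 hx1 hp.le
        have e4 : t m ^ (-α) * v m = x - c * x ^ p := by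
          simp only [hv]
          rw [hx, Real.div_rpow hκ.le hmp.le, Real.rpow_neg hmp.le,
            Real.rpow_sub hmp, Real.rpow_sub hmp, Real.rpow_one]
          field_simp
        have e5 : t n ^ p * t m ^ (1 - p) = t m * x ^ p := by
          rw [hx, Real.div_rpow hκ.le hmp.le, Real.rpow_sub hmp, Real.rpow_one]
          ring
        have e6 : t n = t m * x := by rw [hx]; field_simp
        rw [e3, e4]
        have h7 : (t 1 / t m) ^ p ≤ x ^ p :=
          Real.rpow_le_rpow (by positivity)
            (by rw [hx]; gcongr; exact ht.le hn'.1 hn'.2) hp0.le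
        have h8 : 0 ≤ x ^ p := by positivity
        have h9 : (1 - α) * (1 - 6 * η) * t n ^ p * (t m ^ (1 - p) * J₁) ≤
            (1 - α) * (1 - 6 * η) * t n ^ p * J₂ := by
          have : 0 ≤ 1 - 6 * η := by linarith
          gcongr
        have h10 : (1 - α) * t m * J₁ ≤ 1 := by
          rw [le_div_iff₀ h1α] at hI
          calc (1 - α) * t m * J₁ = t m * (J₁ * (1 - α)) := by ring
            _ ≤ t m * (t m)⁻¹ := by gcongr
            _ = 1 := mul_inv_cancel₀ hmp.ne'
        have h11 : (1 - α) * (1 - 6 * η) * t n ^ p * (t m ^ (1 - p) * J₁) =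
            (1 - 6 * η) * x ^ p * ((1 - α) * t m * J₁) := by
          linear_combination (1 - α) * (1 - 6 * η) * J₁ * e5
        have h12 : (1 - α) * t n * J₁ = x * ((1 - α) * t m * J₁) := by
          linear_combination (1 - α) * J₁ * e6
        rw [h11] at h9
        rw [h12]
        -- This sign allows `(1-α) t_m J₁` to be replaced by its upper bound `1`. The terms linear
        -- in `x` then cancel and `(1 - 6η - c) x^p` remains.
        have h13 : 0 ≤ x - (1 - 6 * η) * x ^ p := by linarith [mul_nonneg hη0.le h8]
        have h14 := mul_le_mul_of_nonneg_left h10 h13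
        have h15 : c * x ^ p = x ^ p - 12 * (η * x ^ p) := by rw [hη]; ring
        have h16 := mul_le_mul_of_nonneg_left h7 (by linarith : 0 ≤ (1 - c) / 2)
        linarith
      · intro j hj hjm s hs
        rw [hBn j hj (by omega), hBn (j + 1) (by omega) (by omega)]
        have htj : 0 < t j := hκ.trans_le (ht.le hj (by omega))
        have hlt : t j < t (j + 1) := ht.lt (by omega) (by omega)
        have hs0 : 0 < s := htj.trans_le hs.1
        have hτ : 0 ≤ t (j + 1) - t j := by linarith
        set e : ℝ := η * (t n / t (j + 1)) ^ (p - 1) with he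
        have htj1 : 0 < t (j + 1) := htj.trans hlt
        have hq1 : (t n / t (j + 1)) ^ (p - 1) ≤ 1 :=
          Real.rpow_le_one (by positivity)
            ((div_le_one (htj.trans hlt)).2 (ht.le (by omega) (by omega))) (by linarith)
        have he0 : 0 ≤ e := by positivity
        have heη : e ≤ η := mul_le_of_le_one_right hη0.le hq1
        have hes : e ≤ η * (t n / s) ^ (p - 1) := by
          rw [he]
          have := hs.2
          gcongr
        have hst := hstep j hj (by omega)
        have h2 := rpow_sub_rpow_le (β := α - 1) (by linarith) htj hlt he0 (by linarith) hs
        have h3 := le_rpow_sub_rpow (β := α - p) (by linarith) htj hlt hη0.le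
          (by linarith [mul_le_mul_of_nonneg_right heη htj.le]) hs
        have h4 : (1 + e) ^ (1 - (α - 1)) ≤ 1 + 3 * e := by
          calc (1 + e) ^ (1 - (α - 1)) ≤ (1 + e) ^ ((2 : ℕ) : ℝ) :=
                Real.rpow_le_rpow_of_exponent_le (by linarith) (by push_cast; linarith)
            _ ≤ 1 + 3 * e := by
                rw [Real.rpow_natCast]
                nlinarith
        have h5 : 1 - 3 * η ≤ (1 + η) ^ (α - p - 1) := by
          calc 1 - 3 * η ≤ (1 + η) ^ (-((3 : ℕ) : ℝ)) := by
                rw [Real.rpow_neg (by linarith), Real.rpow_natCast, ← one_div, le_div_iff₀ (by positivity)]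
                linarith [pow_pos hη0 2, pow_pos hη0 3, pow_pos hη0 4, (by ring : (1 - 3 * η) * (1 + η) ^ 3 = 1 - 6 * η ^ 2 - 8 * η ^ 3 - 3 * η ^ 4)]
            _ ≤ (1 + η) ^ (α - p - 1) :=
                Real.rpow_le_rpow_of_exponent_le (by linarith) (by push_cast; linarith)
        -- The slope error of the leading power, weighted by `(t_n/s)^(p-1)`, is a multiple of the
        -- slope of the second power.
        have e7 : t n * (t n / s) ^ (p - 1) * s ^ (α - 2) = t n ^ p * s ^ (α - p - 1) := by
          rw [Real.div_rpow hκ.le hs0.le, show α - p - 1 = (α - 2) - (p - 1) by ring,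
            Real.rpow_sub hs0 (α - 2), Real.rpow_sub_one hκ.ne']
          field_simp
        have e8 : α - 1 - 1 = α - 2 := by ring
        rw [e8] at h2
        calc v j - v (j + 1) = t n * (t j ^ (α - 1) - t (j + 1) ^ (α - 1)) -
              c * (t n ^ p * (t j ^ (α - p) - t (j + 1) ^ (α - p))) := by
                simp only [hv]; ring
          _ ≤ t n * (-(α - 1) * ((1 + e) ^ (1 - (α - 1)) * s ^ (α - 2)) * (t (j + 1) - t j)) -
              c * (t n ^ p * (-(α - p) * ((1 + η) ^ (α - p - 1) * s ^ (α - p - 1)) *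
                (t (j + 1) - t j))) := by gcongr
          _ ≤ t n * ((1 - α) * ((1 + 3 * (η * (t n / s) ^ (p - 1))) * s ^ (α - 2)) *
                (t (j + 1) - t j)) -
              c * (t n ^ p * ((p - α) * ((1 - 3 * η) * s ^ (α - p - 1)) *
                (t (j + 1) - t j))) := by
              rw [neg_sub, neg_sub]
              gcongr
              linarith
          _ = _ := by
              linear_combination (3 * η * (1 - α) * (t (j + 1) - t j)) * e7 -
                (t n ^ p * (1 - 3 * η) * s ^ (α - p - 1) * (t (j + 1) - t j)) * hcp
  · simp only
    split_ifs with h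
    · have h2 : 1 ≤ C₀ * t 1 / t m := by
        rw [one_le_div hmp]
        exact (ht.le h hn'.2).trans hC₀
      calc (1 - c) * t m ^ α ≤ 1 * t m ^ α := by gcongr; linarith
        _ ≤ (C₀ * t 1 / t m) * t m ^ α := by gcongr
        _ = _ := by ring
    · have : 0 ≤ c * (t n ^ p * t m ^ (α - p)) := by positivity
      calc v m ≤ t n * t m ^ (α - 1) := by simp only [hv]; linarith
        _ ≤ (C₀ * t 1) * t m ^ (α - 1) := by gcongr
        _ = _ := by rw [Real.rpow_sub_one hmp.ne']; ring

end

/-! ### Barriers on quasi-graded meshes -/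

/-- Take for `n` the last node with `t n ≤ C₀ t₁`. Beyond it, with `X = t₁/t_{j+1}`, the grading
bounds the relative step by `c₃ X^(1/r) = c₃ X^g X^(1/r - g)`, and the spare positive power of `X`
is made small by a large `C₀`. The requirement `g < 1/r`, used with `g = p - 1`, is the origin of `p
< 1 + 1/r`. -/
theorem exists_grading_index {r c₃ g η : ℝ} (hc₃ : 0 < c₃) (hg : 0 ≤ g)
    (hg' : g < 1 / r) (hη : 0 < η) (hη' : η ≤ 1) :
    ∃ C₀ : ℝ, 1 ≤ C₀ ∧ ∀ (T : ℝ) (M : ℕ) (t : ℕ → ℝ), IsTemporalMesh T M t →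
      (∀ j ∈ Finset.Icc 1 M, t j - t (j - 1) ≤ c₃ * t 1 ^ (1 / r) * t j ^ (1 - 1 / r)) →
      ∃ n ∈ Finset.Icc 1 M, t n ≤ C₀ * t 1 ∧
        ∀ j, n ≤ j → j < M → t (j + 1) - t j ≤ η * (t n / t (j + 1)) ^ g * t j := by
  set e : ℝ := 1 / r - g with he
  have he0 : 0 < e := by linarith
  set A : ℝ := (2 * c₃ / η) ^ (1 / e) with hA
  have hA0 : 0 < A := by positivity
  refine ⟨max 1 A, le_max_left _ _, fun T M t ht hstep => ?_⟩
  have h1 : 0 < t 1 := ht.pos le_rfl ht.one_le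
  have hC1 : 1 ≤ max 1 A := le_max_left _ _
  set P : ℕ → Prop := fun j => t j ≤ max 1 A * t 1 with hP
  classical
  have hP1 : P 1 := by simp only [hP]; nlinarith
  refine ⟨Nat.findGreatest P M, Finset.mem_Icc.2 ⟨Nat.le_findGreatest ht.one_le hP1,
    Nat.findGreatest_le _⟩, Nat.findGreatest_spec ht.one_le hP1, fun j hj hjM => ?_⟩
  set n := Nat.findGreatest P M with hn
  have hn1 : 1 ≤ n := Nat.le_findGreatest ht.one_le hP1
  have hnot : ¬ P (j + 1) :=
    Nat.findGreatest_is_greatest (P := P) (n := M) (k := j + 1) (by omega) (by omega)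
  simp only [hP, not_le] at hnot
  have hj0 : 0 < t j := ht.pos (by omega) (by omega)
  have hj1 : 0 < t (j + 1) := ht.pos (by omega) (by omega)
  have hs := hstep (j + 1) (Finset.mem_Icc.2 ⟨by omega, by omega⟩)
  rw [Nat.add_sub_cancel] at hs
  set X : ℝ := t 1 / t (j + 1) with hX
  have hX0 : 0 < X := by positivity
  have hX1 : X ≤ 1 := (div_le_one hj1).2 (ht.le (by omega) (by omega))
  have hXA : X ≤ A⁻¹ := by
    rw [hX, div_le_iff₀ hj1, ← div_eq_inv_mul, le_div_iff₀ hA0]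
    nlinarith [le_max_right 1 A]
  have e1 : c₃ * t 1 ^ (1 / r) * t (j + 1) ^ (1 - 1 / r) = c₃ * X ^ (1 / r) * t (j + 1) := by
    rw [hX, Real.div_rpow h1.le hj1.le, Real.rpow_sub hj1, Real.rpow_one]
    ring
  have e2 : X ^ (1 / r) = X ^ g * X ^ e := by
    rw [← Real.rpow_add hX0, he]
    ring_nf
  have h2 : X ^ e ≤ η / (2 * c₃) := by
    calc X ^ e ≤ (A⁻¹) ^ e := Real.rpow_le_rpow hX0.le hXA he0.le
      _ = η / (2 * c₃) := by
        rw [Real.inv_rpow hA0.le, hA, ← Real.rpow_mul (by positivity), one_div,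
          inv_mul_cancel₀ he0.ne', Real.rpow_one, inv_div]
  have h3 : X ^ g ≤ 1 := Real.rpow_le_one hX0.le hX1 hg
  have h3' : 0 < X ^ g := Real.rpow_pos_of_pos hX0 _
  have h4 : t (j + 1) - t j ≤ η / 2 * X ^ g * t (j + 1) := by
    refine hs.trans ?_
    rw [e1, e2]
    calc c₃ * (X ^ g * X ^ e) * t (j + 1)
        ≤ c₃ * (X ^ g * (η / (2 * c₃))) * t (j + 1) := by gcongr
      _ = _ := by field_simp
  have h5 : η / 2 * X ^ g * t (j + 1) ≤ 1 / 2 * t (j + 1) := by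
    have : η * X ^ g ≤ 1 := mul_le_one₀ hη' h3'.le h3
    gcongr
    linarith
  have h6 : t (j + 1) ≤ 2 * t j := by linarith
  have h7 : X ^ g ≤ (t n / t (j + 1)) ^ g := by
    rw [hX]
    have := ht.le hn1 (by omega : n ≤ M)
    gcongr
  calc t (j + 1) - t j ≤ η / 2 * X ^ g * t (j + 1) := h4
    _ ≤ η / 2 * X ^ g * (2 * t j) := by gcongr
    _ = η * X ^ g * t j := by ring
    _ ≤ _ := by gcongr

/-- Barriers for the L1 operator without zero-order term. -/
theorem exists_l1_barrier {α r c₃ p : ℝ} (hα : 0 < α) (hα' : α < 1) (hr : 1 ≤ r) (hc₃ : 0 < c₃)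
    (hp1 : p ≠ 1) (hpr : p < 1 + 1 / r) :
    ∃ C : ℝ, 0 ≤ C ∧ ∀ (T : ℝ) (M : ℕ) (t : ℕ → ℝ), IsTemporalMesh T M t →
      (∀ j ∈ Finset.Icc 1 M, t j - t (j - 1) ≤ c₃ * t 1 ^ (1 / r) * t j ^ (1 - 1 / r)) →
      ∃ B : ℕ → ℝ, B 0 = 0 ∧ ∀ m ∈ Finset.Icc 1 M, (t 1 / t m) ^ p ≤ l1 α t B m ∧
        B m ≤ C * (t m ^ α * (t 1 / t m) ^ min p 1) := by
  have hr0 : 0 < 1 / r := by positivity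
  have hr1 : 1 / r ≤ 1 := by rw [div_le_one (by linarith)]; exact hr
  have hG := Gamma_one_sub_pos hα'
  have scale : ∀ {T : ℝ} {M : ℕ} {t : ℕ → ℝ} {k C : ℝ}, 0 < k →
      (∃ B : ℕ → ℝ, B 0 = 0 ∧ ∀ m ∈ Finset.Icc 1 M, (Real.Gamma (1 - α))⁻¹ * k *
        (t 1 / t m) ^ p ≤ l1 α t B m ∧ B m ≤ C * (t m ^ α * (t 1 / t m) ^ min p 1)) →
      ∃ B : ℕ → ℝ, B 0 = 0 ∧ ∀ m ∈ Finset.Icc 1 M, (t 1 / t m) ^ p ≤ l1 α t B m ∧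
        B m ≤ (Real.Gamma (1 - α) / k * C) * (t m ^ α * (t 1 / t m) ^ min p 1) := by
    rintro T M t k C hk ⟨B, h0, hB⟩
    refine ⟨fun j => Real.Gamma (1 - α) / k * B j, by simp [h0], fun m hm => ⟨?_, ?_⟩⟩
    · rw [l1_smul]
      calc (t 1 / t m) ^ p = Real.Gamma (1 - α) / k *
            ((Real.Gamma (1 - α))⁻¹ * k * (t 1 / t m) ^ p) := by field_simp
        _ ≤ _ := by gcongr; exact (hB m hm).1
    · rw [mul_assoc]
      exact mul_le_mul_of_nonneg_left (hB m hm).2 (by positivity)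
  rcases le_or_gt p α with hpα | hpα
  · refine ⟨Real.Gamma (1 - α) / 1 * 1, by positivity, fun T M t ht _ => scale (T := T) one_pos ?_⟩
    rw [min_eq_left (by linarith)]
    simpa using exists_barrier_of_le hα hα' hpα ht
  rcases lt_or_gt_of_ne hp1 with hp | hp
  · obtain ⟨C₀, hC₀, h⟩ := exists_grading_index (g := 0) (η := (1 - p) / 6) hc₃ le_rfl hr0
      (by linarith) (by linarith)
    have hk : 0 < (1 - p) / (2 * (1 - α)) := div_pos (by linarith) (by linarith)
    refine ⟨Real.Gamma (1 - α) / ((1 - p) / (2 * (1 - α))) * C₀ ^ p, by positivity,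
      fun T M t ht hst => scale (T := T) hk ?_⟩
    obtain ⟨n, hn, h1, h2⟩ := h T M t ht hst
    rw [min_eq_left hp.le]
    exact barrier_of_lt_one hα hα' hpα hp ht hn h1 (by simpa using h2)
  · set c := (1 - α) / (p - α) with hc
    have hc0 : 0 < c := div_pos (by linarith) (by linarith)
    have hc1 : c < 1 := by rw [hc, div_lt_one (by linarith)]; linarith
    obtain ⟨C₀, hC₀, h⟩ := exists_grading_index (g := p - 1) (η := (1 - c) / 12) hc₃
      (by linarith) (by linarith) (by linarith) (by linarith)
    have hk : 0 < (1 - c) / 2 := by linarith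
    refine ⟨Real.Gamma (1 - α) / ((1 - c) / 2) * C₀, by positivity,
      fun T M t ht hst => scale (T := T) hk ?_⟩
    obtain ⟨n, hn, h1, h2⟩ := h T M t ht hst
    rw [min_eq_right hp.le]
    simpa using barrier_of_one_lt hα hα' hp (by linarith) hc ht hn h1 h2

/-! ### Barriers for the L1 operator with the zero-order term `-λ`. -/

section
variable {α T : ℝ} {M : ℕ} {t : ℕ → ℝ}

/-- A growing barrier for `δ_t^α - λ` on meshes with small steps. -/
theorem one_le_l1_exp_barrier (hα : 0 < α) (hα' : α < 1) {lam θ : ℝ} (hlam : 0 ≤ lam)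
    (hθ : 0 < θ) (hθlam : 2 * lam + 1 ≤ (Real.Gamma (1 - α))⁻¹ * θ ^ (-α) / 2)
    (ht : IsTemporalMesh T M t) (hstep : ∀ j < M, t (j + 1) - t j ≤ θ / 2) {m : ℕ}
    (hm : m ∈ Finset.Icc 1 M) :
    1 ≤ l1 α t (fun j => Real.exp (2 * t j / θ) + θ ^ (-α) * t j ^ α) m -
      lam * (Real.exp (2 * t m / θ) + θ ^ (-α) * t m ^ α) := by
  have hm' := Finset.mem_Icc.1 hm
  have hmp : 0 < t m := ht.pos hm'.1 hm'.2
  have hG := inv_pos.2 (Gamma_one_sub_pos hα')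
  set E : ℕ → ℝ := fun j => Real.exp (2 * t j / θ) with hE
  have hEmono : ∀ j < m, E j ≤ E (j + 1) := fun j hj => by
    have := ht.le (Nat.le_succ j) (by omega)
    simp only [hE]
    gcongr
  have h1 : (Real.Gamma (1 - α))⁻¹ ≤ l1 α t (fun j => t j ^ α) m := by
    have := l1_ge_of_mono_zero hα hα' ht hm (V := fun j => t j ^ α)
      (by simp [ht.zero, Real.zero_rpow hα.ne']) fun j hj => by
        have := ht.nonneg (j := j) (by omega)
        have := ht.le (Nat.le_succ j) (by omega)
        gcongr
    rwa [← Real.rpow_add hmp, neg_add_cancel, Real.rpow_zero, mul_one] at this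
  have h2 : θ ^ (-α) * t m ^ α = (t m / θ) ^ α := by
    rw [Real.div_rpow hmp.le hθ.le, Real.rpow_neg hθ.le]
    ring
  have h3 : (t m / θ) ^ α ≤ E m := by
    have hy : 0 < t m / θ := by positivity
    calc (t m / θ) ^ α ≤ (1 + t m / θ) ^ α := by gcongr; linarith
      _ ≤ (1 + t m / θ) ^ (1 : ℝ) :=
        Real.rpow_le_rpow_of_exponent_le (by linarith) hα'.le
      _ = t m / θ + 1 := by rw [Real.rpow_one]; ring
      _ ≤ 2 * t m / θ + 1 := by rw [mul_div_assoc]; linarith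
      _ ≤ E m := Real.add_one_le_exp _
  have hE1 : 1 ≤ E m := Real.one_le_exp (by positivity)
  have hθα : 0 < θ ^ (-α) := by positivity
  rw [l1_add, l1_smul, h2]
  have h4 := mul_le_mul_of_nonneg_left h1 hθα.le
  -- Before `θ/2` the power `θ^(-α) t^α` supplies the growth, while the barrier stays below `4`.
  -- Later the exponential does.
  rcases lt_or_ge (t m) (θ / 2) with hsm | hlg
  · have h5 : 0 ≤ l1 α t E m := by
      refine le_trans ?_ (l1_ge_of_mono hα hα' ht (l := 0) hm'.1 hm'.2 hEmono)
      have : E 0 ≤ E m := by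
        simp only [hE, ht.zero]
        gcongr
      have : 0 ≤ E m - E 0 := by linarith
      rw [ht.zero, sub_zero]
      positivity
    have h6 : E m ≤ 3 := by
      have : 2 * t m / θ ≤ 1 := by rw [div_le_one hθ]; linarith
      calc E m ≤ Real.exp 1 := Real.exp_le_exp.2 this
        _ ≤ 3 := by linarith [Real.exp_one_lt_d9]
    have h7 : (t m / θ) ^ α ≤ 1 :=
      Real.rpow_le_one (by positivity) (by rw [div_le_one hθ]; linarith) hα.le
    nlinarith
  · classical
    -- The last node at least `θ/2` before `t m`. As steps are at most `θ/2`, it lies within `θ` of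
    -- `t m`, so the kernel there is at least `θ^(-α)`, while the exponential has grown at least by
    -- the factor `e` since then.
    set l := Nat.findGreatest (fun l => t l ≤ t m - θ / 2) m with hl
    have hP0 : t 0 ≤ t m - θ / 2 := by rw [ht.zero]; linarith
    have hls : t l ≤ t m - θ / 2 :=
      Nat.findGreatest_spec (P := fun l => t l ≤ t m - θ / 2) (Nat.zero_le m) hP0
    have hlm : l < m := by
      refine lt_of_le_of_ne (Nat.findGreatest_le _) fun h => ?_
      rw [h] at hls
      linarith
    have hl1 : ¬ t (l + 1) ≤ t m - θ / 2 :=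
      Nat.findGreatest_is_greatest (P := fun l => t l ≤ t m - θ / 2) (Nat.lt_succ_self _)
        (by omega)
    have hl2 := hstep l (by omega)
    have h5 : (θ : ℝ) ^ (-α) ≤ (t m - t l) ^ (-α) :=
      Real.rpow_le_rpow_of_nonpos (by linarith) (by linarith) (by linarith)
    have h6 : E m / 2 ≤ E m - E l := by
      have : E l ≤ E m * Real.exp (-1) := by
        simp only [hE]
        rw [← Real.exp_add]
        refine Real.exp_le_exp.2 ?_
        rw [div_le_iff₀ hθ, add_mul, div_mul_cancel₀ _ hθ.ne']
        linarith
      have h7 : Real.exp (-1) ≤ 1 / 2 := by linarith [Real.exp_neg_one_lt_d9]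
      have h8 := mul_le_mul_of_nonneg_left h7 (by linarith : 0 ≤ E m)
      linarith
    have h7 : (Real.Gamma (1 - α))⁻¹ * (θ ^ (-α) * (E m / 2)) ≤ l1 α t E m := by
      refine le_trans ?_ (l1_ge_of_mono hα hα' ht hlm hm'.2 hEmono)
      have := hθα.le.trans h5
      gcongr
    have h8 := mul_le_mul_of_nonneg_right hθlam (by linarith : 0 ≤ E m)
    have h9 := mul_le_mul_of_nonneg_left h3 hlam
    have h10 : 0 ≤ θ ^ (-α) * (Real.Gamma (1 - α))⁻¹ := by positivity
    linarith

/-- A geometric barrier, useful on meshes with a bounded number of steps. -/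
theorem one_le_l1_geometric_barrier (hα : 0 < α) (hα' : α < 1) {lam q : ℝ} (hq0 : 0 ≤ q)
    (hq : q < 1) (ht : IsTemporalMesh T M t)
    (hst : ∀ j ∈ Finset.Icc 1 M, lam * (t j - t (j - 1)) ^ α ≤ q * (Real.Gamma (2 - α))⁻¹)
    {m : ℕ} (hm : m ∈ Finset.Icc 1 M) :
    1 ≤ l1 α t (fun j => T ^ α * Real.Gamma (2 - α) * (2 / (1 - q)) ^ j) m -
      lam * (T ^ α * Real.Gamma (2 - α) * (2 / (1 - q)) ^ m) := by
  have hm' := Finset.mem_Icc.1 hm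
  have hG := Gamma_two_sub_pos hα'
  have hT : 0 < T := ht.last ▸ ht.pos ht.one_le le_rfl
  -- Chosen so that `D (1 - q) - 1 = 1`: the last increment, minus the fraction `q` lost to `lam`,
  -- still has the size of the previous term.
  set D : ℝ := 2 / (1 - q) with hD
  have hD1 : 1 ≤ D := by rw [hD, le_div_iff₀ (by linarith)]; linarith
  have hDq : D * (1 - q) = 2 := by
    rw [hD]
    have : 1 - q ≠ 0 := by linarith
    field_simp
  obtain ⟨n, rfl⟩ : ∃ n, m = n + 1 := ⟨m - 1, by omega⟩
  set K : ℝ := T ^ α * Real.Gamma (2 - α) with hK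
  have hK0 : 0 < K := by positivity
  have h1 := l1Coeff_mul_le_l1 hα hα' ht hm (V := fun j => K * D ^ j) (Q := K * D ^ n)
    fun j hj => by
      have : D ^ j ≤ D ^ n := pow_le_pow_right₀ hD1 (by omega)
      gcongr
  have hτ : 0 < t (n + 1) - t n := sub_pos.2 (ht.lt (by omega) hm'.2)
  have hs := hst (n + 1) hm
  have h2 : lam ≤ q * l1Coeff α t (n + 1) := by
    rw [Nat.add_sub_cancel, ← le_div_iff₀ (by positivity)] at hs
    refine hs.trans (le_of_eq ?_)
    rw [l1Coeff, Nat.add_sub_cancel, Real.rpow_neg hτ.le]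
    ring
  have h3 : 1 ≤ l1Coeff α t (n + 1) * K := by
    have h4 : T ^ (-α) ≤ (t (n + 1) - t n) ^ (-α) :=
      Real.rpow_le_rpow_of_nonpos hτ
        (by linarith [ht.le_last hm'.2, ht.nonneg (j := n) (by omega)]) (by linarith)
    calc (1 : ℝ) = (Real.Gamma (2 - α))⁻¹ * T ^ (-α) * K := by
          rw [hK, Real.rpow_neg hT.le]
          field_simp
      _ ≤ _ := by
          rw [l1Coeff, Nat.add_sub_cancel]
          gcongr
  have hDn : 1 ≤ D ^ n := one_le_pow₀ hD1
  have h5 := mul_le_mul_of_nonneg_right h2 (by positivity : 0 ≤ K * D ^ (n + 1))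
  have h6 : l1Coeff α t (n + 1) * (K * D ^ (n + 1) - K * D ^ n) -
      q * l1Coeff α t (n + 1) * (K * D ^ (n + 1)) = l1Coeff α t (n + 1) * K * D ^ n := by
    rw [pow_succ]
    linear_combination (l1Coeff α t (n + 1) * K * D ^ n) * hDq
  have h7 : 1 ≤ l1Coeff α t (n + 1) * K * D ^ n := by
    nlinarith
  linarith

end

theorem exists_rpow_neg_ge {α : ℝ} (hα : 0 < α) (K : ℝ) : ∃ θ : ℝ, 0 < θ ∧ K ≤ θ ^ (-α) := by
  refine ⟨(max K 1) ^ (-(1 / α)), by positivity, ?_⟩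
  rw [← Real.rpow_mul (by positivity)]
  have : -(1 / α) * -α = 1 := by field_simp
  rw [this, Real.rpow_one]
  exact le_max_left _ _

/-- Barriers for `δ_t^α - λ` on quasi-graded meshes, sources `(t₁/t_m)^p` with `p < 1`. -/
theorem exists_l1_barrier_lam_of_lt_one {α T lam r c₁ c₂ c₃ q p : ℝ} (hα : 0 < α) (hα' : α < 1)
    (hT : 0 < T) (hlam : 0 ≤ lam) (hr : 1 ≤ r) (hc₁ : 0 < c₁) (hc₂ : 0 < c₂) (hc₃ : 0 < c₃)
    (hq : q < 1) (hp0 : 0 ≤ p) (hp1 : p < 1) :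
    ∃ C : ℝ, 0 ≤ C ∧ ∀ (M : ℕ) (t : ℕ → ℝ), IsTemporalMesh T M t →
      QuasiGraded r c₁ c₂ c₃ M t →
      (∀ j ∈ Finset.Icc 1 M, lam * (t j - t (j - 1)) ^ α ≤ q * (Real.Gamma (2 - α))⁻¹) →
      ∀ m₀ ∈ Finset.Icc 1 M, ∃ B : ℕ → ℝ, 0 ≤ B 0 ∧
        (∀ m ∈ Finset.Icc 1 m₀, (t 1 / t m) ^ p ≤ l1 α t B m - lam * B m) ∧
        B m₀ ≤ C * (t m₀ ^ α * (t 1 / t m₀) ^ p) := by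
  have hr0 : 0 < r := by linarith
  have hG1 := Gamma_one_sub_pos hα'
  have hG2 := Gamma_two_sub_pos hα'
  obtain ⟨Cb, hCb, hbar⟩ := exists_l1_barrier (α := α) (r := r) (c₃ := c₃) (p := p) hα hα' hr hc₃
    hp1.ne (by have : 0 < 1 / r := by positivity
               linarith)
  obtain ⟨θ, hθ, hθK⟩ := exists_rpow_neg_ge hα ((2 * lam + 1) * 2 * Real.Gamma (1 - α))
  have hθ2 : 2 * lam + 1 ≤ (Real.Gamma (1 - α))⁻¹ * θ ^ (-α) / 2 := by
    rw [le_div_iff₀ two_pos, ← div_eq_inv_mul, le_div_iff₀ hG1]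
    exact hθK
  obtain ⟨s, hs, hsK⟩ := exists_rpow_neg_ge hα (2 * lam * Cb)
  have hsK' : ∀ x : ℝ, 0 < x → x ≤ s → 2 * lam * Cb * x ^ α ≤ 1 := by
    intro x hx hxs
    have h1 : x ^ α ≤ s ^ α := by gcongr
    calc 2 * lam * Cb * x ^ α ≤ s ^ (-α) * s ^ α := by gcongr
      _ = 1 := by rw [← Real.rpow_add hs, neg_add_cancel, Real.rpow_zero]
  -- Every step is at most `A / M`. For `M ≥ M₀` all steps are therefore at most `θ/2`. For `M < M₀`
  -- the number of steps is bounded and `t₁ ≥ τ₀`, so the geometric barrier suffices.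
  set A : ℝ := c₃ * c₂ ^ (1 / r) * T ^ (1 - 1 / r) with hA
  have hA0 : 0 < A := by positivity
  set M₀ : ℝ := 2 * A / θ with hM₀
  have hM₀0 : 0 < M₀ := by positivity
  set τ₀ : ℝ := c₁ * M₀ ^ (-r) with hτ₀
  have hτ₀0 : 0 < τ₀ := by positivity
  set Cw : ℝ := Real.exp (2 * T / θ) + θ ^ (-α) * T ^ α with hCw
  set Cs : ℝ := T ^ α * Real.Gamma (2 - α) * (2 / (1 - q)) ^ ⌈M₀⌉₊ with hCs
  have hCs0 : 0 ≤ Cs := by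
    have : 0 < 1 - q := by linarith
    positivity
  set C₁ : ℝ := 2 * Cb with hC₁
  set C₂ : ℝ := 2 * lam * Cb * T ^ α * Cw / (s ^ α * (s / T) ^ p) with hC₂
  set C₃ : ℝ := Cs / (τ₀ ^ α * (τ₀ / T) ^ p) with hC₃
  have hC₁0 : 0 ≤ C₁ := by positivity
  have hC₂0 : 0 ≤ C₂ := by positivity
  have hC₃0 : 0 ≤ C₃ := by positivity
  refine ⟨C₁ + C₂ + C₃, by positivity, fun M t ht hgr hst m₀ hm₀ => ?_⟩
  have hm₀' := Finset.mem_Icc.1 hm₀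
  have ht1 : 0 < t 1 := ht.pos le_rfl ht.one_le
  have htm₀ : 0 < t m₀ := ht.pos hm₀'.1 hm₀'.2
  have hM : (0 : ℝ) < M := by exact_mod_cast ht.one_le
  have hratio : ∀ m ∈ Finset.Icc 1 M, (t 1 / t m) ^ p ≤ 1 := fun m hm => by
    have hm' := Finset.mem_Icc.1 hm
    exact Real.rpow_le_one (by have := ht.pos hm'.1 hm'.2; positivity)
      ((div_le_one (ht.pos hm'.1 hm'.2)).2 (ht.le hm'.1 hm'.2)) hp0
  have hΦ0 : 0 ≤ t m₀ ^ α * (t 1 / t m₀) ^ p := by positivity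
  have hsteps : ∀ j < M, t (j + 1) - t j ≤ A / M := by
    intro j hj
    have h1 := hgr.step (j + 1) (Finset.mem_Icc.2 ⟨by omega, hj⟩)
    rw [Nat.add_sub_cancel] at h1
    have h2 : t 1 ^ (1 / r) ≤ c₂ ^ (1 / r) * (M : ℝ)⁻¹ := by
      calc t 1 ^ (1 / r) ≤ (c₂ * (M : ℝ) ^ (-r)) ^ (1 / r) :=
            Real.rpow_le_rpow ht1.le hgr.upper (by positivity)
        _ = _ := by
            rw [Real.mul_rpow hc₂.le (by positivity), ← Real.rpow_mul hM.le,
              show -r * (1 / r) = -1 by field_simp, Real.rpow_neg_one]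
    have h3 : t (j + 1) ^ (1 - 1 / r) ≤ T ^ (1 - 1 / r) := by
      refine Real.rpow_le_rpow (ht.nonneg hj) (ht.le_last hj) ?_
      rw [sub_nonneg, div_le_one hr0]
      exact hr
    have h4 : 0 ≤ t (j + 1) ^ (1 - 1 / r) := Real.rpow_nonneg (ht.nonneg hj) _
    calc t (j + 1) - t j ≤ c₃ * t 1 ^ (1 / r) * t (j + 1) ^ (1 - 1 / r) := h1
      _ ≤ c₃ * (c₂ ^ (1 / r) * (M : ℝ)⁻¹) * T ^ (1 - 1 / r) := by gcongr
      _ = A / M := by rw [hA]; ring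
  rcases le_or_gt M₀ M with hML | hMS
  · have hstep2 : ∀ j < M, t (j + 1) - t j ≤ θ / 2 := by
      intro j hj
      refine (hsteps j hj).trans ?_
      rw [div_le_iff₀ hM]
      rw [hM₀, div_le_iff₀ hθ] at hML
      linarith
    obtain ⟨B₀, hB₀, hB⟩ := hbar T M t ht hgr.step
    simp only [min_eq_left hp1.le] at hB
    -- Up to time `s` the zero-order term is absorbed by doubling `B₀`. The exponential part must be
    -- left out there, since it need not be bounded by the small quantity `t_{m₀}^α (t₁/t_{m₀})^p`.
    -- This is why the barrier depends on the final index `m₀`.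
    rcases le_or_gt (t m₀) s with hms | hms
    · refine ⟨fun j => 2 * B₀ j, by simp [hB₀], fun m hm => ?_, ?_⟩
      · have hm' := Finset.mem_Icc.1 hm
        have hmM : m ∈ Finset.Icc 1 M := Finset.mem_Icc.2 ⟨hm'.1, hm'.2.trans hm₀'.2⟩
        obtain ⟨h1, h2⟩ := hB m hmM
        have htm : 0 < t m := ht.pos hm'.1 (by omega)
        have h3 := hsK' (t m) htm ((ht.le hm'.2 hm₀'.2).trans hms)
        have h4 : 0 ≤ (t 1 / t m) ^ p := by positivity
        have h5 := mul_le_mul_of_nonneg_left h2 hlam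
        have h6 := mul_le_mul_of_nonneg_right h3 h4
        rw [l1_smul]
        linarith
      · have h2 := (hB m₀ hm₀).2
        have : 0 ≤ (C₂ + C₃) * (t m₀ ^ α * (t 1 / t m₀) ^ p) := by positivity
        simp only
        linarith
    · set W : ℕ → ℝ := fun j => Real.exp (2 * t j / θ) + θ ^ (-α) * t j ^ α with hW
      -- For `t m > s` this constant dominates `lam * (2 * B₀ m)`.
      set k : ℝ := 2 * lam * Cb * T ^ α * (t 1 / s) ^ p with hk
      have hk0 : 0 ≤ k := by positivity
      have hW0 : ∀ j ≤ M, 0 ≤ W j := fun j hj => by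
        have := ht.nonneg hj
        positivity
      refine ⟨fun j => 2 * B₀ j + k * W j, ?_, fun m hm => ?_, ?_⟩
      · have := mul_nonneg hk0 (hW0 0 (Nat.zero_le _))
        simp only [hB₀]
        linarith
      · have hm' := Finset.mem_Icc.1 hm
        have hmM : m ∈ Finset.Icc 1 M := Finset.mem_Icc.2 ⟨hm'.1, hm'.2.trans hm₀'.2⟩
        obtain ⟨h1, h2⟩ := hB m hmM
        have htm : 0 < t m := ht.pos hm'.1 (by omega)
        have h4 : 0 ≤ (t 1 / t m) ^ p := by positivity
        have h5 := mul_le_mul_of_nonneg_left h2 hlam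
        have h7 : 1 ≤ l1 α t W m - lam * W m :=
          one_le_l1_exp_barrier hα hα' hlam hθ hθ2 ht hstep2 hmM
        have h8 := mul_le_mul_of_nonneg_left h7 hk0
        rw [l1_add, l1_smul, l1_smul]
        rcases le_or_gt (t m) s with hs1 | hs1
        · have h3 := hsK' (t m) htm hs1
          have h6 := mul_le_mul_of_nonneg_right h3 h4
          linarith
        · have h9 : 2 * lam * Cb * (t m ^ α * (t 1 / t m) ^ p) ≤ k := by
            have : t m ≤ T := ht.le_last (by omega)
            rw [hk, ← mul_assoc]
            gcongr
          linarith
      · have h2 := (hB m₀ hm₀).2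
        have hmT : t m₀ ≤ T := ht.le_last hm₀'.2
        have h3 : W m₀ ≤ Cw := by
          simp only [hW, hCw]
          gcongr
        have h4 : k * Cw ≤ C₂ * (t m₀ ^ α * (t 1 / t m₀) ^ p) := by
          have h5 : s ^ α * (t 1 / T) ^ p ≤ t m₀ ^ α * (t 1 / t m₀) ^ p := by gcongr
          refine le_trans (le_of_eq ?_) (mul_le_mul_of_nonneg_left h5 hC₂0)
          rw [hC₂, hk, Real.div_rpow ht1.le hs.le, Real.div_rpow ht1.le hT.le,
            Real.div_rpow hs.le hT.le]
          have : s ^ p ≠ 0 := by positivity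
          have : T ^ p ≠ 0 := by positivity
          field_simp
        have h5 := mul_le_mul_of_nonneg_left h3 hk0
        have : 0 ≤ C₃ * (t m₀ ^ α * (t 1 / t m₀) ^ p) := by positivity
        simp only
        linarith
  · have hq0 : 0 ≤ q := by
      have h1 := hst 1 (Finset.mem_Icc.2 ⟨le_rfl, ht.one_le⟩)
      have h2 : 0 ≤ lam * (t 1 - t (1 - 1)) ^ α := by
        have : 0 ≤ t 1 - t (1 - 1) := sub_nonneg.2 (ht.le (by omega) ht.one_le)
        positivity
      have h3 := inv_pos.2 hG2
      by_contra hcon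
      nlinarith
    refine ⟨fun j => T ^ α * Real.Gamma (2 - α) * (2 / (1 - q)) ^ j, ?_, fun m hm => ?_, ?_⟩
    · have : 0 < 1 - q := by linarith
      positivity
    · have hm' := Finset.mem_Icc.1 hm
      have hmM : m ∈ Finset.Icc 1 M := Finset.mem_Icc.2 ⟨hm'.1, hm'.2.trans hm₀'.2⟩
      exact (hratio m hmM).trans (one_le_l1_geometric_barrier hα hα' hq0 hq ht hst hmM)
    · have hD1 : 1 ≤ 2 / (1 - q) := by rw [le_div_iff₀ (by linarith)]; linarith
      have h1 : T ^ α * Real.Gamma (2 - α) * (2 / (1 - q)) ^ m₀ ≤ Cs := by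
        have : m₀ ≤ ⌈M₀⌉₊ := by
          have h2 : (m₀ : ℝ) ≤ M := by exact_mod_cast hm₀'.2
          exact_mod_cast (h2.trans hMS.le).trans (Nat.le_ceil M₀)
        rw [hCs]
        gcongr
      have h2 : τ₀ ≤ t 1 := by
        refine le_trans ?_ hgr.lower
        rw [hτ₀]
        refine mul_le_mul_of_nonneg_left ?_ hc₁.le
        exact Real.rpow_le_rpow_of_nonpos hM hMS.le (by linarith)
      have h3 : τ₀ ^ α * (τ₀ / T) ^ p ≤ t m₀ ^ α * (t 1 / t m₀) ^ p := by
        have h4 : τ₀ ≤ t m₀ := h2.trans (ht.le hm₀'.1 hm₀'.2)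
        have h5 : t m₀ ≤ T := ht.le_last hm₀'.2
        gcongr
      have h4 : Cs ≤ C₃ * (t m₀ ^ α * (t 1 / t m₀) ^ p) := by
        refine le_trans (le_of_eq ?_) (mul_le_mul_of_nonneg_left h3 hC₃0)
        rw [hC₃]
        field_simp
      have : 0 ≤ (C₁ + C₂) * (t m₀ ^ α * (t 1 / t m₀) ^ p) := by positivity
      simp only
      linarith

/-- Barriers for `δ_t^α - λ` on quasi-graded meshes, sources `(t₁/t_m)^p`. -/
theorem exists_l1_barrier_lam {α T lam r c₁ c₂ c₃ q p : ℝ} (hα : 0 < α) (hα' : α < 1)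
    (hT : 0 < T) (hlam : 0 ≤ lam) (hr : 1 ≤ r) (hc₁ : 0 < c₁) (hc₂ : 0 < c₂) (hc₃ : 0 < c₃)
    (hq : q < 1) (hp0 : 0 ≤ p) (hp1 : p ≠ 1) (hpr : p < 1 + 1 / r) :
    ∃ C : ℝ, 0 ≤ C ∧ ∀ (M : ℕ) (t : ℕ → ℝ), IsTemporalMesh T M t →
      QuasiGraded r c₁ c₂ c₃ M t →
      (∀ j ∈ Finset.Icc 1 M, lam * (t j - t (j - 1)) ^ α ≤ q * (Real.Gamma (2 - α))⁻¹) →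
      ∀ m₀ ∈ Finset.Icc 1 M, ∃ B : ℕ → ℝ, 0 ≤ B 0 ∧
        (∀ m ∈ Finset.Icc 1 m₀, (t 1 / t m) ^ p ≤ l1 α t B m - lam * B m) ∧
        B m₀ ≤ C * (t m₀ ^ α * (t 1 / t m₀) ^ min p 1) := by
  rcases lt_or_gt_of_ne hp1 with hp | hp
  · rw [min_eq_left hp.le]
    exact exists_l1_barrier_lam_of_lt_one hα hα' hT hlam hr hc₁ hc₂ hc₃ hq hp0 hp
  rw [min_eq_right hp.le]
  obtain ⟨Cb, hCb, hbar⟩ := exists_l1_barrier (α := α) (r := r) (c₃ := c₃) (p := p) hα hα' hr hc₃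
    hp1 hpr
  obtain ⟨C', hC', hbar'⟩ := exists_l1_barrier_lam_of_lt_one (α := α) (T := T) (lam := lam)
    (r := r) (c₁ := c₁) (c₂ := c₂) (c₃ := c₃) (q := q) (p := 1 - α) hα hα' hT hlam hr hc₁ hc₂ hc₃
    hq (by linarith) (by linarith)
  refine ⟨Cb + lam * Cb * C' * T ^ α, by positivity, fun M t ht hgr hst m₀ hm₀ => ?_⟩
  have hm₀' := Finset.mem_Icc.1 hm₀
  have ht1 : 0 < t 1 := ht.pos le_rfl ht.one_le
  have htm₀ : 0 < t m₀ := ht.pos hm₀'.1 hm₀'.2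
  obtain ⟨B₀, hB₀, hB⟩ := hbar T M t ht hgr.step
  obtain ⟨B₁, hB₁, hB₁', hB₁''⟩ := hbar' M t ht hgr hst m₀ hm₀
  simp only [min_eq_right hp.le, Real.rpow_one] at hB
  -- For `p > 1` the term `lam * B₀` is of size `x^α (t₁/x)`. The identity recognizes it as `t₁^α`
  -- times a source of exponent `1 - α < 1`, which the previous case handles.
  have key : ∀ x : ℝ, 0 < x → t 1 ^ α * (t 1 / x) ^ (1 - α) = x ^ α * (t 1 / x) := by
    intro x hx
    rw [Real.div_rpow ht1.le hx.le, Real.rpow_sub ht1, Real.rpow_sub hx, Real.rpow_one,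
      Real.rpow_one]
    field_simp
  refine ⟨fun j => B₀ j + lam * Cb * t 1 ^ α * B₁ j, ?_, fun m hm => ?_, ?_⟩
  · simp only [hB₀, zero_add]
    positivity
  · have hm' := Finset.mem_Icc.1 hm
    have hmM : m ∈ Finset.Icc 1 M := Finset.mem_Icc.2 ⟨hm'.1, hm'.2.trans hm₀'.2⟩
    obtain ⟨h1, h2⟩ := hB m hmM
    have htm : 0 < t m := ht.pos hm'.1 (by omega)
    have h3 := mul_le_mul_of_nonneg_left (hB₁' m hm)
      (by positivity : 0 ≤ lam * Cb * t 1 ^ α)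
    have h4 := mul_le_mul_of_nonneg_left h2 hlam
    rw [mul_assoc, key _ htm] at h3
    rw [l1_add, l1_smul]
    linarith
  · have h1 := (hB m₀ hm₀).2
    have h2 := mul_le_mul_of_nonneg_left hB₁'' (by positivity : 0 ≤ lam * Cb * t 1 ^ α)
    have h3 : lam * Cb * t 1 ^ α * (C' * (t m₀ ^ α * (t 1 / t m₀) ^ (1 - α))) =
        lam * Cb * C' * t m₀ ^ α * (t m₀ ^ α * (t 1 / t m₀)) := by
      rw [← key _ htm₀]
      ring
    have h4 : lam * Cb * C' * t m₀ ^ α * (t m₀ ^ α * (t 1 / t m₀)) ≤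
        lam * Cb * C' * T ^ α * (t m₀ ^ α * (t 1 / t m₀)) := by
      have : t m₀ ≤ T := ht.le_last hm₀'.2
      gcongr
    rw [Real.rpow_one]
    linarith

/-! ### The truncation error of the L1 discretization -/

/-- This is `y ≤ y^α` for `y = (c - s)/(c - x) ∈ (0,1]`. The factor `(s - x)/(c - x)` vanishes at `s
= x` and is below `1`, so the bound also serves on the last mesh interval, where the kernel is
singular. -/
theorem kernel_sub_kernel_le {α c x s : ℝ} (hα : 0 < α) (hα' : α < 1) (hx : x ≤ s) (hs : s < c) :
    (c - s) ^ (-α) - (c - x) ^ (-α) ≤ (c - s) ^ (-α) * ((s - x) / (c - x)) := by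
  have h1 : 0 < c - s := by linarith
  have h2 : 0 < c - x := by linarith
  have h3 : (c - s) / (c - x) ≤ ((c - s) / (c - x)) ^ α := by
    have := Real.rpow_le_rpow_of_exponent_ge (div_pos h1 h2)
      ((div_le_one h2).2 (by linarith)) hα'.le
    simpa using this
  have h4 : (c - x) ^ (-α) = (c - s) ^ (-α) * ((c - s) / (c - x)) ^ α := by
    rw [Real.div_rpow h1.le h2.le, Real.rpow_neg h1.le, Real.rpow_neg h2.le]
    have := (Real.rpow_pos_of_pos h1 α).ne'
    field_simp
  have h5 : (s - x) / (c - x) = 1 - (c - s) / (c - x) := by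
    field_simp
    ring
  have h6 : 0 < (c - s) ^ (-α) := by positivity
  rw [h4, h5]
  nlinarith

theorem kernel_sub_kernel_nonneg {α c x s : ℝ} (hα : 0 < α) (hx : x ≤ s) (hs : s < c) :
    0 ≤ (c - s) ^ (-α) - (c - x) ^ (-α) :=
  sub_nonneg.2 (Real.rpow_le_rpow_of_nonpos (by linarith) (by linarith) (by linarith))

/-- The contribution of one mesh interval to the truncation error. -/
theorem abs_interval_truncation_le {α c x y : ℝ} (hα' : α < 1) {v G : ℝ → ℝ} (hxy : x < y)
    (hcont : ContinuousOn v (Icc x y)) (hdiff : ∀ s ∈ Ioo x y, DifferentiableAt ℝ v s)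
    (hint : IntervalIntegrable (deriv v) volume x y)
    (hint' : IntervalIntegrable (fun s => (c - s) ^ (-α) * deriv v s) volume x y)
    (hG : IntervalIntegrable G volume x y)
    (hbound : ∀ s ∈ Ioo x y, |((c - s) ^ (-α) - (c - x) ^ (-α)) *
      ((v y - v x) / (y - x) - deriv v s)| ≤ G s) :
    |(v y - v x) / (y - x) * (∫ s in x..y, (c - s) ^ (-α)) -
      ∫ s in x..y, (c - s) ^ (-α) * deriv v s| ≤ ∫ s in x..y, G s := by
  set σ : ℝ := (v y - v x) / (y - x) with hσ
  have hyx : y - x ≠ 0 := by linarith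
  have hker := intervalIntegrable_kernel (α := α) hα' c x y
  have hF := intervalIntegral.integral_eq_sub_of_hasDerivAt_of_le hxy.le hcont
    (fun s hs => (hdiff s hs).hasDerivAt) hint
  have e : σ * (∫ s in x..y, (c - s) ^ (-α)) - ∫ s in x..y, (c - s) ^ (-α) * deriv v s =
      ∫ s in x..y, ((c - s) ^ (-α) - (c - x) ^ (-α)) * (σ - deriv v s) := by
    -- Slope minus derivative has mean zero, so a constant may be subtracted from the kernel. The
    -- value at the left endpoint is finite even if `y = c`.
    have e1 : ∫ s in x..y, (c - x) ^ (-α) * (σ - deriv v s) = 0 := by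
      rw [intervalIntegral.integral_const_mul, intervalIntegral.integral_sub
        intervalIntegrable_const hint, hF, intervalIntegral.integral_const, hσ, smul_eq_mul]
      field_simp
      ring
    have e2 : ∫ s in x..y, ((c - s) ^ (-α) - (c - x) ^ (-α)) * (σ - deriv v s) =
        (∫ s in x..y, (σ * (c - s) ^ (-α) - (c - s) ^ (-α) * deriv v s)) -
          ∫ s in x..y, (c - x) ^ (-α) * (σ - deriv v s) := by
      rw [← intervalIntegral.integral_sub ((hker.const_mul σ).sub hint')
        ((intervalIntegrable_const.sub hint).const_mul _)]
      exact intervalIntegral.integral_congr fun s _ => by ring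
    rw [e2, e1, sub_zero, intervalIntegral.integral_sub (hker.const_mul σ) hint',
      intervalIntegral.integral_const_mul]
  rw [e, ← Real.norm_eq_abs]
  refine intervalIntegral.norm_integral_le_of_norm_le hxy.le ?_ hG
  have hne : ∀ᵐ s ∂(volume : Measure ℝ), s ≠ y := by
    simp [ae_iff, measure_singleton]
  filter_upwards [hne] with s hs hs'
  exact hbound s ⟨hs'.1, lt_of_le_of_ne hs'.2 hs⟩

theorem min_mul_rpow_le {α R z : ℝ} (hz : 0 < z) : min R z * z ^ (-α - 1) ≤ z ^ (-α) := by
  calc min R z * z ^ (-α - 1) ≤ z * z ^ (-α - 1) := by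
        gcongr
        exact min_le_right _ _
    _ = z ^ (-α) := by
        rw [mul_comm, ← Real.rpow_add_one hz.ne', sub_add_cancel]

theorem intervalIntegrable_min_mul_kernel {α R c x : ℝ} (hα' : α < 1) (hR : 0 < R)
    (hx : x ≤ c) :
    IntervalIntegrable (fun s => min R (c - s) * (c - s) ^ (-α - 1)) volume x c := by
  refine (intervalIntegrable_kernel (α := α) hα' c x c).mono_fun ?_ ?_
  · refine Measurable.aestronglyMeasurable ?_
    fun_prop
  · refine (ae_restrict_iff' measurableSet_uIoc).2 (Filter.Eventually.of_forall fun s hs => ?_)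
    rw [uIoc_of_le hx] at hs
    rcases hs.2.eq_or_lt with rfl | hsc
    · simp [min_eq_right hR.le]
    · have h1 : 0 < c - s := by linarith
      have hm : 0 < min R (c - s) := lt_min hR h1
      beta_reduce
      rw [Real.norm_of_nonneg (by positivity), Real.norm_of_nonneg (by positivity)]
      exact min_mul_rpow_le h1

/-- Split at distance `R` from `c`: closer in, the integrand equals `(c-s)^(-α)`; farther out, it
equals `R (c-s)^(-α-1)`. Both parts are of order `R^(1-α)`. -/
theorem integral_min_mul_kernel_le {α R c x : ℝ} (hα : 0 < α) (hα' : α < 1) (hR : 0 < R)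
    (hx : x ≤ c) :
    ∫ s in x..c, min R (c - s) * (c - s) ^ (-α - 1) ≤ R ^ (1 - α) * (1 / (1 - α) + 1 / α) := by
  have h1α : 0 < 1 - α := by linarith
  have near : ∀ x' ≤ c, c - x' ≤ R →
      ∫ s in x'..c, min R (c - s) * (c - s) ^ (-α - 1) ≤ R ^ (1 - α) / (1 - α) := by
    intro x' hx' hR'
    have h1 : ∫ s in x'..c, min R (c - s) * (c - s) ^ (-α - 1) ≤ ∫ s in x'..c, (c - s) ^ (-α) := by
      refine intervalIntegral.integral_mono_on_of_le_Ioo hx'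
        (intervalIntegrable_min_mul_kernel hα' hR hx') (intervalIntegrable_kernel hα' _ _ _)
        fun s hs => ?_
      have h2 : 0 < c - s := by linarith [hs.2]
      exact min_mul_rpow_le h2
    refine h1.trans ?_
    rw [integral_kernel hα', sub_self, Real.zero_rpow h1α.ne', sub_zero]
    have : 0 ≤ c - x' := by linarith
    gcongr
  have hsplit : R ^ (1 - α) * (1 / (1 - α) + 1 / α) =
      R ^ (1 - α) / (1 - α) + R ^ (1 - α) / α := by ring
  rw [hsplit]
  have hpos : 0 < R ^ (1 - α) / α := by positivity
  rcases le_or_gt (c - x) R with h | h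
  · linarith [near x hx h]
  · have hy : x ≤ c - R := by linarith
    have hyc : c - R ≤ c := by linarith
    have hi := intervalIntegrable_min_mul_kernel (α := α) hα' hR hx
    have hi1 := hi.mono_set (c := x) (d := c - R) (by
      rw [uIcc_of_le hx, uIcc_of_le hy]
      exact Icc_subset_Icc le_rfl hyc)
    have hi2 := hi.mono_set (c := c - R) (d := c) (by
      rw [uIcc_of_le hx, uIcc_of_le hyc]
      exact Icc_subset_Icc hy le_rfl)
    rw [← intervalIntegral.integral_add_adjacent_intervals hi1 hi2]
    have h2 := near (c - R) hyc (by linarith)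
    have hnot : (0 : ℝ) ∉ uIcc (c - (c - R)) (c - x) := by
      rw [uIcc_of_le (by linarith)]
      exact fun h0 => by linarith [h0.1]
    have hi3 : IntervalIntegrable (fun s => R * (c - s) ^ (-α - 1)) volume x (c - R) := by
      have := (intervalIntegral.intervalIntegrable_rpow (μ := volume) (a := c - x)
        (b := c - (c - R)) (r := -α - 1) (Or.inr (by rwa [uIcc_comm]))).comp_sub_left c
      simpa using this.const_mul R
    have h3 : ∫ s in x..(c - R), min R (c - s) * (c - s) ^ (-α - 1) ≤
        ∫ s in x..(c - R), R * (c - s) ^ (-α - 1) := by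
      refine intervalIntegral.integral_mono_on_of_le_Ioo hy hi1 hi3 fun s hs => ?_
      have h2 : 0 < c - s := by linarith [hs.2]
      gcongr
      exact min_le_left _ _
    have h4 : ∫ s in x..(c - R), R * (c - s) ^ (-α - 1) =
        R * ((R ^ (-α) - (c - x) ^ (-α)) / α) := by
      rw [intervalIntegral.integral_const_mul,
        intervalIntegral.integral_comp_sub_left (fun s : ℝ => s ^ (-α - 1)) c,
        integral_rpow (Or.inr ⟨by linarith, hnot⟩)]
      rw [show -α - 1 + 1 = -α by ring, sub_sub_cancel, ← neg_div_neg_eq]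
      ring_nf
    have h5 : R * ((R ^ (-α) - (c - x) ^ (-α)) / α) ≤ R ^ (1 - α) / α := by
      rw [mul_div_assoc', show 1 - α = -α + 1 by ring, Real.rpow_add_one hR.ne']
      have : 0 ≤ (c - x) ^ (-α) := Real.rpow_nonneg (by linarith) _
      refine div_le_div_of_nonneg_right ?_ hα.le
      nlinarith
    linarith


/-- On a quasi-graded mesh neighbouring times are comparable, except for `t₀` and `t₁`. -/
theorem quasiGraded_succ_le {r c₃ T : ℝ} (hr : 1 ≤ r) (hc₃ : 0 < c₃) {M : ℕ} {t : ℕ → ℝ}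
    (ht : IsTemporalMesh T M t)
    (hstep : ∀ j ∈ Finset.Icc 1 M, t j - t (j - 1) ≤ c₃ * t 1 ^ (1 / r) * t j ^ (1 - 1 / r))
    {j : ℕ} (hj : 1 ≤ j) (hjM : j < M) :
    t (j + 1) ≤ max 2 ((2 * c₃) ^ r) * t j := by
  have h1 : 0 < t 1 := ht.pos le_rfl ht.one_le
  have hj0 : 0 < t j := ht.pos hj hjM.le
  have hj1 : 0 < t (j + 1) := ht.pos (by omega) hjM
  have h1j : t 1 ≤ t j := ht.le hj hjM.le
  have hr0 : 0 < r := by linarith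
  have hs := hstep (j + 1) (Finset.mem_Icc.2 ⟨by omega, hjM⟩)
  rw [Nat.add_sub_cancel] at hs
  rcases le_or_gt (t (j + 1)) ((2 * c₃) ^ r * t 1) with h | h
  · calc t (j + 1) ≤ (2 * c₃) ^ r * t 1 := h
      _ ≤ max 2 ((2 * c₃) ^ r) * t j := by
        gcongr
        exact le_max_right _ _
  · have h2 : t 1 / t (j + 1) ≤ ((2 * c₃) ^ r)⁻¹ := by
      rw [div_le_iff₀ hj1, ← div_eq_inv_mul, le_div_iff₀ (by positivity)]
      linarith
    have h3 : (t 1 / t (j + 1)) ^ (1 / r) ≤ (2 * c₃)⁻¹ := by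
      calc (t 1 / t (j + 1)) ^ (1 / r) ≤ (((2 * c₃) ^ r)⁻¹) ^ (1 / r) := by gcongr
        _ = (2 * c₃)⁻¹ := by
          rw [Real.inv_rpow (by positivity), ← Real.rpow_mul (by positivity),
            mul_one_div_cancel hr0.ne', Real.rpow_one]
    have h4 : c₃ * t 1 ^ (1 / r) * t (j + 1) ^ (1 - 1 / r) =
        c₃ * (t 1 / t (j + 1)) ^ (1 / r) * t (j + 1) := by
      rw [Real.div_rpow h1.le hj1.le, Real.rpow_sub hj1, Real.rpow_one]
      ring
    have h5 : c₃ * (t 1 / t (j + 1)) ^ (1 / r) * t (j + 1) ≤ 1 / 2 * t (j + 1) := by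
      calc c₃ * (t 1 / t (j + 1)) ^ (1 / r) * t (j + 1) ≤ c₃ * (2 * c₃)⁻¹ * t (j + 1) := by gcongr
        _ = _ := by field_simp
    calc t (j + 1) ≤ 2 * t j := by linarith
      _ ≤ _ := by
        gcongr
        exact le_max_left _ _

/-- Growth of a function whose derivative is bounded by `K s^{α-1}`. -/
theorem abs_sub_le_of_deriv_le {α T K : ℝ} (hα : 0 < α) {v : ℝ → ℝ}
    (hcont : ContinuousOn v (Icc 0 T)) (hd : ∀ s ∈ Ioo 0 T, DifferentiableAt ℝ v s)
    (hK : ∀ s ∈ Ioo 0 T, |deriv v s| ≤ K * s ^ (α - 1)) {x y : ℝ} (hx : 0 ≤ x) (hxy : x ≤ y)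
    (hy : y ≤ T) : |v y - v x| ≤ K / α * (y ^ α - x ^ α) := by
  have hF : ∀ s ∈ Ioo 0 T, HasDerivAt (fun s : ℝ => K / α * s ^ α) (K * s ^ (α - 1)) s := by
    intro s hs
    have := (Real.hasDerivAt_rpow_const (p := α) (Or.inl hs.1.ne')).const_mul (K / α)
    refine this.congr_deriv ?_
    field_simp
  have hFc : ContinuousOn (fun s : ℝ => K / α * s ^ α) (Icc 0 T) :=
    continuousOn_const.mul (continuousOn_id.rpow_const fun _ _ => Or.inr hα.le)
  have hxm : x ∈ Icc 0 T := ⟨hx, hxy.trans hy⟩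
  have hym : y ∈ Icc 0 T := ⟨hx.trans hxy, hy⟩
  have m1 : MonotoneOn (fun s => K / α * s ^ α + v s) (Icc 0 T) := by
    refine monotoneOn_of_deriv_nonneg (convex_Icc _ _) (hFc.add hcont) ?_ ?_
    · rw [interior_Icc]
      exact fun s hs => ((hF s hs).differentiableAt.add (hd s hs)).differentiableWithinAt
    · rw [interior_Icc]
      intro s hs
      rw [((hF s hs).fun_add (hd s hs).hasDerivAt).deriv]
      linarith [(abs_le.1 (hK s hs)).1]
  have m2 : MonotoneOn (fun s => K / α * s ^ α - v s) (Icc 0 T) := by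
    refine monotoneOn_of_deriv_nonneg (convex_Icc _ _) (hFc.sub hcont) ?_ ?_
    · rw [interior_Icc]
      exact fun s hs => ((hF s hs).differentiableAt.sub (hd s hs)).differentiableWithinAt
    · rw [interior_Icc]
      intro s hs
      rw [((hF s hs).fun_sub (hd s hs).hasDerivAt).deriv]
      linarith [(abs_le.1 (hK s hs)).2]
  have h1 := m1 hxm hym hxy
  have h2 := m2 hxm hym hxy
  simp only at h1 h2
  rw [abs_le]
  constructor <;> linarith

theorem abs_slope_sub_deriv_le {x y D : ℝ} {v : ℝ → ℝ} (hxy : x < y)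
    (hcont : ContinuousOn v (Icc x y)) (hd : ∀ s ∈ Ioo x y, DifferentiableAt ℝ v s)
    (hd2 : ∀ s ∈ Ioo x y, DifferentiableAt ℝ (deriv v) s)
    (hD : ∀ s ∈ Ioo x y, |deriv (deriv v) s| ≤ D) {s : ℝ} (hs : s ∈ Ioo x y) :
    |(v y - v x) / (y - x) - deriv v s| ≤ D * (y - x) := by
  obtain ⟨ξ, hξ, h⟩ := exists_deriv_eq_slope v hxy hcont
    fun s hs => (hd s hs).differentiableWithinAt
  rw [← h]
  have h1 := (convex_Ioo x y).norm_image_sub_le_of_norm_deriv_le (f := deriv v) (C := D) hd2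
    (fun s hs => by simpa using hD s hs) hs hξ
  rw [Real.norm_eq_abs, Real.norm_eq_abs] at h1
  refine h1.trans ?_
  have hD0 : 0 ≤ D := (abs_nonneg _).trans (hD s hs)
  gcongr
  rw [abs_le]
  constructor <;> linarith [hs.1, hs.2, hξ.1, hξ.2]

/-- A function of time with the regularity of typical solutions: `|∂_t^l v| ≤ K t^{α-l}`. -/
structure WeaklySingular (α T K : ℝ) (v : ℝ → ℝ) : Prop where
  cont : ContinuousOn v (Icc 0 T)
  diff : ∀ s ∈ Ioo 0 T, DifferentiableAt ℝ v s
  diff₂ : ∀ s ∈ Ioo 0 T, DifferentiableAt ℝ (deriv v) s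
  bound : ∀ s ∈ Ioo 0 T, |deriv v s| ≤ K * s ^ (α - 1)
  bound₂ : ∀ s ∈ Ioo 0 T, |deriv (deriv v) s| ≤ K * s ^ (α - 2)

theorem WeaklySingular.intervalIntegrable_deriv {α T K : ℝ} (hα : 0 < α) {v : ℝ → ℝ}
    (hv : WeaklySingular α T K v) {x y : ℝ} (hx : 0 ≤ x) (hxy : x ≤ y) (hy : y ≤ T) :
    IntervalIntegrable (deriv v) volume x y := by
  rw [intervalIntegrable_iff_integrableOn_Ioo_of_le hxy]
  have h1 : IntegrableOn (fun s : ℝ => K * s ^ (α - 1)) (Ioo x y) := by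
    rw [← intervalIntegrable_iff_integrableOn_Ioo_of_le hxy]
    exact (intervalIntegral.intervalIntegrable_rpow' (by linarith)).const_mul K
  refine h1.mono' (measurable_deriv v).aestronglyMeasurable ?_
  refine (ae_restrict_iff' measurableSet_Ioo).2 (Filter.Eventually.of_forall fun s hs => ?_)
  exact hv.bound s ⟨hx.trans_lt hs.1, hs.2.trans_le hy⟩

section
variable {α T K r c₃ p : ℝ} {M : ℕ} {t : ℕ → ℝ} {v : ℝ → ℝ}

/-- The contribution of the first mesh interval. -/
theorem first_truncation_le (hα : 0 < α) (hα' : α < 1) (hK : 0 ≤ K) (hp : p ≤ 1 + α)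
    (hv : WeaklySingular α T K v) {x c : ℝ} (hx : 0 < x) (hxc : x ≤ c) (hc : c ≤ T)
    (hint : IntervalIntegrable (fun s => (c - s) ^ (-α) * deriv v s) volume 0 x) :
    |(v x - v 0) / (x - 0) * (∫ s in (0 : ℝ)..x, (c - s) ^ (-α)) -
      ∫ s in (0 : ℝ)..x, (c - s) ^ (-α) * deriv v s| ≤
      2 * K / (α * (1 - α)) * (x / c) ^ p := by
  have hc0 : 0 < c := hx.trans_le hxc
  have hxT : x ≤ T := hxc.trans hc
  set A : ℝ := 2 * (K / α) * (c ^ (-α - 1) * x ^ (2 * α)) with hA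
  have hA0 : 0 ≤ A := by positivity
  have main := abs_interval_truncation_le (c := c) hα' (v := v) (x := 0) (y := x)
    (G := fun s => A * (x - s) ^ (-α)) hx
    (hv.cont.mono (Icc_subset_Icc le_rfl hxT))
    (fun s hs => hv.diff s ⟨hs.1, hs.2.trans_le hxT⟩)
    (hv.intervalIntegrable_deriv hα le_rfl hx.le hxT) hint
    ((intervalIntegrable_kernel hα' _ _ _).const_mul A) ?_
  · refine main.trans ?_
    rw [intervalIntegral.integral_const_mul, integral_kernel hα', sub_self, sub_zero,
      Real.zero_rpow (by linarith), sub_zero]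
    have h1 : (x / c) ^ (1 + α) ≤ (x / c) ^ p :=
      Real.rpow_le_rpow_of_exponent_ge (by positivity) ((div_le_one hc0).2 hxc) hp
    have h2 : A * (x ^ (1 - α) / (1 - α)) = 2 * K / (α * (1 - α)) * (x / c) ^ (1 + α) := by
      have e1 : x ^ (2 * α) * x ^ (1 - α) = x ^ (1 + α) := by
        rw [← Real.rpow_add hx]
        ring_nf
      have e2 : c ^ (-α - 1) = (c ^ (1 + α))⁻¹ := by
        rw [← Real.rpow_neg hc0.le]
        ring_nf
      rw [Real.div_rpow hx.le hc0.le, ← e1, hA, e2]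
      field_simp
    rw [h2]
    have : 0 ≤ 2 * K / (α * (1 - α)) := by
      have : 0 < 1 - α := by linarith
      positivity
    gcongr
  · intro s hs
    have hs0 : 0 < s := hs.1
    have hsc : s < c := hs.2.trans_le hxc
    have hcs : 0 < c - s := by linarith
    have hxs : 0 < x - s := by linarith [hs.2]
    have hKα : K ≤ K / α := by
      rw [le_div_iff₀ hα]
      nlinarith
    have hsx : x ^ (α - 1) ≤ s ^ (α - 1) :=
      Real.rpow_le_rpow_of_nonpos hs0 hs.2.le (by linarith)
    have h1 : |(v x - v 0) / (x - 0)| ≤ K / α * s ^ (α - 1) := by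
      have := abs_sub_le_of_deriv_le hα hv.cont hv.diff hv.bound le_rfl hx.le hxT
      rw [Real.zero_rpow hα.ne', sub_zero] at this
      rw [sub_zero, abs_div, abs_of_pos hx, div_le_iff₀ hx]
      refine this.trans ?_
      have e : x ^ α = x ^ (α - 1) * x := by
        rw [← Real.rpow_add_one hx.ne', sub_add_cancel]
      rw [e, ← mul_assoc]
      gcongr
    have h2 : |(v x - v 0) / (x - 0) - deriv v s| ≤ 2 * (K / α) * s ^ (α - 1) := by
      have h3 := hv.bound s ⟨hs0, hs.2.trans_le hxT⟩
      have h4 := mul_le_mul_of_nonneg_right hKα (by positivity : 0 ≤ s ^ (α - 1))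
      calc _ ≤ |(v x - v 0) / (x - 0)| + |deriv v s| := abs_sub _ _
        _ ≤ _ := by linarith
    -- Because `x ≤ c`, one has `c - s ≥ (c/x)(x - s)`. The only singularity left is then the
    -- integrable one at `s = x`, and the powers of `c` come out as `c^(-α-1)`.
    have h3 : (c - s) ^ (-α) ≤ (c / x) ^ (-α) * (x - s) ^ (-α) := by
      rw [← Real.mul_rpow (by positivity) hxs.le]
      refine Real.rpow_le_rpow_of_nonpos (by positivity) ?_ (by linarith)
      rw [div_mul_eq_mul_div, div_le_iff₀ hx]
      nlinarith
    have h4 := kernel_sub_kernel_le (α := α) hα hα' hs0.le hsc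
    have h5 := kernel_sub_kernel_nonneg (α := α) hα hs0.le hsc
    rw [abs_mul, abs_of_nonneg h5]
    rw [sub_zero c, sub_zero s] at h4
    calc ((c - s) ^ (-α) - (c - 0) ^ (-α)) * |(v x - v 0) / (x - 0) - deriv v s|
        ≤ ((c / x) ^ (-α) * (x - s) ^ (-α) * (s / c)) * (2 * (K / α) * s ^ (α - 1)) := by
          rw [sub_zero c] at h5 ⊢
          refine mul_le_mul (h4.trans ?_) h2 (abs_nonneg _) (by positivity)
          gcongr
      _ = 2 * (K / α) * (c ^ (-α - 1) * (x ^ α * s ^ α)) * (x - s) ^ (-α) := by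
          rw [Real.div_rpow hc0.le hx.le, Real.rpow_neg hx.le, Real.rpow_sub_one hs0.ne',
            Real.rpow_sub_one hc0.ne']
          field_simp
      _ ≤ 2 * (K / α) * (c ^ (-α - 1) * (x ^ α * x ^ α)) * (x - s) ^ (-α) := by
          have := hs.2.le
          gcongr
      _ = A * (x - s) ^ (-α) := by
          rw [hA, ← Real.rpow_add hx]
          ring_nf

/-- A majorant of the remaining part of the truncation error. -/
def truncMajorant (α p t₁ R c s : ℝ) : ℝ :=
  4 * (c ^ (-α - 1) * t₁ ^ p) * s ^ (α - p) +
    4 * (c ^ (α - 2) * R) * (min R (c - s) * (c - s) ^ (-α - 1))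

theorem intervalIntegrable_truncMajorant (hα' : α < 1) {t₁ R c x y : ℝ}
    (hR : 0 < R) (hx : 0 < x) (hxy : x ≤ y) (hyc : y ≤ c) :
    IntervalIntegrable (truncMajorant α p t₁ R c) volume x y := by
  refine IntervalIntegrable.add ?_ ?_
  · refine (intervalIntegral.intervalIntegrable_rpow (Or.inr ?_)).const_mul _
    rw [uIcc_of_le hxy]
    exact fun h => by linarith [h.1]
  · refine ((intervalIntegrable_min_mul_kernel (α := α) (x := x) hα' hR
      (hxy.trans hyc)).mono_set ?_).const_mul _
    rw [uIcc_of_le hxy, uIcc_of_le (hxy.trans hyc)]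
    exact Icc_subset_Icc le_rfl hyc

theorem integral_truncMajorant_le (hα : 0 < α) (hα' : α < 1) (hp : p < 1 + α) {t₁ R c : ℝ}
    (hR : 0 < R) (ht₁ : 0 < t₁) (htc : t₁ ≤ c) :
    ∫ s in t₁..c, truncMajorant α p t₁ R c s ≤
      4 / (1 + α - p) * (t₁ / c) ^ p + 4 * (1 / (1 - α) + 1 / α) * (R / c) ^ (2 - α) := by
  have hc : 0 < c := ht₁.trans_le htc
  have hp' : 0 < 1 + α - p := by linarith
  unfold truncMajorant
  rw [intervalIntegral.integral_add, intervalIntegral.integral_const_mul,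
    intervalIntegral.integral_const_mul]
  · refine add_le_add ?_ ?_
    · rw [integral_rpow (Or.inl (by linarith)), show α - p + 1 = 1 + α - p by ring]
      have h1 : 0 ≤ t₁ ^ (1 + α - p) := by positivity
      calc 4 * (c ^ (-α - 1) * t₁ ^ p) * ((c ^ (1 + α - p) - t₁ ^ (1 + α - p)) / (1 + α - p))
          ≤ 4 * (c ^ (-α - 1) * t₁ ^ p) * (c ^ (1 + α - p) / (1 + α - p)) := by
            gcongr
            linarith
        _ = 4 / (1 + α - p) * (t₁ / c) ^ p := by
            rw [Real.div_rpow ht₁.le hc.le, Real.rpow_sub hc (1 + α) p, show -α - 1 = -(1 + α) by ring,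
              Real.rpow_neg hc.le]
            field_simp
    · calc 4 * (c ^ (α - 2) * R) * ∫ s in t₁..c, min R (c - s) * (c - s) ^ (-α - 1)
          ≤ 4 * (c ^ (α - 2) * R) * (R ^ (1 - α) * (1 / (1 - α) + 1 / α)) := by
            gcongr
            exact integral_min_mul_kernel_le hα hα' hR htc
        _ = _ := by
            rw [Real.div_rpow hR.le hc.le, show α - 2 = -(2 - α) by ring, Real.rpow_neg hc.le,
              show 2 - α = 1 - α + 1 by ring, Real.rpow_add_one hR.ne']
            ring
  · refine (intervalIntegral.intervalIntegrable_rpow (Or.inr ?_)).const_mul _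
    rw [uIcc_of_le htc]
    exact fun h => by linarith [h.1]
  · exact (intervalIntegrable_min_mul_kernel (α := α) hα' hR htc).const_mul _

/-- Pointwise bound behind the truncation error away from the initial time. -/
theorem kernel_mul_le_truncMajorant (hα : 0 < α) (hα' : α < 1) (hr : 1 ≤ r) {C₄ t₁ x y s c : ℝ}
    (hpr : p ≤ (2 - α) / r) (hC₄ : 1 ≤ C₄) (ht₁ : 0 < t₁) (ht₁x : t₁ ≤ x) (hs : s ∈ Ioo x y)
    (hyc : y ≤ c) (hτ : y - x ≤ C₄ * (t₁ ^ (1 / r) * s ^ (1 - 1 / r))) :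
    ((c - s) ^ (-α) * ((s - x) / (c - x))) * ((y - x) * s ^ (α - 2)) ≤
      C₄ ^ 2 * truncMajorant α p t₁ (C₄ * (t₁ ^ (1 / r) * c ^ (1 - 1 / r))) c s := by
  have hx : 0 < x := ht₁.trans_le ht₁x
  have hs0 : 0 < s := hx.trans hs.1
  have hsc : s < c := hs.2.trans_le hyc
  have hc : 0 < c := hs0.trans hsc
  have hcs : 0 < c - s := by linarith
  have hcx : 0 < c - x := by linarith [hs.1]
  have hyx : 0 < y - x := by linarith [hs.1, hs.2]
  have hsx : 0 < s - x := by linarith [hs.1]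
  have hr0 : 0 < r := by linarith
  have hr1 : 0 ≤ 1 - 1 / r := by
    rw [sub_nonneg, div_le_one hr0]
    exact hr
  have hC4 : (1 : ℝ) ≤ C₄ ^ 2 := one_le_pow₀ hC₄
  set R : ℝ := C₄ * (t₁ ^ (1 / r) * c ^ (1 - 1 / r)) with hR
  have hR0 : 0 < R := by positivity
  have hnear0 : 0 ≤ 4 * (c ^ (α - 2) * R) * (min R (c - s) * (c - s) ^ (-α - 1)) := by
    have : 0 ≤ min R (c - s) := le_min hR0.le hcs.le
    positivity
  have hfar0 : 0 ≤ 4 * (c ^ (-α - 1) * t₁ ^ p) * s ^ (α - p) := by positivity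
  have hker : (c - s) ^ (-α) = (c - s) ^ (-α - 1) * (c - s) := by
    rw [← Real.rpow_add_one hcs.ne', sub_add_cancel]
  have hquot : (c - s) * ((s - x) / (c - x)) ≤ min (y - x) (c - s) := by
    refine le_min ?_ ?_
    · rw [mul_div_assoc', div_le_iff₀ hcx]
      nlinarith [hs.1, hs.2]
    · refine mul_le_of_le_one_right hcs.le ?_
      rw [div_le_one hcx]
      linarith
  have hLHS : ((c - s) ^ (-α) * ((s - x) / (c - x))) * ((y - x) * s ^ (α - 2)) ≤
      (c - s) ^ (-α - 1) * min (y - x) (c - s) * ((y - x) * s ^ (α - 2)) := by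
    rw [hker, mul_assoc ((c - s) ^ (-α - 1))]
    gcongr
  refine hLHS.trans ?_
  unfold truncMajorant
  have htwo : (2 : ℝ) ^ (2 : ℝ) = 4 := by norm_num
  -- In the early half the kernel is comparable to `c^(-α-1)`, and the two step lengths combine with
  -- `s^(α-2)`. In the late half `s` is comparable to `c`; one step length is bounded by `R`, the
  -- other is kept as `min R (c - s)` so that the kernel remains integrable.
  rcases le_or_gt s (c / 2) with h | h
  · have h1 : (c - s) ^ (-α - 1) ≤ 4 * c ^ (-α - 1) := by
      calc (c - s) ^ (-α - 1) ≤ (c / 2) ^ (-α - 1) :=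
            Real.rpow_le_rpow_of_nonpos (by positivity) (by linarith) (by linarith)
        _ = 2 ^ (α + 1) * c ^ (-α - 1) := by
            rw [Real.div_rpow hc.le two_pos.le, show -α - 1 = -(α + 1) by ring,
              Real.rpow_neg two_pos.le]
            field_simp
        _ ≤ 2 ^ (2 : ℝ) * c ^ (-α - 1) := by
            gcongr
            · norm_num
            · linarith
        _ = _ := by rw [htwo]
    have h2 : (y - x) * (y - x) * s ^ (α - 2) ≤ C₄ ^ 2 * (t₁ ^ p * s ^ (α - p)) := by
      have hts : t₁ / s ≤ 1 := (div_le_one hs0).2 (ht₁x.trans hs.1.le)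
      have hq : p ≤ 1 / r + 1 / r := by
        refine hpr.trans ?_
        rw [← add_div]
        gcongr
        linarith
      calc (y - x) * (y - x) * s ^ (α - 2)
          ≤ (C₄ * (t₁ ^ (1 / r) * s ^ (1 - 1 / r))) * (C₄ * (t₁ ^ (1 / r) * s ^ (1 - 1 / r))) *
            s ^ (α - 2) := by gcongr
        _ = C₄ ^ 2 * ((t₁ / s) ^ (1 / r + 1 / r) * s ^ α) := by
            rw [Real.rpow_add (by positivity), Real.div_rpow ht₁.le hs0.le, Real.rpow_sub hs0 1,
              Real.rpow_one, show α - 2 = α - ((2 : ℕ) : ℝ) by norm_num, Real.rpow_sub hs0,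
              Real.rpow_natCast]
            field_simp
        _ ≤ C₄ ^ 2 * ((t₁ / s) ^ p * s ^ α) := by
            refine mul_le_mul_of_nonneg_left (mul_le_mul_of_nonneg_right ?_ (by positivity))
              (by positivity)
            exact Real.rpow_le_rpow_of_exponent_ge (by positivity) hts hq
        _ = _ := by
            rw [Real.div_rpow ht₁.le hs0.le, Real.rpow_sub hs0]
            field_simp
    calc (c - s) ^ (-α - 1) * min (y - x) (c - s) * ((y - x) * s ^ (α - 2))
        ≤ (c - s) ^ (-α - 1) * (y - x) * ((y - x) * s ^ (α - 2)) := by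
          gcongr
          exact min_le_left _ _
      _ = (c - s) ^ (-α - 1) * ((y - x) * (y - x) * s ^ (α - 2)) := by ring
      _ ≤ (4 * c ^ (-α - 1)) * (C₄ ^ 2 * (t₁ ^ p * s ^ (α - p))) := by gcongr
      _ = C₄ ^ 2 * (4 * (c ^ (-α - 1) * t₁ ^ p) * s ^ (α - p)) := by ring
      _ ≤ _ := by
          gcongr
          linarith
  · have h1 : s ^ (α - 2) ≤ 4 * c ^ (α - 2) := by
      calc s ^ (α - 2) ≤ (c / 2) ^ (α - 2) :=
            Real.rpow_le_rpow_of_nonpos (by positivity) h.le (by linarith)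
        _ = 2 ^ (2 - α) * c ^ (α - 2) := by
            rw [Real.div_rpow hc.le two_pos.le, show α - 2 = -(2 - α) by ring,
              Real.rpow_neg two_pos.le]
            field_simp
        _ ≤ 2 ^ (2 : ℝ) * c ^ (α - 2) := by
            gcongr
            · norm_num
            · linarith
        _ = _ := by rw [htwo]
    have h2 : y - x ≤ R := by
      refine hτ.trans ?_
      rw [hR]
      gcongr
    have hm0 : 0 ≤ min R (c - s) := le_min hR0.le hcs.le
    calc (c - s) ^ (-α - 1) * min (y - x) (c - s) * ((y - x) * s ^ (α - 2))
        ≤ (c - s) ^ (-α - 1) * min R (c - s) * (R * (4 * c ^ (α - 2))) := by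
          gcongr
      _ = 1 * (4 * (c ^ (α - 2) * R) * (min R (c - s) * (c - s) ^ (-α - 1))) := by ring
      _ ≤ C₄ ^ 2 * (4 * (c ^ (α - 2) * R) * (min R (c - s) * (c - s) ^ (-α - 1))) := by
          gcongr
      _ ≤ _ := by
          gcongr
          linarith

end

/-- The truncation error of the L1 discretization on quasi-graded meshes. -/
theorem exists_l1_sub_caputo_le {α T K r c₃ p : ℝ} (hα : 0 < α) (hα' : α < 1) (hr : 1 ≤ r)
    (hc₃ : 0 < c₃) (hK : 0 ≤ K) (hp : p < 1 + α) (hpr : p ≤ (2 - α) / r) :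
    ∃ C : ℝ, 0 ≤ C ∧ ∀ (M : ℕ) (t : ℕ → ℝ), IsTemporalMesh T M t →
      (∀ j ∈ Finset.Icc 1 M, t j - t (j - 1) ≤ c₃ * t 1 ^ (1 / r) * t j ^ (1 - 1 / r)) →
      ∀ v : ℝ → ℝ, WeaklySingular α T K v →
      (∀ c ∈ Ioc 0 T, IntervalIntegrable (fun s => (c - s) ^ (-α) * deriv v s) volume 0 c) →
      ∀ m ∈ Finset.Icc 1 M,
        |l1 α t (fun j => v (t j)) m - caputo α v (t m)| ≤ C * (t 1 / t m) ^ p := by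
  have hr0 : 0 < r := by linarith
  have hr1 : 0 ≤ 1 - 1 / r := by
    rw [sub_nonneg, div_le_one hr0]
    exact hr
  have h1α : 0 < 1 - α := by linarith
  have hp' : 0 < 1 + α - p := by linarith
  have hG := inv_pos.2 (Gamma_one_sub_pos hα')
  -- `C₂` compares neighbouring nodes, and `C₄` turns the step bound at the right endpoint into one
  -- at any point of the interval. Neither comparison is available on the first interval, which is
  -- treated separately.
  set C₂ : ℝ := max 2 ((2 * c₃) ^ r) with hC₂
  have hC₂2 : 2 ≤ C₂ := le_max_left _ _
  set C₄ : ℝ := max 1 (c₃ * C₂) with hC₄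
  have hC₄1 : 1 ≤ C₄ := le_max_left _ _
  set L : ℝ := K * C₂ ^ 2 * C₄ ^ 2 with hL
  set S : ℝ := 4 / (1 + α - p) + 4 * (1 / (1 - α) + 1 / α) * C₄ ^ 2 with hS
  refine ⟨(Real.Gamma (1 - α))⁻¹ * (2 * K / (α * (1 - α)) + L * S), by positivity,
    fun M t ht hstep v hv hint m hm => ?_⟩
  have hm' := Finset.mem_Icc.1 hm
  have h1 : 0 < t 1 := ht.pos le_rfl ht.one_le
  have hmp : 0 < t m := ht.pos hm'.1 hm'.2
  have hmT : t m ≤ T := ht.le_last hm'.2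
  have h1m : t 1 ≤ t m := ht.le hm'.1 hm'.2
  have hX1 : t 1 / t m ≤ 1 := (div_le_one hmp).2 h1m
  set F : ℝ → ℝ := fun s => (t m - s) ^ (-α) * deriv v s with hF
  have hFint : IntervalIntegrable F volume 0 (t m) := hint (t m) (ht.mem_Ioc hm)
  have hFj : ∀ j < m, IntervalIntegrable F volume (t j) (t (j + 1)) := fun j hj => by
    refine hFint.mono_set ?_
    rw [uIcc_of_le hmp.le, uIcc_of_le (ht.le (Nat.le_succ j) (by omega))]
    exact Icc_subset_Icc (ht.nonneg (by omega)) (ht.le (by omega) hm'.2)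
  set D : ℕ → ℝ := fun j => (v (t (j + 1)) - v (t j)) / (t (j + 1) - t j) *
    (∫ s in t j..t (j + 1), (t m - s) ^ (-α)) - ∫ s in t j..t (j + 1), F s with hD
  have hdiff : l1 α t (fun j => v (t j)) m - caputo α v (t m) =
      (Real.Gamma (1 - α))⁻¹ * ∑ j ∈ Finset.range m, D j := by
    have hsum := intervalIntegral.sum_integral_adjacent_intervals (μ := volume) (f := F)
      (a := t) (n := m) hFj
    rw [ht.zero] at hsum
    rw [l1_eq, caputo, ← mul_sub, ← hsum, ← Finset.sum_sub_distrib]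
    congr 1
    refine Finset.sum_congr rfl fun j _ => ?_
    rw [hD, kerAvg]
    ring
  set R : ℝ := C₄ * (t 1 ^ (1 / r) * t m ^ (1 - 1 / r)) with hR
  have hR0 : 0 < R := by positivity
  have hL0 : 0 ≤ L := by positivity
  have hD0 : |D 0| ≤ 2 * K / (α * (1 - α)) * (t 1 / t m) ^ p := by
    have := first_truncation_le hα hα' hK hp.le hv h1 h1m hmT
      (by have := hFj 0 hm'.1
          rwa [ht.zero] at this)
    simpa [hD, ht.zero] using this
  have hDj : ∀ j, 1 ≤ j → j < m →
      |D j| ≤ ∫ s in t j..t (j + 1), L * truncMajorant α p (t 1) R (t m) s := by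
    intro j hj hjm
    have hj0 : 0 < t j := ht.pos hj (by omega)
    have hlt : t j < t (j + 1) := ht.lt (by omega) (by omega)
    have hjT : t (j + 1) ≤ T := ht.le_last (by omega)
    have hjm' : t (j + 1) ≤ t m := ht.le (by omega) hm'.2
    have hsub : ∀ s ∈ Ioo (t j) (t (j + 1)), s ∈ Ioo 0 T := fun s hs =>
      ⟨hj0.trans hs.1, hs.2.trans_le hjT⟩
    have hq := quasiGraded_succ_le hr hc₃ ht hstep hj (by omega)
    rw [← hC₂] at hq
    refine abs_interval_truncation_le hα' hlt
      (hv.cont.mono (Icc_subset_Icc hj0.le hjT)) (fun s hs => hv.diff s (hsub s hs))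
      (hv.intervalIntegrable_deriv hα hj0.le hlt.le hjT) (hFj j hjm)
      ((intervalIntegrable_truncMajorant hα' hR0 hj0 hlt.le hjm').const_mul L) fun s hs => ?_
    have hs0 : 0 < s := hj0.trans hs.1
    have hsC : s ≤ C₂ * t j := hs.2.le.trans hq
    have hτ : t (j + 1) - t j ≤ C₄ * (t 1 ^ (1 / r) * s ^ (1 - 1 / r)) := by
      have h2 := hstep (j + 1) (Finset.mem_Icc.2 ⟨by omega, by omega⟩)
      rw [Nat.add_sub_cancel] at h2
      have h3 : t (j + 1) ≤ C₂ * s := hq.trans (by have := hs.1.le; gcongr)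
      have h4 : C₂ ^ (1 - 1 / r) ≤ C₂ := by
        have := Real.rpow_le_rpow_of_exponent_le (by linarith : 1 ≤ C₂)
          (sub_le_self 1 (by positivity : 0 ≤ 1 / r))
        rwa [Real.rpow_one] at this
      have h5 : 0 < t (j + 1) := hj0.trans hlt
      calc t (j + 1) - t j ≤ c₃ * t 1 ^ (1 / r) * t (j + 1) ^ (1 - 1 / r) := h2
        _ ≤ c₃ * t 1 ^ (1 / r) * (C₂ * s) ^ (1 - 1 / r) := by gcongr
        _ = c₃ * C₂ ^ (1 - 1 / r) * (t 1 ^ (1 / r) * s ^ (1 - 1 / r)) := by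
          rw [Real.mul_rpow (by linarith) hs0.le]
          ring
        _ ≤ c₃ * C₂ * (t 1 ^ (1 / r) * s ^ (1 - 1 / r)) := by gcongr
        _ ≤ _ := by
          gcongr
          exact le_max_right _ _
    have hslope : |(v (t (j + 1)) - v (t j)) / (t (j + 1) - t j) - deriv v s| ≤
        K * C₂ ^ 2 * ((t (j + 1) - t j) * s ^ (α - 2)) := by
      have h2 := abs_slope_sub_deriv_le (D := K * t j ^ (α - 2)) hlt
        (hv.cont.mono (Icc_subset_Icc hj0.le hjT)) (fun s hs => hv.diff s (hsub s hs))
        (fun s hs => hv.diff₂ s (hsub s hs)) (fun s hs => (hv.bound₂ s (hsub s hs)).trans (by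
          refine mul_le_mul_of_nonneg_left ?_ hK
          exact Real.rpow_le_rpow_of_nonpos hj0 hs.1.le (by linarith))) hs
      refine h2.trans ?_
      have h3 : t j ^ (α - 2) ≤ C₂ ^ 2 * s ^ (α - 2) := by
        calc t j ^ (α - 2) ≤ (s / C₂) ^ (α - 2) := by
              refine Real.rpow_le_rpow_of_nonpos (by positivity) ?_ (by linarith)
              rw [div_le_iff₀ (by linarith)]
              linarith
          _ = C₂ ^ (2 - α) * s ^ (α - 2) := by
              rw [Real.div_rpow hs0.le (by linarith), show 2 - α = -(α - 2) by ring,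
                Real.rpow_neg (by linarith)]
              ring
          _ ≤ C₂ ^ ((2 : ℕ) : ℝ) * s ^ (α - 2) := by
              gcongr
              · linarith
              · push_cast
                linarith
          _ = _ := by rw [Real.rpow_natCast]
      have : 0 ≤ t (j + 1) - t j := by linarith
      calc K * t j ^ (α - 2) * (t (j + 1) - t j)
          ≤ K * (C₂ ^ 2 * s ^ (α - 2)) * (t (j + 1) - t j) := by gcongr
        _ = _ := by ring
    have hsm : s < t m := hs.2.trans_le hjm'
    have h2 := kernel_sub_kernel_le (α := α) hα hα' hs.1.le hsm
    have h3 := kernel_sub_kernel_nonneg (α := α) hα hs.1.le hsm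
    have h4 := kernel_mul_le_truncMajorant hα hα' hr hpr hC₄1 h1 (ht.le hj (by omega)) hs hjm' hτ
    rw [← hR] at h4
    rw [abs_mul, abs_of_nonneg h3]
    calc _ ≤ ((t m - s) ^ (-α) * ((s - t j) / (t m - t j))) *
          (K * C₂ ^ 2 * ((t (j + 1) - t j) * s ^ (α - 2))) :=
          mul_le_mul h2 hslope (abs_nonneg _) (h3.trans h2)
      _ = K * C₂ ^ 2 * (((t m - s) ^ (-α) * ((s - t j) / (t m - t j))) *
          ((t (j + 1) - t j) * s ^ (α - 2))) := by ring
      _ ≤ K * C₂ ^ 2 * (C₄ ^ 2 * truncMajorant α p (t 1) R (t m) s) := by gcongr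
      _ = _ := by rw [hL]; ring
  have hsum : |∑ j ∈ Finset.range m, D j| ≤
      (2 * K / (α * (1 - α)) + L * S) * (t 1 / t m) ^ p := by
    refine (Finset.abs_sum_le_sum_abs _ _).trans ?_
    rw [Finset.range_eq_Ico, Finset.sum_eq_sum_Ico_succ_bot hm'.1, zero_add, add_mul]
    refine add_le_add hD0 ?_
    have hI : ∑ j ∈ Finset.Ico 1 m, |D j| ≤
        ∫ s in t 1..t m, L * truncMajorant α p (t 1) R (t m) s := by
      rw [← intervalIntegral.sum_integral_adjacent_intervals_Ico hm'.1]
      · exact Finset.sum_le_sum fun j hj =>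
          hDj j (Finset.mem_Ico.1 hj).1 (Finset.mem_Ico.1 hj).2
      · intro j hj
        exact (intervalIntegrable_truncMajorant hα' hR0 (ht.pos hj.1 (by have := hj.2; omega))
          (ht.le (Nat.le_succ j) (by have := hj.2; omega))
          (ht.le (by have := hj.2; omega) hm'.2)).const_mul L
    refine hI.trans ?_
    rw [intervalIntegral.integral_const_mul]
    refine le_trans (mul_le_mul_of_nonneg_left ?_ hL0) (le_of_eq (mul_assoc L S _).symm)
    refine (integral_truncMajorant_le hα hα' hp hR0 h1 h1m).trans ?_
    -- Since `R / t_m = C₄ (t₁/t_m)^(1/r)`, the late half contributes the exponent `(2-α)/r`. This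
    -- is where the limit on `p` comes from.
    have h2 : (R / t m) ^ (2 - α) ≤ C₄ ^ 2 * (t 1 / t m) ^ p := by
      have e : R / t m = C₄ * (t 1 / t m) ^ (1 / r) := by
        rw [hR, Real.div_rpow h1.le hmp.le, Real.rpow_sub hmp, Real.rpow_one]
        field_simp
      have h3 : C₄ ^ (2 - α) ≤ C₄ ^ 2 := by
        rw [← Real.rpow_natCast]
        exact Real.rpow_le_rpow_of_exponent_le hC₄1 (by push_cast; linarith)
      have h4 : (t 1 / t m) ^ ((2 - α) / r) ≤ (t 1 / t m) ^ p :=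
        Real.rpow_le_rpow_of_exponent_ge (by positivity) hX1 hpr
      rw [e, Real.mul_rpow (by linarith) (by positivity), ← Real.rpow_mul (by positivity),
        one_div_mul_eq_div]
      gcongr
    rw [hS, add_mul]
    have h3 : 0 ≤ 4 * (1 / (1 - α) + 1 / α) := by positivity
    have h4 := mul_le_mul_of_nonneg_left h2 h3
    linarith
  rw [hdiff, abs_mul, abs_of_pos hG, mul_assoc]
  gcongr

/-! ### Symmetric difference quotients in one variable -/

theorem abs_sub_le_of_hasDerivAt {φ φ' : ℝ → ℝ} {a b K : ℝ}
    (hd : ∀ s ∈ Ioo a b, HasDerivAt φ (φ' s) s) (hK : ∀ s ∈ Ioo a b, |φ' s| ≤ K) {x y : ℝ}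
    (hx : x ∈ Ioo a b) (hy : y ∈ Ioo a b) : |φ y - φ x| ≤ K * |y - x| := by
  have := Convex.norm_image_sub_le_of_norm_hasDerivWithin_le (f := φ) (f' := φ')
    (fun s hs => (hd s hs).hasDerivWithinAt) (fun s hs => by simpa using hK s hs)
    (convex_Ioo a b) hx hy
  simpa using this

theorem abs_le_pow_succ_of_deriv_le {ψ ψ' : ℝ → ℝ} {C h : ℝ} {k : ℕ} (hC : 0 ≤ C)
    (hcont : ContinuousOn ψ (Icc 0 h)) (h0 : ψ 0 = 0)
    (hd : ∀ s ∈ Ioo 0 h, HasDerivAt ψ (ψ' s) s) (hb : ∀ s ∈ Ioo 0 h, |ψ' s| ≤ C * s ^ k) {s : ℝ}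
    (hs : s ∈ Icc 0 h) : |ψ s| ≤ C * s ^ (k + 1) := by
  rcases hs.1.eq_or_lt with rfl | hs0
  · simp [h0]
  obtain ⟨ξ, hξ, he⟩ := exists_hasDerivAt_eq_slope ψ ψ' hs0
    (hcont.mono (Icc_subset_Icc le_rfl hs.2)) fun y hy => hd y ⟨hy.1, hy.2.trans_le hs.2⟩
  rw [h0, sub_zero, sub_zero, eq_div_iff hs0.ne'] at he
  rw [← he, abs_mul, abs_of_pos hs0, pow_succ, ← mul_assoc]
  have h1 := hb ξ ⟨hξ.1, hξ.2.trans_le hs.2⟩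
  have h2 : ξ ^ k ≤ s ^ k := pow_le_pow_left₀ hξ.1.le hξ.2.le k
  calc |ψ' ξ| * s ≤ C * ξ ^ k * s := by gcongr
    _ ≤ C * s ^ k * s := by gcongr

section
variable {φ φ' φ'' : ℝ → ℝ} {x h C : ℝ} {k : ℕ}

theorem hasDerivAt_comp_pm {s : ℝ} (hd : ∀ s ∈ Ioo (x - h) (x + h), HasDerivAt φ (φ' s) s)
    (hs : s ∈ Ioo 0 h) :
    HasDerivAt (fun s => φ (x + s)) (φ' (x + s)) s ∧
      HasDerivAt (fun s => φ (x - s)) (-φ' (x - s)) s :=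
  ⟨(hd _ ⟨by linarith [hs.1, hs.2], by linarith [hs.2]⟩).comp_const_add x s,
    (hd _ ⟨by linarith [hs.2], by linarith [hs.1, hs.2]⟩).comp_const_sub x s⟩

theorem continuousOn_comp_pm (hc : ContinuousOn φ (Icc (x - h) (x + h))) :
    ContinuousOn (fun s => φ (x + s)) (Icc 0 h) ∧ ContinuousOn (fun s => φ (x - s)) (Icc 0 h) :=
  ⟨hc.comp (by fun_prop) fun s hs => ⟨by linarith [hs.1, hs.2], by linarith [hs.2]⟩,
    hc.comp (by fun_prop) fun s hs => ⟨by linarith [hs.2], by linarith [hs.1, hs.2]⟩⟩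

theorem abs_odd_le (hd : ∀ s ∈ Ioo (x - h) (x + h), HasDerivAt φ (φ' s) s)
    (hb : ∀ s ∈ Ioo (x - h) (x + h), |φ' s| ≤ C) {s : ℝ} (hs : s ∈ Ioo 0 h) :
    |φ (x + s) - φ (x - s)| ≤ 2 * C * s ^ 1 := by
  have := abs_sub_le_of_hasDerivAt hd hb (x := x - s) (y := x + s)
    ⟨by linarith [hs.2], by linarith [hs.1, hs.2]⟩ ⟨by linarith [hs.1, hs.2], by linarith [hs.2]⟩
  rw [show x + s - (x - s) = 2 * s by ring, abs_of_pos (by linarith [hs.1] : 0 < 2 * s)] at this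
  linarith

/-- In `s`, an even difference of `φ` has as derivative the odd difference of `φ'`, and conversely.
Alternating the two and integrating from `s = 0` gains one power of `s` each time. -/
theorem abs_even_le (hC : 0 ≤ C) (hc : ContinuousOn φ (Icc (x - h) (x + h)))
    (hd : ∀ s ∈ Ioo (x - h) (x + h), HasDerivAt φ (φ' s) s)
    (hb : ∀ s ∈ Ioo 0 h, |φ' (x + s) - φ' (x - s)| ≤ C * s ^ k) {s : ℝ} (hs : s ∈ Icc 0 h) :
    |φ (x + s) + φ (x - s) - 2 * φ x| ≤ C * s ^ (k + 1) := by
  obtain ⟨c1, c2⟩ := continuousOn_comp_pm hc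
  refine abs_le_pow_succ_of_deriv_le (ψ := fun s => φ (x + s) + φ (x - s) - 2 * φ x)
    (ψ' := fun s => φ' (x + s) - φ' (x - s)) hC ((c1.add c2).sub continuousOn_const)
    (by simp only [add_zero, sub_zero]; ring) (fun s hs => ?_) hb hs
  obtain ⟨d1, d2⟩ := hasDerivAt_comp_pm hd hs
  exact ((d1.fun_add d2).sub_const _).congr_deriv (by ring)

theorem abs_odd_sub_le (hC : 0 ≤ C) (hc : ContinuousOn φ (Icc (x - h) (x + h)))
    (hd : ∀ s ∈ Ioo (x - h) (x + h), HasDerivAt φ (φ' s) s)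
    (hb : ∀ s ∈ Ioo 0 h, |φ' (x + s) + φ' (x - s) - 2 * φ' x| ≤ C * s ^ k) {s : ℝ}
    (hs : s ∈ Icc 0 h) :
    |φ (x + s) - φ (x - s) - 2 * s * φ' x| ≤ C * s ^ (k + 1) := by
  obtain ⟨c1, c2⟩ := continuousOn_comp_pm hc
  refine abs_le_pow_succ_of_deriv_le (ψ := fun s => φ (x + s) - φ (x - s) - 2 * s * φ' x)
    (ψ' := fun s => φ' (x + s) + φ' (x - s) - 2 * φ' x) hC
    ((c1.sub c2).sub (by fun_prop)) (by simp) (fun s hs => ?_) hb hs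
  obtain ⟨d1, d2⟩ := hasDerivAt_comp_pm hd hs
  exact ((d1.fun_sub d2).fun_sub (((hasDerivAt_id s).const_mul 2).mul_const (φ' x))).congr_deriv
    (by ring)

theorem abs_even_sub_le (hC : 0 ≤ C) (hc : ContinuousOn φ (Icc (x - h) (x + h)))
    (hd : ∀ s ∈ Ioo (x - h) (x + h), HasDerivAt φ (φ' s) s)
    (hb : ∀ s ∈ Ioo 0 h, |φ' (x + s) - φ' (x - s) - 2 * s * φ'' x| ≤ C * s ^ k) {s : ℝ}
    (hs : s ∈ Icc 0 h) :
    |φ (x + s) + φ (x - s) - 2 * φ x - s ^ 2 * φ'' x| ≤ C * s ^ (k + 1) := by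
  obtain ⟨c1, c2⟩ := continuousOn_comp_pm hc
  refine abs_le_pow_succ_of_deriv_le
    (ψ := fun s => φ (x + s) + φ (x - s) - 2 * φ x - s ^ 2 * φ'' x)
    (ψ' := fun s => φ' (x + s) - φ' (x - s) - 2 * s * φ'' x) hC
    (((c1.add c2).sub continuousOn_const).sub (by fun_prop))
    (by simp only [add_zero, sub_zero]; ring) (fun s hs => ?_) hb hs
  obtain ⟨d1, d2⟩ := hasDerivAt_comp_pm hd hs
  exact (((d1.fun_add d2).sub_const _).fun_sub
    ((hasDerivAt_pow 2 s).mul_const (φ'' x))).congr_deriv (by push_cast; ring)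

end

/-- `φ 0, …, φ n` are successive derivatives on an open interval. -/
def DerivTower (n : ℕ) (φ : ℕ → ℝ → ℝ) (a b : ℝ) : Prop :=
  ∀ l < n, ∀ s ∈ Ioo a b, HasDerivAt (φ l) (φ (l + 1) s) s

theorem DerivTower.mono {n m : ℕ} {φ : ℕ → ℝ → ℝ} {a b a' b' : ℝ} (H : DerivTower n φ a b)
    (hm : m ≤ n) (ha : a ≤ a') (hb : b' ≤ b) : DerivTower m φ a' b' :=
  fun l hl s hs => H l (hl.trans_le hm) s ⟨ha.trans_lt hs.1, hs.2.trans_le hb⟩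

section
variable {φ : ℕ → ℝ → ℝ} {x h K : ℝ}

theorem DerivTower.bound_nonneg {n : ℕ} (hh : 0 < h)
    (hb : ∀ s ∈ Ioo (x - h) (x + h), |φ n s| ≤ K) : 0 ≤ K :=
  (abs_nonneg _).trans (hb x ⟨by linarith, by linarith⟩)

theorem DerivTower.continuousOn {n l : ℕ} {a b a' b' : ℝ} (H : DerivTower n φ a b) (hl : l < n)
    (ha : a < a') (hb : b' < b) : ContinuousOn (φ l) (Icc a' b') :=
  fun s hs => (H l hl s ⟨ha.trans_le hs.1, hs.2.trans_lt hb⟩).continuousAt.continuousWithinAt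

theorem secondDifference_le {s : ℝ} (H : DerivTower 2 φ (x - h) (x + h))
    (hb : ∀ s ∈ Ioo (x - h) (x + h), |φ 2 s| ≤ K) (hs : s ∈ Ioo 0 h) :
    |φ 0 (x + s) + φ 0 (x - s) - 2 * φ 0 x| ≤ 2 * K * s ^ 2 := by
  have hh : 0 < h := hs.1.trans hs.2
  have hK := DerivTower.bound_nonneg hh hb
  have H' : DerivTower 2 φ (x - s) (x + s) := H.mono le_rfl (by linarith [hs.2]) (by linarith [hs.2])
  exact abs_even_le (k := 1) (by linarith)
    (H.continuousOn (by norm_num) (by linarith [hs.2]) (by linarith [hs.2])) (H' 0 (by norm_num))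
    (fun σ hσ => abs_odd_le (H 1 (by norm_num)) hb ⟨hσ.1, hσ.2.trans hs.2⟩)
    ⟨hs.1.le, le_rfl⟩

/-- Continuity up to `x ± h` is a separate hypothesis because these points may lie on the boundary
of the cube, where no derivatives are available. -/
theorem centralDifference_le (hh : 0 < h) (hc : ContinuousOn (φ 0) (Icc (x - h) (x + h)))
    (H : DerivTower 3 φ (x - h) (x + h)) (hb : ∀ s ∈ Ioo (x - h) (x + h), |φ 3 s| ≤ K) :
    |φ 0 (x + h) - φ 0 (x - h) - 2 * h * φ 1 x| ≤ 2 * K * h ^ 3 := by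
  have hK := DerivTower.bound_nonneg hh hb
  refine abs_odd_sub_le (k := 2) (by linarith) hc (H 0 (by norm_num)) (fun s hs => ?_)
    ⟨hh.le, le_rfl⟩
  exact secondDifference_le (φ := fun l => φ (l + 1)) (h := h)
    (fun l hl => H (l + 1) (by omega)) hb hs

theorem secondDifference_sub_le (hh : 0 < h) (hc : ContinuousOn (φ 0) (Icc (x - h) (x + h)))
    (H : DerivTower 4 φ (x - h) (x + h)) (hb : ∀ s ∈ Ioo (x - h) (x + h), |φ 4 s| ≤ K) :
    |φ 0 (x + h) + φ 0 (x - h) - 2 * φ 0 x - h ^ 2 * φ 2 x| ≤ 2 * K * h ^ 4 := by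
  have hK := DerivTower.bound_nonneg hh hb
  refine abs_even_sub_le (k := 3) (φ'' := φ 2) (by linarith) hc (H 0 (by norm_num))
    (fun s hs => ?_) ⟨hh.le, le_rfl⟩
  exact centralDifference_le (φ := fun l => φ (l + 1)) (h := s) hs.1
    (H.continuousOn (by norm_num) (by linarith [hs.2]) (by linarith [hs.2]))
    (fun l hl => (H.mono le_rfl (by linarith [hs.2]) (by linarith [hs.2])) (l + 1) (by omega))
    fun σ hσ => hb σ ⟨by linarith [hσ.1, hs.2], by linarith [hσ.2, hs.2]⟩

end

/-- Bounds of the first two derivatives in terms of the function and of higher derivatives. -/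
theorem DerivTower.interpolation {φ : ℕ → ℝ → ℝ} {B K : ℝ} (H : DerivTower 4 φ 0 1)
    (h0 : ∀ s ∈ Ioo (0 : ℝ) 1, |φ 0 s| ≤ B) (h3 : ∀ s ∈ Ioo (0 : ℝ) 1, |φ 3 s| ≤ K)
    (h4 : ∀ s ∈ Ioo (0 : ℝ) 1, |φ 4 s| ≤ K) {s : ℝ} (hs : s ∈ Ioo (0 : ℝ) 1) :
    |φ 1 s| ≤ 68 * B + 4 * K ∧ |φ 2 s| ≤ 68 * B + 4 * K := by
  have hB : 0 ≤ B := (abs_nonneg _).trans (h0 s hs)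
  have hK : 0 ≤ K := (abs_nonneg _).trans (h3 s hs)
  have hx : (1 / 2 : ℝ) ∈ Ioo (0 : ℝ) 1 := ⟨by norm_num, by norm_num⟩
  have H' : DerivTower 4 φ (1 / 2 - 1 / 4) (1 / 2 + 1 / 4) :=
    H.mono le_rfl (by norm_num) (by norm_num)
  have hc : ContinuousOn (φ 0) (Icc (1 / 2 - 1 / 4) (1 / 2 + 1 / 4)) :=
    H.continuousOn (by norm_num) (by norm_num) (by norm_num)
  -- Differences with step `1/4` control the first two derivatives at the midpoint. The mean value
  -- theorem then spreads the bounds over the interval, first for `φ 2`, then for `φ 1`.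
  have e1 := centralDifference_le (K := K) (by norm_num) hc
    (H'.mono (m := 3) (by norm_num) le_rfl le_rfl)
    fun s hs => h3 s ⟨by linarith [hs.1], by linarith [hs.2]⟩
  have e2 := secondDifference_sub_le (K := K) (by norm_num) hc H'
    fun s hs => h4 s ⟨by linarith [hs.1], by linarith [hs.2]⟩
  have b1 := abs_le.1 (h0 (1 / 2 + 1 / 4) ⟨by norm_num, by norm_num⟩)
  have b2 := abs_le.1 (h0 (1 / 2 - 1 / 4) ⟨by norm_num, by norm_num⟩)
  have b3 := abs_le.1 (h0 (1 / 2) hx)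
  rw [abs_le] at e1 e2
  norm_num at e1 e2 b1 b2 b3
  have d2 : ∀ s ∈ Ioo (0 : ℝ) 1, |φ 2 s| ≤ 64 * B + 2 * K := by
    intro s hs
    have := abs_le.1 (abs_sub_le_of_hasDerivAt (H 2 (by norm_num)) h3 hx hs)
    have h1 : |s - 1 / 2| ≤ 1 := by
      rw [abs_le]
      constructor <;> linarith [hs.1, hs.2]
    have h2 := mul_le_mul_of_nonneg_left h1 hK
    rw [abs_le]
    constructor <;> linarith
  refine ⟨?_, (d2 s hs).trans (by linarith)⟩
  have := abs_le.1 (abs_sub_le_of_hasDerivAt (H 1 (by norm_num)) d2 hx hs)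
  have h1 : |s - 1 / 2| ≤ 1 := by
    rw [abs_le]
    constructor <;> linarith [hs.1, hs.2]
  have h2 := mul_le_mul_of_nonneg_left h1 (by linarith : 0 ≤ 64 * B + 2 * K)
  rw [abs_le]
  constructor <;> linarith

/-- Consistency of the central difference approximation of `-(A φ')'`. -/
theorem fluxDifference_le {φ A : ℕ → ℝ → ℝ} {x h K L G : ℝ} (hh : 0 < h) (hh1 : h ≤ 1)
    (hx0 : 0 ≤ x - h) (hx1 : x + h ≤ 1)
    (hc : ContinuousOn (φ 0) (Icc (x - h) (x + h))) (H : DerivTower 4 φ 0 1)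
    (hA : DerivTower 3 A 0 1) (h1 : |φ 1 x| ≤ G) (h2 : |φ 2 x| ≤ G)
    (h3 : ∀ s ∈ Ioo (0 : ℝ) 1, |φ 3 s| ≤ K) (h4 : ∀ s ∈ Ioo (0 : ℝ) 1, |φ 4 s| ≤ K)
    (hL : ∀ l ≤ 3, ∀ s ∈ Ioo (0 : ℝ) 1, |A l s| ≤ L) :
    |(h ^ 2)⁻¹ * (A 0 (x + h / 2) * (φ 0 x - φ 0 (x + h)) +
        A 0 (x - h / 2) * (φ 0 x - φ 0 (x - h))) + (A 1 x * φ 1 x + A 0 x * φ 2 x)| ≤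
      L * (5 * K + G) * h ^ 2 := by
  have hx : x ∈ Ioo (0 : ℝ) 1 := ⟨by linarith, by linarith⟩
  have hsub : ∀ s ∈ Ioo (x - h) (x + h), s ∈ Ioo (0 : ℝ) 1 := fun s hs =>
    ⟨by linarith [hs.1], by linarith [hs.2]⟩
  have H' : DerivTower 4 φ (x - h) (x + h) := H.mono le_rfl hx0 hx1
  have hA' : DerivTower 3 A (x - h) (x + h) := hA.mono le_rfl hx0 hx1
  have hG : 0 ≤ G := (abs_nonneg _).trans h1
  have hK : 0 ≤ K := (abs_nonneg _).trans (h3 x hx)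
  have hL0 : 0 ≤ L := (abs_nonneg _).trans (hL 0 (by norm_num) x hx)
  have e1 := secondDifference_sub_le (K := K) hh hc H' fun s hs => h4 s (hsub s hs)
  have e2 := centralDifference_le (K := K) hh hc (H'.mono (m := 3) (by norm_num) le_rfl le_rfl)
    fun s hs => h3 s (hsub s hs)
  have e3 := secondDifference_le (K := L) (s := h / 2)
    (hA'.mono (m := 2) (by norm_num) le_rfl le_rfl)
    (fun s hs => hL 2 (by norm_num) s (hsub s hs)) ⟨by linarith, by linarith⟩
  have e4 := centralDifference_le (φ := A) (x := x) (h := h / 2) (K := L) (by linarith)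
    (hA'.continuousOn (by norm_num) (by linarith) (by linarith))
    (hA'.mono le_rfl (by linarith) (by linarith))
    fun s hs => hL 3 le_rfl s ⟨by linarith [hs.1], by linarith [hs.2]⟩
  set E1 := φ 0 (x + h) + φ 0 (x - h) - 2 * φ 0 x - h ^ 2 * φ 2 x with hE1
  set E2 := φ 0 (x + h) - φ 0 (x - h) - 2 * h * φ 1 x with hE2
  set E3 := A 0 (x + h / 2) + A 0 (x - h / 2) - 2 * A 0 x with hE3
  set E4 := A 0 (x + h / 2) - A 0 (x - h / 2) - 2 * (h / 2) * A 1 x with hE4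
  -- From `a x + b y = ½(a+b)(x+y) + ½(a-b)(x-y)`: half sums of the coefficients meet the second
  -- difference of `φ`, half differences meet its central difference. Products of the leading parts
  -- give `(Aφ')'`; the other six products are remainders.
  have hid : (h ^ 2)⁻¹ * (A 0 (x + h / 2) * (φ 0 x - φ 0 (x + h)) +
        A 0 (x - h / 2) * (φ 0 x - φ 0 (x - h))) + (A 1 x * φ 1 x + A 0 x * φ 2 x) =
      -(h ^ 2)⁻¹ * (A 0 x * E1 + 1 / 2 * (E3 * (h ^ 2 * φ 2 x)) + 1 / 2 * (E3 * E1) +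
        1 / 2 * (h * A 1 x * E2) + h * φ 1 x * E4 + 1 / 2 * (E4 * E2)) := by
    rw [hE1, hE2, hE3, hE4]
    field_simp
    ring
  have a0 := hL 0 (by norm_num) x hx
  have a1 := hL 1 (by norm_num) x hx
  have hh2 : h ^ 2 ≤ 1 := pow_le_one₀ hh.le hh1
  have p1 : |A 0 x * E1| ≤ L * (2 * K * h ^ 4) := by
    rw [abs_mul]; gcongr
  have p2 : |E3 * (h ^ 2 * φ 2 x)| ≤ (2 * L * (h / 2) ^ 2) * (h ^ 2 * G) := by
    rw [abs_mul, abs_mul, abs_of_pos (by positivity : 0 < h ^ 2)]; gcongr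
  have p3 : |E3 * E1| ≤ (2 * L * (h / 2) ^ 2) * (2 * K * h ^ 4) := by
    rw [abs_mul]; gcongr
  have p4 : |h * A 1 x * E2| ≤ h * L * (2 * K * h ^ 3) := by
    rw [abs_mul, abs_mul, abs_of_pos hh]; gcongr
  have p5 : |h * φ 1 x * E4| ≤ h * G * (2 * L * (h / 2) ^ 3) := by
    rw [abs_mul, abs_mul, abs_of_pos hh]; gcongr
  have p6 : |E4 * E2| ≤ (2 * L * (h / 2) ^ 3) * (2 * K * h ^ 3) := by
    rw [abs_mul]; gcongr
  have hsum : |A 0 x * E1 + 1 / 2 * (E3 * (h ^ 2 * φ 2 x)) + 1 / 2 * (E3 * E1) +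
      1 / 2 * (h * A 1 x * E2) + h * φ 1 x * E4 + 1 / 2 * (E4 * E2)| ≤
      L * (5 * K + G) * h ^ 4 := by
    have q1 : L * K * h ^ 4 * h ^ 2 ≤ L * K * h ^ 4 * 1 := by gcongr
    have q2 : 0 ≤ L * G * h ^ 4 := by positivity
    have q3 : 0 ≤ L * K * h ^ 4 := by positivity
    rw [abs_le] at p1 p2 p3 p4 p5 p6 ⊢
    constructor <;> linarith
  rw [hid, abs_mul, abs_neg, abs_of_pos (by positivity : 0 < (h ^ 2)⁻¹)]
  calc _ ≤ (h ^ 2)⁻¹ * (L * (5 * K + G) * h ^ 4) := by gcongr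
    _ = _ := by field_simp

/-! ### Restriction to coordinate lines, and nodes of the spatial mesh -/

section
variable {d : ℕ}

theorem update_add_smul_single (x : Fin d → ℝ) (k : Fin d) (s τ : ℝ) :
    Function.update x k s + τ • (Pi.single k (1 : ℝ) : Fin d → ℝ) =
      Function.update x k (s + τ) := by
  ext j
  rcases eq_or_ne j k with rfl | hj
  · simp
  · simp [hj]

/-- Along a coordinate line a partial derivative is an ordinary derivative, which makes the
one-variable estimates applicable. -/
theorem hasLineDerivAt_update_iff {G : (Fin d → ℝ) → ℝ} {D : ℝ} {x : Fin d → ℝ} {k : Fin d}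
    {s : ℝ} : HasLineDerivAt ℝ G D (Function.update x k s) (Pi.single k 1) ↔
      HasDerivAt (fun σ => G (Function.update x k σ)) D s := by
  unfold HasLineDerivAt
  simp only [update_add_smul_single]
  constructor
  · intro h
    have h' : HasDerivAt (fun t => G (Function.update x k (s + t))) D (s - s) := by
      rwa [sub_self]
    simpa using h'.comp_sub_const s s
  · intro h
    have h' : HasDerivAt (fun σ => G (Function.update x k σ)) D (s + 0) := by rwa [add_zero]
    exact h'.comp_const_add s 0

theorem PDiffAt.hasDerivAt {G : (Fin d → ℝ) → ℝ} {x : Fin d → ℝ} {k : Fin d} {s : ℝ}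
    (h : PDiffAt k G (Function.update x k s)) :
    HasDerivAt (fun σ => G (Function.update x k σ)) (pd k G (Function.update x k s)) s :=
  hasLineDerivAt_update_iff.1 (LineDifferentiableAt.hasLineDerivAt h)

theorem pd_eq_of_hasDerivAt {G : (Fin d → ℝ) → ℝ} {D : ℝ} {x : Fin d → ℝ} {k : Fin d} {s : ℝ}
    (h : HasDerivAt (fun σ => G (Function.update x k σ)) D s) :
    pd k G (Function.update x k s) = D :=
  (hasLineDerivAt_update_iff.2 h).lineDeriv

theorem update_mem_cube {x : Fin d → ℝ} (hx : x ∈ cube d) {k : Fin d} {s : ℝ}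
    (hs : s ∈ Ioo (0 : ℝ) 1) : Function.update x k s ∈ cube d := by
  intro j _
  rcases eq_or_ne j k with rfl | hj
  · simpa using hs
  · simpa [hj] using hx j (mem_univ _)

theorem cube_subset_closedCube : cube d ⊆ closedCube d :=
  fun _ hx j hj => Ioo_subset_Icc_self (hx j hj)

theorem update_mem_closedCube {x : Fin d → ℝ} (hx : x ∈ cube d) {k : Fin d} {s : ℝ}
    (hs : s ∈ Icc (0 : ℝ) 1) : Function.update x k s ∈ closedCube d := by
  intro j _
  rcases eq_or_ne j k with rfl | hj
  · simpa using hs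
  · simpa [hj] using cube_subset_closedCube hx j (mem_univ _)

theorem closedCube_mem_nhds {x : Fin d → ℝ} (hx : x ∈ cube d) : closedCube d ∈ nhds x := by
  have : IsOpen (cube d) := isOpen_set_pi finite_univ fun _ _ => isOpen_Ioo
  exact Filter.mem_of_superset (this.mem_nhds hx) cube_subset_closedCube

theorem isCompact_closedCube : IsCompact (closedCube d) :=
  isCompact_univ_pi fun _ => isCompact_Icc

/-- The derivatives of `g` along the coordinate line through `x` in the direction `k`. -/
def lineTower (g : (Fin d → ℝ) → ℝ) (x : Fin d → ℝ) (k : Fin d) (l : ℕ) (s : ℝ) : ℝ :=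
  iteratedFDeriv ℝ l g (Function.update x k s) fun _ => Pi.single k 1

theorem lineTower_zero (g : (Fin d → ℝ) → ℝ) (x : Fin d → ℝ) (k : Fin d) (s : ℝ) :
    lineTower g x k 0 s = g (Function.update x k s) := by
  simp [lineTower]

theorem derivTower_lineTower {n : ℕ} {g : (Fin d → ℝ) → ℝ} (hg : ContDiffOn ℝ n g (closedCube d))
    {x : Fin d → ℝ} (hx : x ∈ cube d) (k : Fin d) : DerivTower n (lineTower g x k) 0 1 := by
  intro l hl s hs
  have hmem := update_mem_cube hx (k := k) hs
  have hcd : ContDiffAt ℝ n g (Function.update x k s) :=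
    hg.contDiffAt (closedCube_mem_nhds hmem)
  have h1 := (hcd.differentiableAt_iteratedFDeriv (m := l) (by exact_mod_cast hl)).hasFDerivAt
  have h2 := h1.comp_hasDerivAt s (hasDerivAt_update x k s)
  have h3 := ((ContinuousMultilinearMap.apply ℝ (fun _ : Fin l => (Fin d → ℝ)) ℝ
    (fun _ => Pi.single k 1)).hasFDerivAt).comp_hasDerivAt s h2
  refine h3.congr_deriv ?_
  rw [lineTower, iteratedFDeriv_succ_apply_left]
  rfl

theorem abs_lineTower_le {n l : ℕ} {K : ℝ} {g : (Fin d → ℝ) → ℝ}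
    (hb : ∀ j ≤ n, ∀ y ∈ closedCube d, ‖iteratedFDerivWithin ℝ j g (closedCube d) y‖ ≤ K)
    (hl : l ≤ n) {x : Fin d → ℝ} (hx : x ∈ cube d) (k : Fin d) {s : ℝ} (hs : s ∈ Ioo (0 : ℝ) 1) :
    |lineTower g x k l s| ≤ K := by
  have hmem := update_mem_cube hx (k := k) hs
  have h1 := hb l hl _ (cube_subset_closedCube hmem)
  rw [iteratedFDerivWithin_congr_set (t := univ), iteratedFDerivWithin_univ] at h1
  · refine le_trans ?_ h1
    have h2 := (iteratedFDeriv ℝ l g (Function.update x k s)).le_opNorm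
      fun _ => (Pi.single k 1 : Fin d → ℝ)
    simpa [lineTower, Pi.norm_single] using h2
  · filter_upwards [closedCube_mem_nhds hmem] with y hy
    simp only [eq_iff_iff]
    exact ⟨fun _ => trivial, fun _ => hy⟩

theorem derivTower_iterate_pd {n : ℕ} {g : (Fin d → ℝ) → ℝ} {x : Fin d → ℝ} (hx : x ∈ cube d)
    (k : Fin d) (hg : ∀ y ∈ cube d, ∀ l < n, PDiffAt k ((pd k)^[l] g) y) :
    DerivTower n (fun l s => (pd k)^[l] g (Function.update x k s)) 0 1 := by
  intro l hl s hs
  have := (hg _ (update_mem_cube hx hs) l hl).hasDerivAt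
  simp only [Function.iterate_succ_apply']
  exact this

/-! Nodes. -/

variable {N : ℕ}

theorem node_mem_cube (hN : 1 ≤ N) {i : Idx d N} (hi : i ∈ interior (d := d) (N := N)) :
    node i ∈ cube d := by
  intro k _
  have hN0 : (0 : ℝ) < N := by exact_mod_cast hN
  obtain ⟨h1, h2⟩ := hi k
  have h1' : (0 : ℝ) < ((i k : ℕ) : ℝ) := by exact_mod_cast h1
  have h2' : ((i k : ℕ) : ℝ) < N := by exact_mod_cast h2
  refine ⟨by simp only [node]; positivity, ?_⟩
  simp only [node, mul_one_div]
  rwa [div_lt_one hN0]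

theorem node_mem_closedCube (hN : 1 ≤ N) (i : Idx d N) : node i ∈ closedCube d := by
  intro k _
  have hN0 : (0 : ℝ) < N := by exact_mod_cast hN
  have h2' : ((i k : ℕ) : ℝ) ≤ N := by exact_mod_cast (Nat.lt_succ_iff.1 (i k).2)
  refine ⟨by simp only [node]; positivity, ?_⟩
  simp only [node, mul_one_div]
  rwa [div_le_one hN0]

theorem node_mem_cube_iff (hN : 1 ≤ N) {i : Idx d N} :
    node i ∈ cube d ↔ i ∈ interior (d := d) (N := N) := by
  refine ⟨fun h k => ?_, node_mem_cube hN⟩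
  have hN0 : (0 : ℝ) < N := by exact_mod_cast hN
  obtain ⟨h1, h2⟩ := h k (mem_univ k)
  simp only [node, mul_one_div] at h1 h2
  rw [div_lt_one hN0] at h2
  have h1' : (0 : ℝ) < ((i k : ℕ) : ℝ) := by
    by_contra hcon
    have : ((i k : ℕ) : ℝ) = 0 := le_antisymm (not_lt.1 hcon) (by positivity)
    rw [this, zero_div] at h1
    exact lt_irrefl _ h1
  exact ⟨by exact_mod_cast h1', by exact_mod_cast h2⟩

theorem val_next (k : Fin d) {i : Idx d N} (hi : i ∈ interior (d := d) (N := N)) :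
    ((i k + 1 : Fin (N + 1)) : ℕ) = (i k : ℕ) + 1 := by
  rw [Fin.val_add_one, if_neg]
  intro h
  have := (hi k).2
  rw [h, Fin.val_last] at this
  exact lt_irrefl _ this

theorem val_prev (k : Fin d) {i : Idx d N} (hi : i ∈ interior (d := d) (N := N)) :
    ((i k - 1 : Fin (N + 1)) : ℕ) = (i k : ℕ) - 1 := by
  rw [Fin.coe_sub_one, if_neg]
  intro h
  have := (hi k).1
  rw [h] at this
  exact lt_irrefl _ this

theorem node_next (k : Fin d) {i : Idx d N} (hi : i ∈ interior (d := d) (N := N)) :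
    node (next k i) = Function.update (node i) k (node i k + 1 / (N : ℝ)) := by
  ext j
  rcases eq_or_ne j k with rfl | hj
  · simp only [node, next, Function.update_self, val_next j hi]
    push_cast
    ring
  · simp [node, next, hj]

theorem node_prev (k : Fin d) {i : Idx d N} (hi : i ∈ interior (d := d) (N := N)) :
    node (prev k i) = Function.update (node i) k (node i k - 1 / (N : ℝ)) := by
  ext j
  rcases eq_or_ne j k with rfl | hj
  · simp only [node, prev, Function.update_self, val_prev j hi]
    rw [Nat.cast_sub (hi j).1]
    push_cast
    ring
  · simp [node, prev, hj]

theorem add_single_eq_update (x : Fin d → ℝ) (k : Fin d) (s : ℝ) :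
    x + Pi.single k s = Function.update x k (x k + s) := by
  ext j
  rcases eq_or_ne j k with rfl | hj
  · simp
  · simp [hj]

theorem sub_single_eq_update (x : Fin d → ℝ) (k : Fin d) (s : ℝ) :
    x - Pi.single k s = Function.update x k (x k - s) := by
  ext j
  rcases eq_or_ne j k with rfl | hj
  · simp
  · simp [hj]

theorem node_coord_bounds (hN : 1 ≤ N) {i : Idx d N} (hi : i ∈ interior (d := d) (N := N))
    (k : Fin d) : 0 ≤ node i k - 1 / (N : ℝ) ∧ node i k + 1 / (N : ℝ) ≤ 1 := by
  have hN0 : (0 : ℝ) < N := by exact_mod_cast hN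
  obtain ⟨h1, h2⟩ := hi k
  have h1' : (1 : ℝ) ≤ ((i k : ℕ) : ℝ) := by exact_mod_cast h1
  have h2' : ((i k : ℕ) : ℝ) + 1 ≤ N := by exact_mod_cast h2
  have hp : 0 < 1 / (N : ℝ) := by positivity
  have h3 : (N : ℝ) * (1 / (N : ℝ)) = 1 := by field_simp
  simp only [node]
  constructor <;> nlinarith

end

/-! ### Second-order consistency of the difference operator and positivity of its weights. -/

section
variable {d N : ℕ}

/-- Consistency in one coordinate direction. -/
theorem abs_directional_consistency_le {a b v : (Fin d → ℝ) → ℝ} {B K L : ℝ} (k : Fin d)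
    (hv : ContinuousOn v (closedCube d)) (hvB : ∀ x ∈ cube d, |v x| ≤ B)
    (hpd : ∀ x ∈ cube d, ∀ l < 4, PDiffAt k ((pd k)^[l] v) x)
    (hK : ∀ x ∈ cube d, ∀ l : ℕ, l = 3 ∨ l = 4 → |(pd k)^[l] v x| ≤ K)
    (ha : ContDiffOn ℝ 3 a (closedCube d))
    (haL : ∀ j ≤ 3, ∀ x ∈ closedCube d, ‖iteratedFDerivWithin ℝ j a (closedCube d) x‖ ≤ L)
    (hbL : ∀ x ∈ closedCube d, |b x| ≤ L) (hN : 1 ≤ N) {i : Idx d N}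
    (hi : i ∈ interior (d := d) (N := N)) :
    |((1 / (N : ℝ)) ^ 2)⁻¹ *
      (a (node i + Pi.single k (1 / (N : ℝ) / 2)) * (v (node i) - v (node (next k i)))
        + a (node i - Pi.single k (1 / (N : ℝ) / 2)) * (v (node i) - v (node (prev k i))))
      + pd k (fun y => a y * pd k v y) (node i)| ≤
        L * (5 * K + (68 * B + 4 * K)) * (1 / (N : ℝ)) ^ 2 ∧
    |1 / 2 * (1 / (N : ℝ))⁻¹ * b (node i) * (v (node (next k i)) - v (node (prev k i)))
      - b (node i) * pd k v (node i)| ≤ L * K * (1 / (N : ℝ)) ^ 2 := by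
  have hN0 : (0 : ℝ) < N := by exact_mod_cast hN
  have hN1 : (1 : ℝ) ≤ N := by exact_mod_cast hN
  set h : ℝ := 1 / (N : ℝ) with hh
  have hh0 : 0 < h := by positivity
  have hh1 : h ≤ 1 := by rw [hh, div_le_one hN0]; exact hN1
  have hx := node_mem_cube hN hi
  obtain ⟨hX0, hX1⟩ := node_coord_bounds hN hi k
  rw [← hh] at hX0 hX1
  set x := node i with hxdef
  set X : ℝ := x k with hXdef
  have hXm : X ∈ Ioo (0 : ℝ) 1 := ⟨by linarith, by linarith⟩
  set φ : ℕ → ℝ → ℝ := fun l s => (pd k)^[l] v (Function.update x k s) with hφ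
  set A : ℕ → ℝ → ℝ := lineTower a x k with hA
  have hself : Function.update x k X = x := Function.update_eq_self k x
  have Hφ : DerivTower 4 φ 0 1 := derivTower_iterate_pd hx k hpd
  have HA : DerivTower 3 A 0 1 := derivTower_lineTower (n := 3) (by exact_mod_cast ha) hx k
  have hφ0 : ∀ s ∈ Ioo (0 : ℝ) 1, |φ 0 s| ≤ B := fun s hs => hvB _ (update_mem_cube hx hs)
  have hφ3 : ∀ s ∈ Ioo (0 : ℝ) 1, |φ 3 s| ≤ K := fun s hs =>
    hK _ (update_mem_cube hx hs) 3 (Or.inl rfl)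
  have hφ4 : ∀ s ∈ Ioo (0 : ℝ) 1, |φ 4 s| ≤ K := fun s hs =>
    hK _ (update_mem_cube hx hs) 4 (Or.inr rfl)
  have hAL : ∀ l ≤ 3, ∀ s ∈ Ioo (0 : ℝ) 1, |A l s| ≤ L := fun l hl s hs =>
    abs_lineTower_le (n := 3) haL hl hx k hs
  -- Only derivatives of orders three and four are assumed bounded; those of orders one and two are
  -- recovered from them and the bound of `v`.
  obtain ⟨hG1, hG2⟩ := Hφ.interpolation hφ0 hφ3 hφ4 hXm
  have hupd : Continuous fun s : ℝ => Function.update x k s :=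
    continuous_const.update k continuous_id
  have hc : ContinuousOn (φ 0) (Icc (X - h) (X + h)) :=
    hv.comp hupd.continuousOn fun s hs =>
      update_mem_closedCube hx ⟨by linarith [hs.1], by linarith [hs.2]⟩
  have ev : v x = φ 0 X := by simp only [hφ, hself, Function.iterate_zero, id]
  have en : v (node (next k i)) = φ 0 (X + h) := by
    rw [node_next k hi]
    rfl
  have ep : v (node (prev k i)) = φ 0 (X - h) := by
    rw [node_prev k hi]
    rfl
  have ea1 : a (x + Pi.single k (h / 2)) = A 0 (X + h / 2) := by
    rw [add_single_eq_update, hA, lineTower_zero]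
  have ea2 : a (x - Pi.single k (h / 2)) = A 0 (X - h / 2) := by
    rw [sub_single_eq_update, hA, lineTower_zero]
  have ed : pd k v x = φ 1 X := by simp only [hφ, hself, Function.iterate_one]
  have eflux : pd k (fun y => a y * pd k v y) x = A 1 X * φ 1 X + A 0 X * φ 2 X := by
    have h1 := (HA 0 (by norm_num) X hXm).fun_mul (Hφ 1 (by norm_num) X hXm)
    have h2 : HasDerivAt (fun σ => (fun y => a y * pd k v y) (Function.update x k σ))
        (A 1 X * φ 1 X + A 0 X * φ 2 X) X := by
      refine h1.congr_of_eventuallyEq (Filter.Eventually.of_forall fun s => ?_)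
      simp only [hA, lineTower_zero, hφ, Function.iterate_one]
    have h3 := pd_eq_of_hasDerivAt (G := fun y => a y * pd k v y) h2
    rwa [hself] at h3
  rw [ev, en, ep, ea1, ea2, ed, eflux]
  refine ⟨fluxDifference_le hh0 hh1 hX0 hX1 hc Hφ HA hG1 hG2 hφ3 hφ4 hAL, ?_⟩
  have e2 := centralDifference_le (K := K) hh0 hc (Hφ.mono (m := 3) (by norm_num) hX0 hX1)
    fun s hs => hφ3 s ⟨by linarith [hs.1], by linarith [hs.2]⟩
  have hb := hbL x (cube_subset_closedCube hx)
  have hid : 1 / 2 * h⁻¹ * b x * (φ 0 (X + h) - φ 0 (X - h)) - b x * φ 1 X =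
      1 / 2 * h⁻¹ * (b x * (φ 0 (X + h) - φ 0 (X - h) - 2 * h * φ 1 X)) := by
    field_simp
  rw [hid, abs_mul, abs_of_pos (by positivity : 0 < 1 / 2 * h⁻¹), abs_mul]
  calc 1 / 2 * h⁻¹ * (|b x| * |φ 0 (X + h) - φ 0 (X - h) - 2 * h * φ 1 X|)
      ≤ 1 / 2 * h⁻¹ * (L * (2 * K * h ^ 3)) := by
        have : 0 ≤ L := (abs_nonneg _).trans hb
        gcongr
    _ = L * K * h ^ 2 := by field_simp

/-- The finite difference operator is consistent of second order. -/
theorem exists_fdOp_sub_ellipticOp_le {T B : ℝ} {a b : Fin d → (Fin d → ℝ) → ℝ → ℝ}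
    {c : (Fin d → ℝ) → ℝ → ℝ} (hL : EllipticCoeffs T a b c) {u : (Fin d → ℝ) → ℝ → ℝ}
    (hu : ∀ t ∈ Ioc 0 T, ContinuousOn (fun x => u x t) (closedCube d))
    (huB : ∀ x ∈ cube d, ∀ t ∈ Ioc 0 T, |u x t| ≤ B) (hsr : SpaceRegular T u) :
    ∃ C : ℝ, ∀ t ∈ Ioc 0 T, ∀ N : ℕ, 1 ≤ N → ∀ i ∈ interior (d := d) (N := N),
      |fdOp a b c t (fun i : Idx d N => u (node i) t) i -
        ellipticOp a b c t (fun y => u y t) (node i)| ≤ C * (1 / (N : ℝ)) ^ 2 := by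
  obtain ⟨K, hK⟩ := hsr
  choose La hLa using hL.smooth_a
  choose Lb hLb using hL.smooth_b
  set L : Fin d → ℝ := fun k => max (La k) (Lb k) with hLdef
  refine ⟨∑ k, (L k * (5 * K + (68 * B + 4 * K)) + L k * K), fun t ht N hN i hi => ?_⟩
  have main := fun k => abs_directional_consistency_le (a := fun y => a k y t)
    (b := fun y => b k y t) (v := fun y => u y t) (B := B) (K := K) (L := L k) k (hu t ht)
    (fun x hx => huB x hx t ht) (fun x hx => (hK k x hx t ht).1)
    (fun x hx => (hK k x hx t ht).2) (by exact_mod_cast (hLa k t ht).1)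
    (fun j hj x hx => ((hLa k t ht).2 j hj x hx).trans (le_max_left _ _))
    (fun x hx => by
      have := (hLb k t ht).2 0 (Nat.zero_le _) x hx
      rw [norm_iteratedFDerivWithin_zero] at this
      exact this.trans (le_max_right _ _)) hN hi
  have e : fdOp a b c t (fun i : Idx d N => u (node i) t) i -
      ellipticOp a b c t (fun y => u y t) (node i) =
      ∑ k, ((((1 / (N : ℝ)) ^ 2)⁻¹ *
        (a k (node i + Pi.single k (1 / (N : ℝ) / 2)) t *
            (u (node i) t - u (node (next k i)) t)
          + a k (node i - Pi.single k (1 / (N : ℝ) / 2)) t *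
            (u (node i) t - u (node (prev k i)) t))
        + pd k (fun y => a k y t * pd k (fun y => u y t) y) (node i)) +
      (1 / 2 * (1 / (N : ℝ))⁻¹ * b k (node i) t *
          (u (node (next k i)) t - u (node (prev k i)) t)
        - b k (node i) t * pd k (fun y => u y t) (node i))) := by
    simp only [fdOp, ellipticOp]
    rw [add_sub_add_right_eq_sub, ← Finset.sum_add_distrib, ← Finset.sum_sub_distrib]
    exact Finset.sum_congr rfl fun k _ => by ring
  rw [e, Finset.sum_mul]
  refine (Finset.abs_sum_le_sum_abs _ _).trans (Finset.sum_le_sum fun k _ => ?_)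
  refine (abs_add_le _ _).trans ?_
  rw [add_mul]
  exact add_le_add (main k).1 (main k).2

/-! ### The discrete maximum principle -/

/-- The weight of the neighbour `z + h iₖ` in the finite difference operator. -/
def wNext (a b : Fin d → (Fin d → ℝ) → ℝ → ℝ) (t : ℝ) (i : Idx d N) (k : Fin d) : ℝ :=
  ((1 / (N : ℝ)) ^ 2)⁻¹ * a k (node i + Pi.single k (1 / (N : ℝ) / 2)) t -
    1 / 2 * (1 / (N : ℝ))⁻¹ * b k (node i) t

/-- The weight of the neighbour `z - h iₖ` in the finite difference operator. -/
def wPrev (a b : Fin d → (Fin d → ℝ) → ℝ → ℝ) (t : ℝ) (i : Idx d N) (k : Fin d) : ℝ :=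
  ((1 / (N : ℝ)) ^ 2)⁻¹ * a k (node i - Pi.single k (1 / (N : ℝ) / 2)) t +
    1 / 2 * (1 / (N : ℝ))⁻¹ * b k (node i) t

theorem fdOp_eq (a b : Fin d → (Fin d → ℝ) → ℝ → ℝ) (c : (Fin d → ℝ) → ℝ → ℝ) (t : ℝ)
    (V : Idx d N → ℝ) (i : Idx d N) :
    fdOp a b c t V i = ∑ k, (wNext a b t i k * (V i - V (next k i)) +
      wPrev a b t i k * (V i - V (prev k i))) + c (node i) t * V i := by
  simp only [fdOp, wNext, wPrev]
  rw [← Finset.sum_add_distrib]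
  congr 1
  exact Finset.sum_congr rfl fun k _ => by ring

theorem le_supNorm {X : Type*} {S : Set X} {g : X → ℝ} {C : ℝ} (hC : ∀ x ∈ S, |g x| ≤ C) {x : X}
    (hx : x ∈ S) : |g x| ≤ supNorm S g := by
  refine le_csSup ⟨C, ?_⟩ ⟨x, hx, rfl⟩
  rintro _ ⟨y, hy, rfl⟩
  exact hC y hy

theorem supNorm_nonneg {X : Type*} (S : Set X) (g : X → ℝ) : 0 ≤ supNorm S g := by
  refine Real.sSup_nonneg ?_
  rintro _ ⟨y, _, rfl⟩
  exact abs_nonneg _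

/-- The points `x` and `y` may differ because the mesh condition multiplies two separate suprema.
This is needed as `a` is evaluated at half-shifted points and `b` at nodes. -/
theorem abs_le_mul_of_discreteMaxCond {T : ℝ} {a b : Fin d → (Fin d → ℝ) → ℝ → ℝ}
    {c : (Fin d → ℝ) → ℝ → ℝ} (hL : EllipticCoeffs T a b c) (hN : 1 ≤ N)
    (hmax : DiscreteMaxCond T a b N) {t : ℝ} (ht : t ∈ Ioc 0 T) (k : Fin d) {x y : Fin d → ℝ}
    (hx : x ∈ cube d) (hy : y ∈ cube d) :
    1 / 2 * (1 / (N : ℝ))⁻¹ * |b k y t| ≤ ((1 / (N : ℝ)) ^ 2)⁻¹ * a k x t := by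
  have hN0 : (0 : ℝ) < N := by exact_mod_cast hN
  obtain ⟨Kb, hKb⟩ := hL.smooth_b k
  obtain ⟨Ka, hKa⟩ := hL.smooth_a k
  have hb : |b k y t| ≤ supNorm (cube d) fun x => b k x t := by
    refine le_supNorm (g := fun x => b k x t) (C := Kb) (fun z hz => ?_) hy
    have := (hKb t ht).2 0 (Nat.zero_le _) z (cube_subset_closedCube hz)
    rwa [norm_iteratedFDerivWithin_zero] at this
  have hapos := hL.a_pos k x (cube_subset_closedCube hx) t ht
  have ha : (a k x t)⁻¹ ≤ supNorm (cube d) fun x => (a k x t)⁻¹ := by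
    have hcont : ContinuousOn (fun x => (a k x t)⁻¹) (closedCube d) :=
      (hKa t ht).1.continuousOn.inv₀ fun z hz => (hL.a_pos k z hz t ht).ne'
    obtain ⟨C, hC⟩ := isCompact_closedCube.exists_bound_of_continuousOn hcont
    have := le_supNorm (g := fun x => (a k x t)⁻¹) (C := C)
      (fun z hz => hC z (cube_subset_closedCube hz)) hx
    rwa [abs_of_pos (inv_pos.2 hapos)] at this
  have h1 := hmax t ht k
  have h2 : 1 / 2 * |b k y t| * (a k x t)⁻¹ ≤ N := by
    refine le_trans ?_ (h1.trans (by simp))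
    have := supNorm_nonneg (cube d) fun x => b k x t
    gcongr
  rw [← div_eq_mul_inv, div_le_iff₀ hapos] at h2
  have e1 : (1 / (N : ℝ))⁻¹ = N := by simp
  have e2 : ((1 / (N : ℝ)) ^ 2)⁻¹ = (N : ℝ) * (N : ℝ) := by
    field_simp
  rw [e1, e2]
  linarith [mul_le_mul_of_nonneg_left h2 hN0.le]

theorem half_shift_mem_cube (hN : 1 ≤ N) {i : Idx d N} (hi : i ∈ interior (d := d) (N := N))
    (k : Fin d) : node i + Pi.single k (1 / (N : ℝ) / 2) ∈ cube d ∧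
      node i - Pi.single k (1 / (N : ℝ) / 2) ∈ cube d := by
  have hN0 : (0 : ℝ) < N := by exact_mod_cast hN
  have hp : 0 < 1 / (N : ℝ) := by positivity
  obtain ⟨h0, h1⟩ := node_coord_bounds hN hi k
  rw [add_single_eq_update, sub_single_eq_update]
  exact ⟨update_mem_cube (node_mem_cube hN hi) ⟨by linarith, by linarith⟩,
    update_mem_cube (node_mem_cube hN hi) ⟨by linarith, by linarith⟩⟩

theorem weights_nonneg {T : ℝ} {a b : Fin d → (Fin d → ℝ) → ℝ → ℝ}
    {c : (Fin d → ℝ) → ℝ → ℝ} (hL : EllipticCoeffs T a b c) (hN : 1 ≤ N)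
    (hmax : DiscreteMaxCond T a b N) {t : ℝ} (ht : t ∈ Ioc 0 T) {i : Idx d N}
    (hi : i ∈ interior (d := d) (N := N)) (k : Fin d) :
    0 ≤ wNext a b t i k ∧ 0 ≤ wPrev a b t i k := by
  have hN0 : (0 : ℝ) < N := by exact_mod_cast hN
  obtain ⟨hm1, hm2⟩ := half_shift_mem_cube hN hi k
  have h1 := abs_le_mul_of_discreteMaxCond hL hN hmax ht k hm1 (node_mem_cube hN hi)
  have h2 := abs_le_mul_of_discreteMaxCond hL hN hmax ht k hm2 (node_mem_cube hN hi)
  have h3 : 0 ≤ 1 / 2 * (1 / (N : ℝ))⁻¹ := by positivity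
  have h4 := mul_le_mul_of_nonneg_left (le_abs_self (b k (node i) t)) h3
  have h5 := mul_le_mul_of_nonneg_left (neg_abs_le (b k (node i) t)) h3
  unfold wNext wPrev
  constructor <;> linarith

/-- The discrete maximum principle. -/
theorem fdOp_ge_of_max {T : ℝ} {a b : Fin d → (Fin d → ℝ) → ℝ → ℝ}
    {c : (Fin d → ℝ) → ℝ → ℝ} (hL : EllipticCoeffs T a b c) (hN : 1 ≤ N)
    (hmax : DiscreteMaxCond T a b N) {t : ℝ} (ht : t ∈ Ioc 0 T) {i : Idx d N}
    (hi : i ∈ interior (d := d) (N := N)) {V : Idx d N → ℝ} (hV : ∀ j, V j ≤ V i) :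
    c (node i) t * V i ≤ fdOp a b c t V i := by
  rw [fdOp_eq]
  refine le_add_of_nonneg_left (Finset.sum_nonneg fun k _ => ?_)
  obtain ⟨h1, h2⟩ := weights_nonneg hL hN hmax ht hi k
  exact add_nonneg (mul_nonneg h1 (sub_nonneg.2 (hV _))) (mul_nonneg h2 (sub_nonneg.2 (hV _)))

end

/-! ### The maximum norm of the error, uniqueness, range and existence. -/

section
variable {d N : ℕ}

theorem fdOp_sub (a b : Fin d → (Fin d → ℝ) → ℝ → ℝ) (c : (Fin d → ℝ) → ℝ → ℝ) (t : ℝ)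
    (V W : Idx d N → ℝ) (i : Idx d N) :
    fdOp a b c t (fun j => V j - W j) i = fdOp a b c t V i - fdOp a b c t W i := by
  simp only [fdOp_eq]
  rw [add_sub_add_comm, ← Finset.sum_sub_distrib]
  congr 1
  · exact Finset.sum_congr rfl fun k _ => by ring
  · ring

theorem fdOp_smul (a b : Fin d → (Fin d → ℝ) → ℝ → ℝ) (c : (Fin d → ℝ) → ℝ → ℝ) (t s : ℝ)
    (V : Idx d N → ℝ) (i : Idx d N) :
    fdOp a b c t (fun j => s * V j) i = s * fdOp a b c t V i := by
  simp only [fdOp_eq]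
  rw [mul_add, Finset.mul_sum]
  congr 1
  · exact Finset.sum_congr rfl fun k _ => by ring
  · ring

theorem abs_le_supNorm_interior (g : Idx d N → ℝ) {i : Idx d N} (hi : i ∈ interior) :
    |g i| ≤ supNorm interior g :=
  le_csSup ((toFinite _).bddAbove) ⟨i, hi, rfl⟩

theorem exists_abs_eq_supNorm (hne : (interior (d := d) (N := N)).Nonempty)
    (g : Idx d N → ℝ) : ∃ i ∈ interior, supNorm interior g = |g i| := by
  obtain ⟨i, hi, h⟩ := (hne.image fun x => |g x|).csSup_mem (toFinite _)
  exact ⟨i, hi, h.symm⟩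

/-- The maximum norm of the error satisfies a scalar discrete fractional inequality. -/
theorem l1_supNorm_sub_le {α T lam R : ℝ} {M : ℕ} {t : ℕ → ℝ} (hα : 0 < α) (hα' : α < 1)
    (ht : IsTemporalMesh T M t) {a b : Fin d → (Fin d → ℝ) → ℝ → ℝ}
    {c : (Fin d → ℝ) → ℝ → ℝ} (hL : EllipticCoeffs T a b c) (hN : 1 ≤ N)
    (hmax : DiscreteMaxCond T a b N) (hR : 0 ≤ R) {m : ℕ} (hm : m ∈ Finset.Icc 1 M)
    {e : ℕ → Idx d N → ℝ} {p : Idx d N → ℝ} (hbd : ∀ i ∉ interior, e m i = 0)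
    (hp : ∀ i ∈ interior, (0 ≤ e m i → -lam * e m i ≤ p i) ∧ (e m i ≤ 0 → p i ≤ -lam * e m i))
    (heq : ∀ i ∈ interior,
      |l1 α t (fun j => e j i) m + fdOp a b c (t m) (e m) i + p i| ≤ R) :
    l1 α t (fun j => supNorm interior (e j)) m - lam * supNorm interior (e m) ≤ R := by
  -- Without interior nodes, as for `N = 1` and `d ≥ 1`, the supremum over the empty set is `0` by
  -- convention.
  rcases (interior (d := d) (N := N)).eq_empty_or_nonempty with hemp | hne
  · have h0 : ∀ g : Idx d N → ℝ, supNorm interior g = 0 := fun g => by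
      simp [supNorm, hemp]
    simp only [h0, mul_zero, sub_zero]
    refine le_trans (le_of_eq ?_) hR
    simp [l1_eq]
  obtain ⟨i, hi, hiE⟩ := exists_abs_eq_supNorm hne (e m)
  have htm := ht.mem_Ioc hm
  obtain ⟨s, hs, hsi⟩ : ∃ s : ℝ, (s = 1 ∨ s = -1) ∧ |e m i| = s * e m i := by
    rcases le_total 0 (e m i) with h | h
    · exact ⟨1, Or.inl rfl, by rw [abs_of_nonneg h, one_mul]⟩
    · exact ⟨-1, Or.inr rfl, by rw [abs_of_nonpos h, neg_one_mul]⟩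
  have hsabs : ∀ x : ℝ, s * x ≤ |x| := fun x => by
    rcases hs with rfl | rfl
    · rw [one_mul]; exact le_abs_self x
    · rw [neg_one_mul]; exact neg_le_abs x
  have h1 : 0 ≤ s * fdOp a b c (t m) (e m) i := by
    rw [← fdOp_smul]
    refine le_trans ?_ (fdOp_ge_of_max hL hN hmax htm hi fun j => ?_)
    · rw [← hsi]
      exact mul_nonneg (hL.c_nonneg _ (cube_subset_closedCube (node_mem_cube hN hi)) _ htm)
        (abs_nonneg _)
    · by_cases hj : j ∈ interior
      · rw [← hsi, ← hiE]
        exact (hsabs _).trans (abs_le_supNorm_interior (e m) hj)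
      · rw [hbd j hj, mul_zero, ← hsi]
        exact abs_nonneg _
  have h2 : -lam * (s * e m i) ≤ s * p i := by
    rcases hs with rfl | rfl
    · rw [one_mul, one_mul]
      exact (hp i hi).1 (by rw [one_mul] at hsi; rw [← hsi]; exact abs_nonneg _)
    · have : e m i ≤ 0 := by
        have := abs_nonneg (e m i)
        rw [hsi] at this
        linarith
      have := (hp i hi).2 this
      linarith
  -- The sequence `s * e j i - ‖e j‖` is nonpositive and vanishes at `j = m`, so its L1 derivative
  -- at `m` is nonnegative.
  have h3 : l1 α t (fun j => supNorm interior (e j)) m ≤ s * l1 α t (fun j => e j i) m := by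
    have h4 := l1Coeff_mul_le_l1 hα hα' ht hm
      (V := fun j => s * e j i - supNorm interior (e j)) (Q := 0) (fun j _ => by
        have := (hsabs (e j i)).trans (abs_le_supNorm_interior (e j) hi)
        linarith)
    rw [hiE, hsi, sub_self, sub_zero, mul_zero, l1_sub, l1_smul] at h4
    linarith
  have h5 := (hsabs _).trans (heq i hi)
  rw [hiE, hsi]
  linarith

/-- Nonlinearities with a one-sided Lipschitz condition, as used in the error analysis. -/
theorem A1.sign {T lam : ℝ} {f : (Fin d → ℝ) → ℝ → ℝ → ℝ} (hf : A1 T f lam) {x : Fin d → ℝ}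
    (hx : x ∈ cube d) {t : ℝ} (ht : t ∈ Ioc 0 T) (s₁ s₂ : ℝ) :
    (0 ≤ s₁ - s₂ → -lam * (s₁ - s₂) ≤ f x t s₁ - f x t s₂) ∧
      (s₁ - s₂ ≤ 0 → f x t s₁ - f x t s₂ ≤ -lam * (s₁ - s₂)) := by
  refine ⟨fun h => hf.lipschitz x hx t ht s₁ s₂ (by linarith), fun h => ?_⟩
  have := hf.lipschitz x hx t ht s₂ s₁ (by linarith)
  linarith

/-- The difference of two solutions has zero residual and zero initial values, so the barrier `0`
bounds its maximum norm. -/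
theorem discreteSolution_unique {α T lam : ℝ} {M : ℕ} {t : ℕ → ℝ} (hα : 0 < α) (hα' : α < 1)
    (ht : IsTemporalMesh T M t) {a b : Fin d → (Fin d → ℝ) → ℝ → ℝ}
    {c : (Fin d → ℝ) → ℝ → ℝ} (hL : EllipticCoeffs T a b c) (hN : 1 ≤ N)
    (hmax : DiscreteMaxCond T a b N) {f : (Fin d → ℝ) → ℝ → ℝ → ℝ} (hf : A1 T f lam)
    (hlam : ∀ j ∈ Finset.Icc 1 M, lam * (t j - t (j - 1)) ^ α < (Real.Gamma (2 - α))⁻¹)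
    {u₀ : (Fin d → ℝ) → ℝ} {U U' : ℕ → Idx d N → ℝ}
    (hU : IsDiscreteSolution α a b c f u₀ M t N U)
    (hU' : IsDiscreteSolution α a b c f u₀ M t N U') : ∀ m ≤ M, U' m = U m := by
  set e : ℕ → Idx d N → ℝ := fun j i => U' j i - U j i with he
  have h0 : ∀ i, e 0 i = 0 := fun i => by simp only [he, hU.initial, hU'.initial, sub_self]
  have hE : ∀ j ≤ M, supNorm interior (e j) ≤ 0 := by
    refine l1_comparison (B := fun _ => 0) hα hα' ht hlam le_rfl ?_ fun m hm => ?_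
    · refine Real.sSup_nonpos ?_
      rintro _ ⟨i, _, rfl⟩
      simp [h0]
    · have hz : l1 α t (fun _ => 0) m - lam * 0 = 0 := by simp [l1_eq]
      rw [hz]
      refine l1_supNorm_sub_le (p := fun i => f (node i) (t m) (U' m i) - f (node i) (t m) (U m i))
        hα hα' ht hL hN hmax le_rfl hm (fun i hi => ?_) (fun i hi => ?_) fun i hi => ?_
      · simp only [he, hU.boundary m hm i hi, hU'.boundary m hm i hi, sub_self]
      · exact hf.sign (node_mem_cube hN hi) (ht.mem_Ioc hm) _ _
      · have h1 := hU.equation m hm i hi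
        have h2 := hU'.equation m hm i hi
        simp only [he]
        rw [l1_sub, fdOp_sub, abs_le]
        constructor <;> linarith
  intro m hm
  rcases Nat.eq_zero_or_pos m with rfl | hm0
  · funext i
    rw [hU.initial, hU'.initial]
  · funext i
    have hm' : m ∈ Finset.Icc 1 M := Finset.mem_Icc.2 ⟨hm0, hm⟩
    by_cases hi : i ∈ interior
    · have := (abs_le_supNorm_interior (e m) hi).trans (hE m hm)
      have := abs_eq_zero.1 (le_antisymm this (abs_nonneg _))
      exact sub_eq_zero.1 this
    · rw [hU.boundary m hm' i hi, hU'.boundary m hm' i hi]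

/-- Upper solutions given by nonnegative constants. -/
theorem discrete_le_const {α T lam σ : ℝ} {M : ℕ} {t : ℕ → ℝ} (hα : 0 < α) (hα' : α < 1)
    (ht : IsTemporalMesh T M t) {a b : Fin d → (Fin d → ℝ) → ℝ → ℝ}
    {c : (Fin d → ℝ) → ℝ → ℝ} (hL : EllipticCoeffs T a b c) (hN : 1 ≤ N)
    (hmax : DiscreteMaxCond T a b N)
    (hlam : ∀ j ∈ Finset.Icc 1 M, lam * (t j - t (j - 1)) ^ α < (Real.Gamma (2 - α))⁻¹)
    (hc : ∀ x ∈ closedCube d, ∀ t ∈ Ioc 0 T, c x t = 0) (hσ : 0 ≤ σ)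
    {U F : ℕ → Idx d N → ℝ} (hbd : ∀ m ∈ Finset.Icc 1 M, ∀ i ∉ interior, U m i = 0)
    (h0 : ∀ i, U 0 i ≤ σ)
    (heq : ∀ m ∈ Finset.Icc 1 M, ∀ i ∈ interior,
      l1 α t (fun j => U j i) m + fdOp a b c (t m) (U m) i + F m i = 0)
    (hF : ∀ m ∈ Finset.Icc 1 M, ∀ i ∈ interior, σ ≤ U m i → -lam * (U m i - σ) ≤ F m i) :
    ∀ m ≤ M, ∀ i, U m i ≤ σ := by
  intro m
  induction m using Nat.strong_induction_on with
  | _ m ih =>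
    intro hmM i
    rcases Nat.eq_zero_or_pos m with rfl | hm0
    · exact h0 i
    have hm : m ∈ Finset.Icc 1 M := Finset.mem_Icc.2 ⟨hm0, hmM⟩
    have htm := ht.mem_Ioc hm
    obtain ⟨z, hz⟩ := Finite.exists_max (U m)
    refine (hz i).trans ?_
    by_contra hcon
    push Not at hcon
    -- Boundary values are `0 ≤ σ`, so a node where the solution exceeds `σ` is interior; the sign
    -- of `σ` enters here.
    have hzi : z ∈ interior := by
      by_contra h
      rw [hbd m hm z h] at hcon
      linarith
    have h1 := fdOp_ge_of_max hL hN hmax htm hzi hz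
    rw [hc _ (node_mem_closedCube hN z) _ htm, zero_mul] at h1
    have h2 := l1Coeff_mul_le_l1 hα hα' ht hm (V := fun j => U j z) (Q := σ)
      fun j hj => ih j hj (by omega) z
    have h3 := lam_lt_l1Coeff ht hm (hlam m hm)
    have h4 := hF m hm z hzi hcon.le
    have h5 := heq m hm z hzi
    nlinarith

/-- The lower bound is the upper bound `-σ₁` for `-U`, whose nonlinearity is `-f`. -/
theorem discreteSolution_range {α T lam σ₁ σ₂ : ℝ} {M : ℕ} {t : ℕ → ℝ} (hα : 0 < α)
    (hα' : α < 1) (ht : IsTemporalMesh T M t) {a b : Fin d → (Fin d → ℝ) → ℝ → ℝ}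
    {c : (Fin d → ℝ) → ℝ → ℝ} (hL : EllipticCoeffs T a b c) (hN : 1 ≤ N)
    (hmax : DiscreteMaxCond T a b N) {f : (Fin d → ℝ) → ℝ → ℝ → ℝ} (hf : A1 T f lam)
    (hlam : ∀ j ∈ Finset.Icc 1 M, lam * (t j - t (j - 1)) ^ α < (Real.Gamma (2 - α))⁻¹)
    {u₀ : (Fin d → ℝ) → ℝ} {U : ℕ → Idx d N → ℝ}
    (hU : IsDiscreteSolution α a b c f u₀ M t N U) (hA2 : A2 T f c σ₁ σ₂)
    (hu₀ : ∀ x ∈ closedCube d, σ₁ ≤ u₀ x ∧ u₀ x ≤ σ₂) :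
    ∀ m ≤ M, ∀ i, σ₁ ≤ U m i ∧ U m i ≤ σ₂ := by
  have hup := discrete_le_const (σ := σ₂) (U := U)
    (F := fun m i => f (node i) (t m) (U m i)) hα hα' ht hL hN hmax hlam hA2.c_zero hA2.nonneg
    hU.boundary (fun i => by
      rw [hU.initial]
      exact (hu₀ _ (node_mem_closedCube hN i)).2) hU.equation (fun m hm i hi hle => by
        have h1 := hf.lipschitz _ (node_mem_cube hN hi) _ (ht.mem_Ioc hm) _ _ hle
        have h2 := hA2.f_upper _ (node_mem_cube hN hi) _ (ht.mem_Ioc hm)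
        linarith)
  have hlow := discrete_le_const (σ := -σ₁) (U := fun m i => -1 * U m i)
    (F := fun m i => -f (node i) (t m) (U m i)) hα hα' ht hL hN hmax hlam hA2.c_zero
    (by linarith [hA2.nonpos]) (fun m hm i hi => by rw [hU.boundary m hm i hi, mul_zero])
    (fun i => by
      rw [hU.initial]
      linarith [(hu₀ _ (node_mem_closedCube hN i)).1]) (fun m hm i hi => by
        have := hU.equation m hm i hi
        rw [l1_smul, fdOp_smul]
        linarith) (fun m hm i hi hle => by
        have h1 := hf.lipschitz _ (node_mem_cube hN hi) _ (ht.mem_Ioc hm) σ₁ (U m i)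
          (by linarith)
        have h2 := hA2.f_lower _ (node_mem_cube hN hi) _ (ht.mem_Ioc hm)
        linarith)
  exact fun m hm i => ⟨by linarith [hlow m hm i], hup m hm i⟩

/-! ### Existence of the discrete solution -/

/-- Strong monotonicity forces `G` to `±∞`, so it is onto by the intermediate value theorem, and the
same inequality makes a right inverse Lipschitz with constant `1/μ`. -/
theorem exists_lipschitz_inverse {G : ℝ → ℝ} {μ : ℝ} (hG : Continuous G) (hμ : 0 < μ)
    (hmono : ∀ v w : ℝ, w ≤ v → μ * (v - w) ≤ G v - G w) :
    ∃ S : ℝ → ℝ, (∀ y, G (S y) = y) ∧ ∀ y z, μ * |S y - S z| ≤ |y - z| := by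
  have htop : Filter.Tendsto G Filter.atTop Filter.atTop := by
    refine Filter.tendsto_atTop_mono' _ ?_
      (Filter.tendsto_atTop_add_const_right _ (G 0) (Filter.tendsto_id.const_mul_atTop hμ))
    filter_upwards [Filter.eventually_ge_atTop 0] with v hv
    have := hmono v 0 hv
    simp only [id]
    linarith
  have hbot : Filter.Tendsto G Filter.atBot Filter.atBot := by
    refine Filter.tendsto_atBot_mono' _ ?_
      (Filter.tendsto_atBot_add_const_right _ (G 0) (Filter.tendsto_id.const_mul_atBot hμ))
    filter_upwards [Filter.eventually_le_atBot 0] with v hv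
    have := hmono 0 v hv
    simp only [id]
    linarith
  choose S hS using hG.surjective htop hbot
  refine ⟨S, hS, fun y z => ?_⟩
  have key : ∀ y z, S z ≤ S y → μ * |S y - S z| ≤ |y - z| := fun y z h => by
    have := hmono _ _ h
    rw [hS, hS] at this
    rw [abs_of_nonneg (by linarith)]
    exact this.trans (le_abs_self _)
  rcases le_total (S z) (S y) with h | h
  · exact key y z h
  · rw [abs_sub_comm (S y), abs_sub_comm y]
    exact key z y h

/-- Solvability of one time step, by contraction of the nonlinear Jacobi iteration. -/
theorem exists_step {T lam κ : ℝ} {a b : Fin d → (Fin d → ℝ) → ℝ → ℝ}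
    {c : (Fin d → ℝ) → ℝ → ℝ} (hL : EllipticCoeffs T a b c) (hN : 1 ≤ N)
    (hmax : DiscreteMaxCond T a b N) {f : (Fin d → ℝ) → ℝ → ℝ → ℝ} (hf : A1 T f lam)
    (hκ : lam < κ) {t : ℝ} (ht : t ∈ Ioc 0 T) (g : Idx d N → ℝ) :
    ∃ V : Idx d N → ℝ, (∀ i ∉ interior, V i = 0) ∧
      ∀ i ∈ interior, κ * V i + g i + fdOp a b c t V i + f (node i) t (V i) = 0 := by
  classical
  set P : Idx d N → ℝ := fun i => ∑ k, (wNext a b t i k + wPrev a b t i k) with hP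
  set Nb : (Idx d N → ℝ) → Idx d N → ℝ := fun W i =>
    ∑ k, (wNext a b t i k * W (next k i) + wPrev a b t i k * W (prev k i)) with hNb
  have hP0 : ∀ i ∈ interior, 0 ≤ P i := fun i hi => Finset.sum_nonneg fun k _ => by
    obtain ⟨h1, h2⟩ := weights_nonneg hL hN hmax ht hi k
    linarith
  have hc0 : ∀ i ∈ interior (d := d) (N := N), 0 ≤ c (node i) t := fun i hi =>
    hL.c_nonneg _ (cube_subset_closedCube (node_mem_cube hN hi)) _ ht
  have hS : ∀ i : Idx d N, ∃ S : ℝ → ℝ, i ∈ interior →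
      (∀ y, (κ + P i + c (node i) t) * S y + f (node i) t (S y) = y) ∧
        ∀ y z, (κ - lam + P i) * |S y - S z| ≤ |y - z| := by
    intro i
    by_cases hi : i ∈ interior
    · obtain ⟨S, h1, h2⟩ := exists_lipschitz_inverse
        (G := fun v => (κ + P i + c (node i) t) * v + f (node i) t v) (μ := κ - lam + P i)
        ((continuous_const.mul continuous_id).add
          (hf.cont _ (node_mem_cube hN hi) _ ht)) (by linarith [hP0 i hi]) (fun v w hvw => by
          have h3 := hf.lipschitz _ (node_mem_cube hN hi) _ ht v w hvw
          have h4 := mul_nonneg (hc0 i hi) (sub_nonneg.2 hvw)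
          linarith)
      exact ⟨S, fun _ => ⟨h1, h2⟩⟩
    · exact ⟨id, fun h => absurd h hi⟩
  choose S hS using hS
  -- One Jacobi sweep: with frozen neighbours the equation at a node is a scalar strongly monotone
  -- one. The sweep has Lipschitz factor `P / (κ - lam + P)` at each interior node.
  set Ψ : (Idx d N → ℝ) → Idx d N → ℝ := fun W i =>
    if i ∈ interior then S i (Nb W i - g i) else 0 with hΨ
  have hNbl : ∀ W W' : Idx d N → ℝ, ∀ i ∈ interior, |Nb W i - Nb W' i| ≤ P i * dist W W' := by
    intro W W' i hi
    simp only [hNb, hP]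
    rw [← Finset.sum_sub_distrib, Finset.sum_mul]
    refine (Finset.abs_sum_le_sum_abs _ _).trans (Finset.sum_le_sum fun k _ => ?_)
    obtain ⟨h1, h2⟩ := weights_nonneg hL hN hmax ht hi k
    have h3 : ∀ j, |W j - W' j| ≤ dist W W' := fun j => by
      rw [← Real.dist_eq]
      exact dist_le_pi_dist W W' j
    calc |wNext a b t i k * W (next k i) + wPrev a b t i k * W (prev k i) -
          (wNext a b t i k * W' (next k i) + wPrev a b t i k * W' (prev k i))|
        = |wNext a b t i k * (W (next k i) - W' (next k i)) +
            wPrev a b t i k * (W (prev k i) - W' (prev k i))| := by ring_nf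
      _ ≤ wNext a b t i k * |W (next k i) - W' (next k i)| +
            wPrev a b t i k * |W (prev k i) - W' (prev k i)| := by
          refine (abs_add_le _ _).trans ?_
          rw [abs_mul, abs_mul, abs_of_nonneg h1, abs_of_nonneg h2]
      _ ≤ wNext a b t i k * dist W W' + wPrev a b t i k * dist W W' := by
          gcongr
          · exact h3 _
          · exact h3 _
      _ = _ := by ring
  set Pm : ℝ := ∑ i, |P i| with hPm
  have hPm0 : 0 ≤ Pm := Finset.sum_nonneg fun i _ => abs_nonneg _
  have hPle : ∀ i, P i ≤ Pm := fun i => (le_abs_self _).trans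
    (Finset.single_le_sum (f := fun i => |P i|) (fun i _ => abs_nonneg _) (Finset.mem_univ i))
  have hδ : 0 < κ - lam := by linarith
  -- `x / (κ - lam + x)` increases in `x ≥ 0`, so an upper bound of all `P i` gives a common
  -- contraction factor.
  set ρ : ℝ := Pm / (κ - lam + Pm) with hρ
  have hρ0 : 0 ≤ ρ := by positivity
  have hρ1 : ρ < 1 := by
    rw [hρ, div_lt_one (by linarith)]
    linarith
  have hcontr : ContractingWith (NNReal.mk ρ hρ0) Ψ := by
    refine ⟨by exact_mod_cast hρ1, LipschitzWith.of_dist_le_mul fun W W' => ?_⟩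
    rw [NNReal.coe_mk, dist_pi_le_iff (by positivity)]
    intro i
    simp only [hΨ]
    split_ifs with hi
    · rw [Real.dist_eq]
      have h1 := (hS i hi).2 (Nb W i - g i) (Nb W' i - g i)
      rw [sub_sub_sub_cancel_right] at h1
      have h2 := h1.trans (hNbl W W' i hi)
      have h3 : 0 < κ - lam + P i := by linarith [hP0 i hi]
      have h4 : P i / (κ - lam + P i) ≤ ρ := by
        rw [hρ, div_le_div_iff₀ h3 (by linarith)]
        nlinarith [hPle i, hP0 i hi]
      have h5 : |S i (Nb W i - g i) - S i (Nb W' i - g i)| ≤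
          P i / (κ - lam + P i) * dist W W' := by
        rw [div_mul_eq_mul_div, le_div_iff₀ h3]
        linarith
      exact h5.trans (mul_le_mul_of_nonneg_right h4 dist_nonneg)
    · rw [dist_self]
      positivity
  have hfix : Ψ (hcontr.fixedPoint Ψ) = hcontr.fixedPoint Ψ := hcontr.fixedPoint_isFixedPt
  set V := hcontr.fixedPoint Ψ with hV
  refine ⟨V, fun i hi => ?_, fun i hi => ?_⟩
  · rw [← hfix]
    simp only [hΨ, if_neg hi]
  · have h1 : S i (Nb V i - g i) = V i := by
      have := congrFun hfix i
      simpa only [hΨ, if_pos hi] using this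
    have h2 := (hS i hi).1 (Nb V i - g i)
    rw [h1] at h2
    have h3 : fdOp a b c t V i = P i * V i - Nb V i + c (node i) t * V i := by
      rw [fdOp_eq]
      simp only [hP, hNb]
      rw [Finset.sum_mul, ← Finset.sum_sub_distrib]
      congr 1
      exact Finset.sum_congr rfl fun k _ => by ring
    rw [h3]
    linarith

theorem exists_discreteSolution {α T lam : ℝ} {M : ℕ} {t : ℕ → ℝ} (hα' : α < 1)
    (ht : IsTemporalMesh T M t) {a b : Fin d → (Fin d → ℝ) → ℝ → ℝ}
    {c : (Fin d → ℝ) → ℝ → ℝ} (hL : EllipticCoeffs T a b c) (hN : 1 ≤ N)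
    (hmax : DiscreteMaxCond T a b N) {f : (Fin d → ℝ) → ℝ → ℝ → ℝ} (hf : A1 T f lam)
    (hlam : ∀ j ∈ Finset.Icc 1 M, lam * (t j - t (j - 1)) ^ α < (Real.Gamma (2 - α))⁻¹)
    (u₀ : (Fin d → ℝ) → ℝ) :
    ∃ U : ℕ → Idx d N → ℝ, IsDiscreteSolution α a b c f u₀ M t N U := by
  suffices H : ∀ n ≤ M, ∃ U : ℕ → Idx d N → ℝ, IsDiscreteSolution α a b c f u₀ n t N U from
    H M le_rfl
  intro n
  induction n with
  | zero =>
    intro _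
    refine ⟨fun _ i => u₀ (node i), ⟨?_, ?_, fun _ => rfl⟩⟩
    · intro m hm
      have := Finset.mem_Icc.1 hm
      omega
    · intro m hm
      have := Finset.mem_Icc.1 hm
      omega
  | succ n ih =>
    intro hn
    obtain ⟨U, hU⟩ := ih (by omega)
    have hmem : n + 1 ∈ Finset.Icc 1 M := Finset.mem_Icc.2 ⟨by omega, hn⟩
    -- The known history: the L1 operator at `t (n + 1)` is `l1Coeff * V + g`.
    set g : Idx d N → ℝ := fun i => (Real.Gamma (1 - α))⁻¹ *
      (∑ j ∈ Finset.range n, kerAvg α t (n + 1) j * (U (j + 1) i - U j i) -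
        kerAvg α t (n + 1) n * U n i) with hg
    obtain ⟨V, hV0, hV⟩ := exists_step hL hN hmax hf (lam_lt_l1Coeff ht hmem (hlam _ hmem))
      (ht.mem_Ioc hmem) g
    have hne : ∀ j ≤ n, Function.update U (n + 1) V j = U j := fun j hj =>
      Function.update_of_ne (by omega) _ _
    have hself : Function.update U (n + 1) V (n + 1) = V := Function.update_self _ _ _
    refine ⟨Function.update U (n + 1) V, ⟨fun m hm i hi => ?_, fun m hm i hi => ?_, fun i => ?_⟩⟩
    · have hm' := Finset.mem_Icc.1 hm
      rcases hm'.2.eq_or_lt with rfl | hlt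
      · have h1 : l1 α t (fun j => Function.update U (n + 1) V j i) (n + 1) =
            l1Coeff α t (n + 1) * V i + g i := by
          rw [l1_eq, Finset.sum_range_succ, hself, hne n le_rfl, l1Coeff_eq hα' ht hn, hg]
          have h2 : ∑ j ∈ Finset.range n, kerAvg α t (n + 1) j *
              (Function.update U (n + 1) V (j + 1) i - Function.update U (n + 1) V j i) =
              ∑ j ∈ Finset.range n, kerAvg α t (n + 1) j * (U (j + 1) i - U j i) := by
            refine Finset.sum_congr rfl fun j hj => ?_
            have := Finset.mem_range.1 hj
            rw [hne (j + 1) (by omega), hne j (by omega)]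
          rw [h2]
          ring
        rw [h1, hself]
        exact hV i hi
      · have hmn : m ∈ Finset.Icc 1 n := Finset.mem_Icc.2 ⟨hm'.1, by omega⟩
        have h1 : l1 α t (fun j => Function.update U (n + 1) V j i) m =
            l1 α t (fun j => U j i) m :=
          l1_congr α t fun j hj => by rw [hne j (by omega)]
        rw [h1, hne m (by omega)]
        exact hU.equation m hmn i hi
    · have hm' := Finset.mem_Icc.1 hm
      rcases hm'.2.eq_or_lt with rfl | hlt
      · rw [hself]
        exact hV0 i hi
      · rw [hne m (by omega)]
        exact hU.boundary m (Finset.mem_Icc.2 ⟨hm'.1, by omega⟩) i hi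
    · rw [hne 0 (by omega)]
      exact hU.initial i

end

/-! ### Assembly of the error estimate. -/

section
variable {d : ℕ}

/-- On `(0,T)` one has `1 ≤ T^(l-α) s^(α-l)`, so the constant `1` in the regularity bound is
absorbed into the singular power. -/
theorem TimeRegular.exists_weaklySingular {α T : ℝ} {a b : Fin d → (Fin d → ℝ) → ℝ → ℝ}
    {c : (Fin d → ℝ) → ℝ → ℝ} {f : (Fin d → ℝ) → ℝ → ℝ → ℝ} {u₀ : (Fin d → ℝ) → ℝ}
    {u : (Fin d → ℝ) → ℝ → ℝ} (hα' : α < 1) (hT : 0 < T)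
    (hu : IsSolution α T a b c f u₀ u) (htr : TimeRegular α T u) :
    ∃ K : ℝ, 0 ≤ K ∧ ∀ x ∈ cube d, WeaklySingular α T K (u x) := by
  obtain ⟨K, hK⟩ := htr
  have hT1 : 0 < T ^ (1 - α) := Real.rpow_pos_of_pos hT _
  have hT2 : 0 < T ^ (2 - α) := Real.rpow_pos_of_pos hT _
  set K' : ℝ := |K| * (T ^ (1 - α) + T ^ (2 - α) + 1) with hK'
  have key : ∀ l : ℝ, α < l → T ^ (l - α) ≤ T ^ (1 - α) + T ^ (2 - α) → ∀ s ∈ Ioo 0 T,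
      K * (1 + s ^ (α - l)) ≤ K' * s ^ (α - l) := by
    intro l hl hTl s hs
    have h0 := Real.rpow_pos_of_pos hs.1 (α - l)
    have h1 : 1 ≤ T ^ (l - α) * s ^ (α - l) := by
      rw [← neg_sub l α, Real.rpow_neg hs.1.le, ← div_eq_mul_inv,
        one_le_div (Real.rpow_pos_of_pos hs.1 _)]
      exact Real.rpow_le_rpow hs.1.le hs.2.le (by linarith)
    have h2 := mul_le_mul_of_nonneg_right hTl h0.le
    calc K * (1 + s ^ (α - l)) ≤ |K| * (1 + s ^ (α - l)) := by
          gcongr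
          exact le_abs_self K
      _ ≤ |K| * ((T ^ (1 - α) + T ^ (2 - α) + 1) * s ^ (α - l)) := by
          gcongr
          linarith
      _ = _ := by rw [hK']; ring
  refine ⟨K', by positivity, fun x hx => ⟨hu.cont_time x hx, hu.diff_time x hx,
    fun s hs => ?_, fun s hs => ?_, fun s hs => ?_⟩⟩
  · have := (hK x hx s hs).1 1 one_lt_two
    rwa [iteratedDeriv_one] at this
  · have := (hK x hx s hs).2 1 (Or.inl rfl)
    rw [iteratedDeriv_one, Nat.cast_one] at this
    exact this.trans (key 1 hα' (by linarith) s hs)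
  · have := (hK x hx s hs).2 2 (Or.inr rfl)
    rw [iteratedDeriv_succ, iteratedDeriv_one, Nat.cast_ofNat] at this
    exact this.trans (key 2 (by linarith) (by linarith) s hs)

/-- No joint continuity is assumed, so compactness is used only at `t = T`; the bound on the time
derivative carries it back to earlier times uniformly in `x`. -/
theorem IsSolution.exists_abs_le {α T K : ℝ} {a b : Fin d → (Fin d → ℝ) → ℝ → ℝ}
    {c : (Fin d → ℝ) → ℝ → ℝ} {f : (Fin d → ℝ) → ℝ → ℝ → ℝ} {u₀ : (Fin d → ℝ) → ℝ}
    {u : (Fin d → ℝ) → ℝ → ℝ} (hα : 0 < α) (hT : 0 < T) (hK : 0 ≤ K)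
    (hu : IsSolution α T a b c f u₀ u) (hw : ∀ x ∈ cube d, WeaklySingular α T K (u x)) :
    ∃ B : ℝ, ∀ x ∈ cube d, ∀ t ∈ Ioc 0 T, |u x t| ≤ B := by
  obtain ⟨C, hC⟩ := isCompact_closedCube.exists_bound_of_continuousOn
    (hu.cont_space T ⟨hT, le_rfl⟩)
  refine ⟨C + K / α * T ^ α, fun x hx t ht => ?_⟩
  have h1 := abs_sub_le_of_deriv_le hα (hw x hx).cont (hw x hx).diff (hw x hx).bound
    ht.1.le ht.2 le_rfl
  have h2 : |u x T| ≤ C := hC x (cube_subset_closedCube hx)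
  have h3 : K / α * (T ^ α - t ^ α) ≤ K / α * T ^ α := by
    have := Real.rpow_pos_of_pos ht.1 α
    gcongr
    linarith
  have h4 := abs_sub_abs_le_abs_sub (u x t) (u x T)
  rw [abs_sub_comm] at h4
  linarith

/-- The error bound in terms of an admissible exponent `p` of the temporal truncation error. -/
theorem exists_supNorm_error_le {α T lam r c₁ c₂ c₃ q p : ℝ}
    {a b : Fin d → (Fin d → ℝ) → ℝ → ℝ} {c : (Fin d → ℝ) → ℝ → ℝ}
    {f : (Fin d → ℝ) → ℝ → ℝ → ℝ} {u₀ : (Fin d → ℝ) → ℝ} {u : (Fin d → ℝ) → ℝ → ℝ}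
    (hα : 0 < α) (hα' : α < 1) (hT : 0 < T) (hL : EllipticCoeffs T a b c) (hf : A1 T f lam)
    (hu : IsSolution α T a b c f u₀ u) (htr : TimeRegular α T u) (hsr : SpaceRegular T u)
    (hr : 1 ≤ r) (hc₁ : 0 < c₁) (hc₂ : 0 < c₂) (hc₃ : 0 < c₃) (hq : q < 1) (hp0 : 0 ≤ p)
    (hp1 : p ≠ 1) (hpr : p < 1 + 1 / r) (hpα : p < 1 + α) (hpr' : p ≤ (2 - α) / r) :
    ∃ C : ℝ, 0 ≤ C ∧ ∀ (M : ℕ) (t : ℕ → ℝ) (N : ℕ), 1 ≤ N → IsTemporalMesh T M t →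
      QuasiGraded r c₁ c₂ c₃ M t →
      (∀ j ∈ Finset.Icc 1 M, lam * (t j - t (j - 1)) ^ α ≤ q * (Real.Gamma (2 - α))⁻¹) →
      DiscreteMaxCond T a b N → ∀ U : ℕ → Idx d N → ℝ,
      IsDiscreteSolution α a b c f u₀ M t N U → ∀ m ∈ Finset.Icc 1 M,
        supNorm interior (fun i => u (node i) (t m) - U m i) ≤
          C * (t m ^ α * (t 1 / t m) ^ min p 1 + t m ^ α * (1 / (N : ℝ)) ^ 2) := by
  have hr0 : 0 < r := by linarith
  obtain ⟨K, hK0, hK⟩ := htr.exists_weaklySingular hα' hT hu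
  obtain ⟨B, hB⟩ := hu.exists_abs_le hα hT hK0 hK
  obtain ⟨C₁, hC₁, htime⟩ := exists_l1_sub_caputo_le (T := T) hα hα' hr hc₃ hK0 hpα hpr'
  obtain ⟨C₂, hspace⟩ := exists_fdOp_sub_ellipticOp_le hL hu.cont_space hB hsr
  obtain ⟨D₁, hD₁, hbar₁⟩ := exists_l1_barrier_lam hα hα' hT hf.lam_nonneg hr hc₁ hc₂ hc₃ hq
    hp0 hp1 hpr
  -- The spatial error is bounded by a constant in time, a source of exponent `0`; its barrier
  -- supplies the factor `t_m^α`.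
  obtain ⟨D₂, hD₂, hbar₂⟩ := exists_l1_barrier_lam (p := 0) hα hα' hT hf.lam_nonneg hr hc₁ hc₂
    hc₃ hq le_rfl zero_ne_one (by positivity)
  refine ⟨C₁ * D₁ + |C₂| * D₂, by positivity, fun M t N hN ht hqg hlam hmax U hU m₀ hm₀ => ?_⟩
  obtain ⟨B₁, hB₁0, hB₁, hB₁m⟩ := hbar₁ M t ht hqg hlam m₀ hm₀
  obtain ⟨B₂, hB₂0, hB₂, hB₂m⟩ := hbar₂ M t ht hqg hlam m₀ hm₀
  have hm₀M := (Finset.mem_Icc.1 hm₀).2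
  have hGam := inv_pos.2 (Gamma_two_sub_pos hα')
  set e : ℕ → Idx d N → ℝ := fun j i => u (node i) (t j) - U j i with he
  set H : ℝ := |C₂| * (1 / (N : ℝ)) ^ 2 with hH
  have hH0 : 0 ≤ H := by positivity
  have hcomp : supNorm interior (e m₀) ≤ C₁ * B₁ m₀ + H * B₂ m₀ := by
    refine l1_comparison (E := fun j => supNorm interior (e j))
      (B := fun j => C₁ * B₁ j + H * B₂ j) hα hα' ht
      (fun j hj => (hlam j hj).trans_lt (by nlinarith)) hm₀M ?_ (fun m hm => ?_) m₀ le_rfl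
    · refine (Real.sSup_nonpos ?_).trans (by positivity)
      rintro _ ⟨i, hi, rfl⟩
      simp only [he, hU.initial, ht.zero, hu.initial _ (node_mem_cube hN hi), sub_self, abs_zero,
        le_refl]
    have hmM : m ∈ Finset.Icc 1 M :=
      Finset.mem_Icc.2 ⟨(Finset.mem_Icc.1 hm).1, (Finset.mem_Icc.1 hm).2.trans hm₀M⟩
    have htm := ht.mem_Ioc hmM
    have ht1 : 0 < t 1 := (ht.mem_Ioc (Finset.mem_Icc.2 ⟨le_rfl, ht.one_le⟩)).1
    have hx0 : 0 ≤ (t 1 / t m) ^ p := Real.rpow_nonneg (div_nonneg ht1.le htm.1.le) _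
    have hR : l1 α t (fun j => supNorm interior (e j)) m - lam * supNorm interior (e m) ≤
        C₁ * (t 1 / t m) ^ p + H := by
      refine l1_supNorm_sub_le
        (p := fun i => f (node i) (t m) (u (node i) (t m)) - f (node i) (t m) (U m i))
        hα hα' ht hL hN hmax (by positivity) hmM (fun i hi => ?_) (fun i hi => ?_) fun i hi => ?_
      · simp only [he]
        rw [hU.boundary m hmM i hi, hu.boundary _ ⟨node_mem_closedCube hN i,
          fun h => hi ((node_mem_cube_iff hN).1 h)⟩ _ htm, sub_self]
      · exact hf.sign (node_mem_cube hN hi) htm _ _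
      · have hxi := node_mem_cube hN hi
        have h1 := hU.equation m hmM i hi
        have h2 := hu.equation _ hxi _ htm
        have h3 := htime M t ht hqg.step _ (hK _ hxi) (hu.caputo_integrable _ hxi) m hmM
        have h4 := (hspace _ htm N hN i hi).trans
          (mul_le_mul_of_nonneg_right (le_abs_self C₂) (by positivity))
        simp only [he]
        rw [l1_sub, fdOp_sub]
        rw [abs_le] at h3 h4 ⊢
        constructor <;> linarith [h3.1, h3.2, h4.1, h4.2]
    have h1 := mul_le_mul_of_nonneg_left (hB₁ m hm) hC₁
    have h2 := mul_le_mul_of_nonneg_left (hB₂ m hm) hH0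
    rw [Real.rpow_zero] at h2
    rw [l1_add, l1_smul, l1_smul]
    linarith
  have htm := ht.mem_Ioc hm₀
  have ht1 : 0 < t 1 := (ht.mem_Ioc (Finset.mem_Icc.2 ⟨le_rfl, ht.one_le⟩)).1
  have hX0 : 0 ≤ t m₀ ^ α * (t 1 / t m₀) ^ min p 1 :=
    mul_nonneg (Real.rpow_nonneg htm.1.le _) (Real.rpow_nonneg (div_nonneg ht1.le htm.1.le) _)
  have hY0 : 0 ≤ t m₀ ^ α * (1 / (N : ℝ)) ^ 2 :=
    mul_nonneg (Real.rpow_nonneg htm.1.le _) (by positivity)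
  rw [min_eq_left zero_le_one, Real.rpow_zero, mul_one] at hB₂m
  have h1 := mul_le_mul_of_nonneg_left hB₁m hC₁
  have h2 := mul_le_mul_of_nonneg_left hB₂m hH0
  have h3 : 0 ≤ C₁ * D₁ := by positivity
  have h4 : 0 ≤ |C₂| * D₂ := by positivity
  calc supNorm interior (e m₀) ≤ C₁ * B₁ m₀ + H * B₂ m₀ := hcomp
    _ ≤ C₁ * D₁ * (t m₀ ^ α * (t 1 / t m₀) ^ min p 1) +
        |C₂| * D₂ * (t m₀ ^ α * (1 / (N : ℝ)) ^ 2) := by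
      rw [hH] at h2 ⊢
      linarith
    _ ≤ _ := by
      have h5 := mul_nonneg h3 hY0
      have h6 := mul_nonneg h4 hX0
      linarith

/-- For every grading exponent the truncation error has an admissible exponent that yields the
temporal error term. -/
theorem exists_exponent {α T r c₁ c₂ c₃ ε : ℝ} (hα : 0 < α) (hα' : α < 1) (hr : 1 ≤ r)
    (hc₁ : 0 < c₁) (hc₂ : 0 < c₂) (hε : 0 < ε) :
    ∃ p C : ℝ, 0 ≤ p ∧ p ≠ 1 ∧ p < 1 + 1 / r ∧ p < 1 + α ∧ p ≤ (2 - α) / r ∧ 0 ≤ C ∧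
      ∀ (M : ℕ) (t : ℕ → ℝ), IsTemporalMesh T M t → QuasiGraded r c₁ c₂ c₃ M t →
        ∀ m ∈ Finset.Icc 1 M,
          t m ^ α * (t 1 / t m) ^ min p 1 ≤ C * temporalError α r ε M (t m) := by
  have hr0 : 0 < r := by linarith
  have hr1 : 0 < 1 / r := by positivity
  have hpow : ∀ (M : ℕ) (s y : ℝ), 1 ≤ M → 0 < s →
      s ^ α * ((M : ℝ) ^ (-r) / s) ^ y = (M : ℝ) ^ (-r * y) * s ^ (α - y) := by
    intro M s y hM hs
    have hM0 : (0 : ℝ) < M := by exact_mod_cast hM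
    rw [Real.div_rpow (Real.rpow_nonneg hM0.le _) hs.le, ← Real.rpow_mul hM0.le,
      Real.rpow_sub hs]
    ring
  have hle : ∀ (M : ℕ) (t : ℕ → ℝ), IsTemporalMesh T M t → QuasiGraded r c₁ c₂ c₃ M t →
      ∀ m ∈ Finset.Icc 1 M, ∀ y : ℝ, 0 ≤ y →
        t m ^ α * (t 1 / t m) ^ y ≤
          c₂ ^ y * (t m ^ α * ((M : ℝ) ^ (-r) / t m) ^ y) := by
    intro M t ht hqg m hm y hy
    have htm := (ht.mem_Ioc hm).1
    have ht1 : 0 < t 1 := (ht.mem_Ioc (Finset.mem_Icc.2 ⟨le_rfl, ht.one_le⟩)).1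
    have hM0 : (0 : ℝ) < M := by exact_mod_cast ht.one_le
    have h1 : (t 1 / t m) ^ y ≤ (c₂ * ((M : ℝ) ^ (-r) / t m)) ^ y := by
      refine Real.rpow_le_rpow (by positivity) ?_ hy
      rw [← mul_div_assoc]
      exact div_le_div_of_nonneg_right hqg.upper htm.le
    rw [Real.mul_rpow hc₂.le (by positivity)] at h1
    have h2 := mul_le_mul_of_nonneg_left h1 (Real.rpow_nonneg htm.le α)
    linarith
  rcases lt_trichotomy r (2 - α) with hlt | heq | hgt
  · have h1 : 1 < (2 - α) / r := by rwa [one_lt_div hr0]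
    have h2 : (2 - α) / r < 1 + 1 / r := by
      rw [div_lt_iff₀ hr0, add_mul, one_div_mul_cancel hr0.ne']
      linarith
    have h3 := min_le_left (α / 2) ((2 - α) / r - 1)
    have h4 := min_le_right (α / 2) ((2 - α) / r - 1)
    have h5 : 0 < min (α / 2) ((2 - α) / r - 1) := lt_min (by linarith) (by linarith)
    -- An exponent above `1`, below `1 + α` and at most `(2-α)/r`; since `min p 1 = 1`, its exact
    -- value does not matter.
    refine ⟨1 + min (α / 2) ((2 - α) / r - 1), c₂, by linarith, by linarith, by linarith,
      by linarith, by linarith, hc₂.le, fun M t ht hqg m hm => ?_⟩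
    rw [min_eq_right (by linarith), temporalError, if_pos hlt]
    have := hle M t ht hqg m hm 1 zero_le_one
    rw [hpow M _ 1 ht.one_le (ht.mem_Ioc hm).1, mul_one] at this
    simpa only [Real.rpow_one] using this
  · have h1 : (2 - α) / r = 1 := by rw [← heq]; exact div_self hr0.ne'
    -- Any exponent in `(0,1)` not below `1 - ε` serves; the second entry keeps it positive for
    -- large `ε`. The excess power `p - (1 - ε)` is bounded through `M^(-r)/t_m ≤ 1/c₁`.
    set p : ℝ := max (1 - ε) ((1 + α) / 2) with hp
    have hp1 : p < 1 := max_lt (by linarith) (by linarith)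
    have hp0 : 0 < p := lt_max_of_lt_right (by linarith)
    have hpε : 0 ≤ p - (1 - ε) := sub_nonneg.2 (le_max_left _ _)
    refine ⟨p, c₂ ^ p * (1 / c₁) ^ (p - (1 - ε)), hp0.le, hp1.ne, by linarith, by linarith,
      by linarith, by positivity, fun M t ht hqg m hm => ?_⟩
    rw [min_eq_left hp1.le, temporalError, if_neg heq.not_lt, if_pos heq,
      ← hpow M _ _ ht.one_le (ht.mem_Ioc hm).1]
    refine (hle M t ht hqg m hm p hp0.le).trans ?_
    have htm := (ht.mem_Ioc hm).1
    have ht1 : 0 < t 1 := (ht.mem_Ioc (Finset.mem_Icc.2 ⟨le_rfl, ht.one_le⟩)).1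
    have hM0 : (0 : ℝ) < M := by exact_mod_cast ht.one_le
    set X : ℝ := (M : ℝ) ^ (-r) / t m with hX
    have hX0 : 0 < X := by positivity
    have hXc : X ≤ 1 / c₁ := by
      rw [hX, div_le_div_iff₀ htm hc₁, one_mul, mul_comm]
      exact hqg.lower.trans (ht.le (Finset.mem_Icc.1 hm).1 (Finset.mem_Icc.1 hm).2)
    have h2 : X ^ p ≤ (1 / c₁) ^ (p - (1 - ε)) * X ^ (1 - ε) := by
      calc X ^ p = X ^ (p - (1 - ε)) * X ^ (1 - ε) := by
            rw [← Real.rpow_add hX0, sub_add_cancel]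
        _ ≤ _ := by
            gcongr
    calc c₂ ^ p * (t m ^ α * X ^ p)
        ≤ c₂ ^ p * (t m ^ α * ((1 / c₁) ^ (p - (1 - ε)) * X ^ (1 - ε))) := by gcongr
      _ = _ := by ring
  · have h1 : (2 - α) / r < 1 := by rwa [div_lt_one hr0]
    have h0 : 0 < (2 - α) / r := div_pos (by linarith) hr0
    refine ⟨(2 - α) / r, c₂ ^ ((2 - α) / r), h0.le, h1.ne, by linarith, by linarith, le_rfl,
      by positivity, fun M t ht hqg m hm => ?_⟩
    rw [min_eq_left h1.le, temporalError, if_neg hgt.not_gt, if_neg hgt.ne']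
    have := hle M t ht hqg m hm _ h0.le
    rw [hpow M _ _ ht.one_le (ht.mem_Ioc hm).1] at this
    have h2 : -r * ((2 - α) / r) = α - 2 := by
      field_simp
      ring
    rwa [h2] at this

end

end FracFD

end

theorem theorem6p1 {d : ℕ} (hd : 1 ≤ d) (α T : ℝ) (hα : 0 < α) (hα' : α < 1) (hT : 0 < T)
    (a b : Fin d → (Fin d → ℝ) → ℝ → ℝ) (c : (Fin d → ℝ) → ℝ → ℝ)
    (hL : FracFD.EllipticCoeffs T a b c)
    (f : (Fin d → ℝ) → ℝ → ℝ → ℝ) (lam : ℝ) (hf : FracFD.A1 T f lam)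
    (u₀ : (Fin d → ℝ) → ℝ) (hu₀ : MemLp u₀ ⊤ (volume.restrict (FracFD.cube d))) :
    -- existence, uniqueness and range of the discrete solution
    (∀ (M : ℕ) (t : ℕ → ℝ) (N : ℕ), 1 ≤ N → FracFD.IsTemporalMesh T M t →
      (∀ j ∈ Finset.Icc 1 M, lam * (t j - t (j - 1)) ^ α < (Real.Gamma (2 - α))⁻¹) →
      FracFD.DiscreteMaxCond T a b N →
      ∃ U : ℕ → FracFD.Idx d N → ℝ,
        FracFD.IsDiscreteSolution α a b c f u₀ M t N U ∧
        (∀ U' : ℕ → FracFD.Idx d N → ℝ, FracFD.IsDiscreteSolution α a b c f u₀ M t N U' →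
          ∀ m ≤ M, U' m = U m) ∧
        ∀ σ₁ σ₂ : ℝ, FracFD.A2 T f c σ₁ σ₂ →
          (∀ x ∈ FracFD.closedCube d, σ₁ ≤ u₀ x ∧ u₀ x ≤ σ₂) →
          ∀ m ≤ M, ∀ i, σ₁ ≤ U m i ∧ U m i ≤ σ₂) ∧
    -- the error bound
    (∀ u : (Fin d → ℝ) → ℝ → ℝ, FracFD.IsSolution α T a b c f u₀ u →
      FracFD.TimeRegular α T u → FracFD.SpaceRegular T u →
      ∀ r c₁ c₂ c₃ ε q : ℝ, 1 ≤ r → 0 < c₁ → 0 < c₂ → 0 < c₃ → 0 < ε → q < 1 →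
      ∃ C : ℝ, ∀ (M : ℕ) (t : ℕ → ℝ) (N : ℕ), 1 ≤ N → FracFD.IsTemporalMesh T M t →
        FracFD.QuasiGraded r c₁ c₂ c₃ M t →
        (∀ j ∈ Finset.Icc 1 M, lam * (t j - t (j - 1)) ^ α ≤ q * (Real.Gamma (2 - α))⁻¹) →
        FracFD.DiscreteMaxCond T a b N →
        ∀ U : ℕ → FracFD.Idx d N → ℝ, FracFD.IsDiscreteSolution α a b c f u₀ M t N U →
          ∀ m ∈ Finset.Icc 1 M,
            FracFD.supNorm FracFD.interior (fun i => u (FracFD.node i) (t m) - U m i)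
              ≤ C * (FracFD.temporalError α r ε M (t m) + t m ^ α * (1 / (N : ℝ)) ^ 2)) := by
  refine ⟨fun M t N hN ht hlam hmax => ?_,
    fun u hu htr hsr r c₁ c₂ c₃ ε q hr hc₁ hc₂ hc₃ hε hq => ?_⟩
  · obtain ⟨U, hU⟩ := FracFD.exists_discreteSolution hα' ht hL hN hmax hf hlam u₀
    exact ⟨U, hU, fun U' hU' => FracFD.discreteSolution_unique hα hα' ht hL hN hmax hf hlam hU hU',
      fun σ₁ σ₂ hA2 h0 => FracFD.discreteSolution_range hα hα' ht hL hN hmax hf hlam hU hA2 h0⟩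
  · obtain ⟨p, C₁, hp0, hp1, hpr, hpα, hpr', hC₁, hexp⟩ :=
      FracFD.exists_exponent (T := T) (c₃ := c₃) hα hα' hr hc₁ hc₂ hε
    obtain ⟨C, hC, herr⟩ := FracFD.exists_supNorm_error_le hα hα' hT hL hf hu htr hsr hr hc₁ hc₂
      hc₃ hq hp0 hp1 hpr hpα hpr'
    refine ⟨C * (C₁ + 1), fun M t N hN ht hqg hlam hmax U hU m hm => ?_⟩
    refine (herr M t N hN ht hqg hlam hmax U hU m hm).trans ?_
    have htm := (ht.mem_Ioc hm).1
    have h1 := hexp M t ht hqg m hm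
    have h2 : 0 ≤ FracFD.temporalError α r ε M (t m) := by
      unfold FracFD.temporalError
      split_ifs <;> positivity
    have h3 : 0 ≤ t m ^ α * (1 / (N : ℝ)) ^ 2 := by positivity
    rw [mul_assoc]
    refine mul_le_mul_of_nonneg_left ?_ hC
    linarith [mul_nonneg hC₁ h3]
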